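/- Let $d\ge 2$ and $1\le k\le d-1$. Let $\Pi$ be a discrete torsion-free group of orientation-preserving isometries of $\mathbb{H}^d$, let $M=\Pi\backslash\mathbb{H}^d$ be the corresponding oriented complete hyperbolic manifold, and let $\mathcal F(M)=\Pi\backslash\mathcal F(\mathbb H^d)$ be its bundle of oriented orthonormal frames, with projection $\pi:\mathcal F(M)\to M$. A geodesic $j$-submanifold of $M$ is a properly immersed totally geodesic submanifold $N=\mathrm{Stab}_\Pi(P)\backslash P\to M$, where $P\subset\mathbb H^d$ is a totally geodesic $j$-plane. Its frame measure $\mu_N$ is the measure on $\mathcal F(M)$ supported on the frames based on $N$ whose first $j$ vectors are tangent to $N$, given locally by the hyperbolic volume of $N$ times the invariant probability measure on the fibre (a torsor under $S(O(j)\times O(d-j))$; both local orientations of $N$ have weight $\frac12$). For a geodesic $k$-submanifold $\Gamma$ and a geodesic $(d-k)$-submanifold $S$, let $I(\Gamma,S)$ be the sum of the Dirac measures at the transverse intersection points of $\Gamma$ and $S$, where a point is weighted by its multiplicity, i.e. by the number of pairs of a sheet of $\Gamma$ and a sheet of $S$ through the point that are transverse there. More generally $\Gamma$ and $S$ may be finite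 formal sums of geodesic $k$- and $(d-k)$-submanifolds with nonnegative real weights; $\mu_\Gamma$, $\mu_S$ and $I(\Gamma,S)$ are then extended linearly, respectively bilinearly. For a frame $u=(u_1,\dots,u_d)$ of $\mathbb H^d$ let $B^j_\delta(u)$ be the ball of radius $\delta$ around the base point of $u$ in the totally geodesic $j$-plane tangent to $u_1,\dots,u_j$. For $\delta>0$ put $\mathbb K_\delta(u,v)=1/c_\delta$ with $c_\delta=\mathrm{vol}(B^k_\delta(u))\,\mathrm{vol}(B^{d-k}_\delta(v))$ if the closed balls $\overline{B^k_\delta(u)}$ and $\overline{B^{d-k}_\delta(v)}$ intersect (are not disjoint) and do so transversely, and $\mathbb K_\delta(u,v)=0$ otherwise. Let $K_\delta(u,v)=\sum_{g\in\Pi}\mathbb K_\delta(g\tilde u,\tilde v)$ for $u,v\in\mathcal F(M)$ with any lifts $\tilde u,\tilde v\in\mathcal F(\mathbb H^d)$. Then for every real-valued $f\in C_c(M)$, the function $f$ is $I(\Gamma,S)$-integrable; for every $\delta>0$ the iterated integral below converges absolutely, in the sense that its inner integrand is $\mu_\Gamma$-integrable for every $v\in\mathcal F(M)$ and the inner integral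 is $\mu_S$-integrable as a function of $v$; and $$\int_M f\,dI(\Gamma,S)=\lim_{\delta\to0^+}\int_{\mathcal F(M)}\int_{\mathcal F(M)} f(\pi(v))\,K_\delta(u,v)\,d\mu_\Gamma(u)\,d\mu_S(v).$$ -/

import Mathlib

open Filter Topology MeasureTheory
open scoped NNReal ENNReal Pointwise

noncomputable section

namespace HypGeom

/-! ### Hyperbolic space: the hyperboloid model -/

/-- The Lorentz form `-x₀y₀ + x₁y₁ + ⋯ + x_d y_d` on `ℝ^{d+1}`. -/
def lorentz {d : ℕ} (x y : Fin (d + 1) → ℝ) : ℝ :=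
  -(x 0 * y 0) + ∑ i : Fin d, x i.succ * y i.succ

/-- Hyperbolic `d`-space `ℍ^d`: the upper sheet of the hyperboloid `⟨x, x⟩ = -1`. -/
abbrev HSpace (d : ℕ) : Type := {x : Fin (d + 1) → ℝ // lorentz x x = -1 ∧ 0 < x 0}

/-- The hyperbolic distance, `cosh d(x, y) = -⟨x, y⟩`. -/
def hdist {d : ℕ} (x y : HSpace d) : ℝ := Real.arcosh (-(lorentz x.1 y.1))

/-- The point `o = (1, 0, …, 0)` of `ℍ^d`. -/
def origin (d : ℕ) : HSpace d :=
  ⟨Fin.cons 1 (fun _ => 0), by simp [lorentz], by simp⟩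

theorem lorentz_neg_neg {d : ℕ} (x : Fin (d + 1) → ℝ) :
    lorentz (-x) (-x) = lorentz x x := by
  simp [lorentz]

/-- `SO⁺(d,1)`, acting on `ℍ^d` as the group `Isom⁺(ℍ^d)` of orientation preserving isometries:
the matrices of determinant one that preserve the Lorentz form and map `ℍ^d` to itself. -/
def SOplus (d : ℕ) : Subgroup (Matrix.SpecialLinearGroup (Fin (d + 1)) ℝ) where
  carrier := {A | (∀ x y : Fin (d + 1) → ℝ,
      lorentz (A.1.mulVec x) (A.1.mulVec y) = lorentz x y) ∧
    ∀ x : HSpace d, 0 < A.1.mulVec x.1 0}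
  one_mem' := by
    refine ⟨fun x y => by simp, fun x => by simpa using x.2.2⟩
  mul_mem' := by
    rintro A B ⟨hA, hA'⟩ ⟨hB, hB'⟩
    refine ⟨fun x y => ?_, fun x => ?_⟩
    · simp only [Matrix.SpecialLinearGroup.coe_mul, ← Matrix.mulVec_mulVec]
      rw [hA, hB]
    · simp only [Matrix.SpecialLinearGroup.coe_mul, ← Matrix.mulVec_mulVec]
      exact hA' ⟨B.1.mulVec x.1, by rw [hB]; exact x.2.1, hB' x⟩
  inv_mem' := by
    rintro A ⟨hA, hA'⟩
    have key : ∀ x, A.1.mulVec ((A⁻¹).1.mulVec x) = x := fun x => by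
      rw [Matrix.mulVec_mulVec, ← Matrix.SpecialLinearGroup.coe_mul]; simp
    have hinv : ∀ x y, lorentz ((A⁻¹).1.mulVec x) ((A⁻¹).1.mulVec y) = lorentz x y :=
      fun x y => by rw [← hA, key, key]
    refine ⟨hinv, fun x => ?_⟩
    set w := (A⁻¹).1.mulVec x.1 with hw
    have hww : lorentz w w = -1 := by rw [hw, hinv]; exact x.2.1
    by_contra hcon
    have hne : w 0 ≠ 0 := by
      intro h0
      have : 0 ≤ lorentz w w := by
        simp only [lorentz, h0, mul_zero, neg_zero, zero_add]
        exact Finset.sum_nonneg fun i _ => mul_self_nonneg _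
      linarith
    have hlt : w 0 < 0 := lt_of_le_of_ne (not_lt.mp hcon) hne
    have h1 := hA' ⟨-w, by rw [lorentz_neg_neg]; exact hww, by simpa using hlt⟩
    simp only [Matrix.mulVec_neg, hw, key] at h1
    have h2 := x.2.2
    simp only [Pi.neg_apply] at h1
    linarith

/-- The isometry action of `SO⁺(d,1)` on `ℍ^d`. -/
instance instMulActionHSpace (d : ℕ) : MulAction (SOplus d) (HSpace d) where
  smul A x := ⟨A.1.1.mulVec x.1, by rw [A.2.1]; exact x.2.1, A.2.2 x⟩
  one_smul x := Subtype.ext (by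
    change ((1 : SOplus d)).1.1.mulVec x.1 = x.1
    simp)
  mul_smul A B x := Subtype.ext (by
    change (A * B).1.1.mulVec x.1 = A.1.1.mulVec (B.1.1.mulVec x.1)
    simp [Matrix.mulVec_mulVec])

/-- The Borel `σ`-algebra on `SO⁺(d,1)`. -/
instance instMeasurableSpaceSOplus (d : ℕ) : MeasurableSpace (SOplus d) := borel _

instance instBorelSpaceSOplus (d : ℕ) : BorelSpace (SOplus d) := ⟨rfl⟩

/-! ### Frames

A positively oriented orthonormal frame `(u₁, …, u_d)` at a point `x` of `ℍ^d` is the matrix with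
columns `x, u₁, …, u_d`.  The tangent space at `x` is the Lorentz complement of `x`, so the matrices
that arise in this way are exactly the elements of `SO⁺(d,1)`, and an isometry `g` acts on frames
as multiplication by `g` from the left. -/

/-- The oriented orthonormal frame bundle `F(ℍ^d)`. -/
abbrev Frame (d : ℕ) : Type := SOplus d

/-- The base point of a frame. -/
def basePt {d : ℕ} (v : Frame d) : HSpace d := v • origin d

/-- The span in `ℝ^{d+1}` of the base point and the first `k` vectors of a frame. -/
def planeSpan {d : ℕ} (v : Frame d) (k : ℕ) : Submodule ℝ (Fin (d + 1) → ℝ) :=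
  Submodule.span ℝ {w | ∃ i : Fin (d + 1), (i : ℕ) ≤ k ∧ w = fun r => v.1.1 r i}

/-- The totally geodesic `k`-plane in `ℍ^d` tangent to the first `k` vectors of the frame `v`. -/
def plane {d : ℕ} (v : Frame d) (k : ℕ) : Set (HSpace d) := {x | x.1 ∈ planeSpan v k}

/-- The open ball `B^k_δ(v)` around the base point of `v` in the `k`-plane tangent to `v`. -/
def geoBall {d : ℕ} (k : ℕ) (δ : ℝ) (v : Frame d) : Set (HSpace d) :=
  {x ∈ plane v k | hdist (basePt v) x < δ}

/-- The closed ball around the base point of `v` in the `k`-plane tangent to `v`. -/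
def geoClosedBall {d : ℕ} (k : ℕ) (δ : ℝ) (v : Frame d) : Set (HSpace d) :=
  {x ∈ plane v k | hdist (basePt v) x ≤ δ}

/-- The tangent space of `ℍ^d` at `x`. -/
def tangentSpaceAt {d : ℕ} (x : HSpace d) : Submodule ℝ (Fin (d + 1) → ℝ) where
  carrier := {w | lorentz x.1 w = 0}
  add_mem' := by
    intro a b ha hb
    simp only [Set.mem_ofPred_eq, lorentz, Pi.add_apply, mul_add, Finset.sum_add_distrib] at *
    linarith
  zero_mem' := by simp [lorentz]
  smul_mem' := by
    intro c a ha
    simp only [Set.mem_ofPred_eq] at *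
    have : lorentz x.1 (c • a) = c * lorentz x.1 a := by
      simp only [lorentz, Pi.smul_apply, smul_eq_mul, mul_add, Finset.mul_sum]
      congr 1
      · ring
      · exact Finset.sum_congr rfl fun i _ => by ring
    rw [this, ha, mul_zero]

/-- For linear subspaces `V`, `W` of `ℝ^{d+1}` through the point `x` of `ℍ^d`: the totally geodesic
submanifolds `ℍ^d ∩ V` and `ℍ^d ∩ W`, whose tangent spaces at `x` are `V ∩ T_x ℍ^d` and
`W ∩ T_x ℍ^d`, meet transversely at `x`. -/
def TransverseAt {d : ℕ} (x : HSpace d) (V W : Submodule ℝ (Fin (d + 1) → ℝ)) : Prop :=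
  x.1 ∈ V ∧ x.1 ∈ W ∧
    (V ⊓ tangentSpaceAt x) ⊔ (W ⊓ tangentSpaceAt x) = tangentSpaceAt x

/-! ### Volume and frame measures on a geodesic plane in `ℍ^d` -/

/-- The vector `(y, 0) ∈ ℝ^d` for `y ∈ ℝ^k`. -/
def pad {k : ℕ} (d : ℕ) (y : EuclideanSpace ℝ (Fin k)) : Fin d → ℝ :=
  fun i => if h : (i : ℕ) < k then y ⟨i, h⟩ else 0

/-- `√(1 + |z|²)`. -/
def boostTime {d : ℕ} (z : Fin d → ℝ) : ℝ := √(1 + ∑ i, z i ^ 2)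

/-- The matrix of the Lorentz boost that takes `o` to `(√(1 + |z|²), z)`. -/
def boostMatrix {d : ℕ} (z : Fin d → ℝ) : Matrix (Fin (d + 1)) (Fin (d + 1)) ℝ :=
  Matrix.of (Fin.cons (Fin.cons (boostTime z) z)
    (fun i => Fin.cons (z i) (fun j => (if i = j then 1 else 0) + z i * z j / (1 + boostTime z))))

theorem boostTime_sq {d : ℕ} (z : Fin d → ℝ) : boostTime z ^ 2 = 1 + ∑ i, z i ^ 2 :=
  Real.sq_sqrt (by positivity)

theorem boostTime_pos {d : ℕ} (z : Fin d → ℝ) : 0 < boostTime z :=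
  Real.sqrt_pos.mpr (by positivity)

theorem boost_mulVec_zero {d : ℕ} (z : Fin d → ℝ) (x : Fin (d + 1) → ℝ) :
    (boostMatrix z).mulVec x 0 = boostTime z * x 0 + ∑ i, z i * x i.succ := by
  simp [Matrix.mulVec, dotProduct, Fin.sum_univ_succ, boostMatrix]

theorem boost_mulVec_succ {d : ℕ} (z : Fin d → ℝ) (x : Fin (d + 1) → ℝ) (i : Fin d) :
    (boostMatrix z).mulVec x i.succ =
      x i.succ + z i * (x 0 + (∑ j, z j * x j.succ) / (1 + boostTime z)) := by
  simp only [Matrix.mulVec, dotProduct, Fin.sum_univ_succ, boostMatrix, Matrix.of_apply,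
    Fin.cons_succ, Fin.cons_zero, add_mul, Finset.sum_add_distrib]
  simp only [ite_mul, one_mul, zero_mul, Finset.sum_ite_eq, Finset.mem_univ, if_true]
  rw [mul_add, mul_div_assoc', Finset.mul_sum, Finset.sum_div]
  have : ∀ j, z i * z j / (1 + boostTime z) * x j.succ
      = z i * (z j * x j.succ) / (1 + boostTime z) := fun j => by ring
  simp only [this]
  ring

theorem boost_lorentz {d : ℕ} (z : Fin d → ℝ) (x y : Fin (d + 1) → ℝ) :
    lorentz ((boostMatrix z).mulVec x) ((boostMatrix z).mulVec y) = lorentz x y := by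
  have hc := boostTime_sq z
  have hp := boostTime_pos z
  simp only [lorentz, boost_mulVec_zero, boost_mulVec_succ]
  set c := boostTime z
  set X := ∑ i, z i * x i.succ with hX
  set Y := ∑ i, z i * y i.succ with hY
  set a := x 0 + X / (1 + c) with ha
  set b := y 0 + Y / (1 + c) with hb
  have hsum : ∑ i : Fin d, (x i.succ + z i * a) * (y i.succ + z i * b)
      = ∑ i : Fin d, x i.succ * y i.succ + b * X + a * Y + a * b * ∑ i, z i ^ 2 := by
    rw [hX, hY, Finset.mul_sum, Finset.mul_sum, Finset.mul_sum, ← Finset.sum_add_distrib,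
      ← Finset.sum_add_distrib, ← Finset.sum_add_distrib]
    exact Finset.sum_congr rfl fun i _ => by ring
  have hz : ∑ i, z i ^ 2 = c ^ 2 - 1 := by linarith
  rw [hsum, hz, ha, hb]
  have h1 : (1 + c) ≠ 0 := by positivity
  field_simp
  ring

theorem boost_continuous (d : ℕ) : Continuous fun z : Fin d → ℝ => boostMatrix z := by
  have hb : Continuous fun z : Fin d → ℝ => boostTime z := by
    unfold boostTime
    fun_prop
  refine continuous_matrix fun i j => ?_
  refine Fin.cases ?_ (fun i => ?_) i <;> refine Fin.cases ?_ (fun j => ?_) j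
  · simpa [boostMatrix] using hb
  · simpa [boostMatrix] using continuous_apply j
  · simpa [boostMatrix] using continuous_apply i
  · simp only [boostMatrix, Matrix.of_apply, Fin.cons_succ]
    refine continuous_const.add (Continuous.div (by fun_prop) (by fun_prop) fun z => ?_)
    have := boostTime_pos z
    positivity

theorem boost_zero (d : ℕ) : boostMatrix (0 : Fin d → ℝ) = 1 := by
  ext i j
  refine Fin.cases ?_ (fun i => ?_) i <;> refine Fin.cases ?_ (fun j => ?_) j
  · simp [boostMatrix, boostTime]
  · simp [boostMatrix]
    rfl
  · simp [boostMatrix]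
  · simp [boostMatrix, Matrix.one_apply]

theorem det_sq_of_lorentz {d : ℕ} (A : Matrix (Fin (d + 1)) (Fin (d + 1)) ℝ)
    (hA : ∀ x y, lorentz (A.mulVec x) (A.mulVec y) = lorentz x y) : A.det ^ 2 = 1 := by
  set J : Matrix (Fin (d + 1)) (Fin (d + 1)) ℝ :=
    Matrix.diagonal (Fin.cons (-1) fun _ => 1) with hJ
  have hl : ∀ x y, dotProduct x (J.mulVec y) = lorentz x y := fun x y => by
    simp [hJ, dotProduct, Matrix.mulVec_diagonal, Fin.sum_univ_succ, lorentz]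
  have hM : A.transpose * J * A = J := by
    ext i j
    have h := hA (Pi.single i 1) (Pi.single j 1)
    rw [← hl, ← hl, Matrix.mulVec_mulVec, Matrix.dotProduct_mulVec,
      Matrix.vecMul_mulVec, Matrix.dotProduct_mulVec] at h
    simpa [Matrix.mul_assoc] using h
  have hJd : J.det ≠ 0 := by
    rw [hJ, Matrix.det_diagonal, Fin.prod_univ_succ]
    simp
  have h2 := congrArg Matrix.det hM
  rw [Matrix.det_mul, Matrix.det_mul, Matrix.det_transpose] at h2
  have : J.det * (A.det ^ 2 - 1) = 0 := by linear_combination h2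
  have := (mul_eq_zero.mp this).resolve_left hJd
  linarith

theorem boost_det {d : ℕ} (z : Fin d → ℝ) : (boostMatrix z).det = 1 := by
  have hsq := fun w : Fin d → ℝ => det_sq_of_lorentz (boostMatrix w) (boost_lorentz w)
  have hc : Continuous fun t : ℝ => (boostMatrix (t • z)).det :=
    ((boost_continuous d).comp (by fun_prop)).matrix_det
  rcases sq_eq_sq_iff_eq_or_eq_neg.mp ((hsq z).trans (one_pow 2).symm) with h | h
  · exact h
  · exfalso
    have h0 : (0 : ℝ) ∈ Set.Icc ((boostMatrix ((1 : ℝ) • z)).det)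
        ((boostMatrix ((0 : ℝ) • z)).det) := by
      rw [one_smul, zero_smul, boost_zero, h, Matrix.det_one]
      norm_num
    obtain ⟨t, -, ht⟩ := intermediate_value_Icc' zero_le_one hc.continuousOn h0
    have := hsq (t • z)
    simp only at ht
    rw [ht] at this
    norm_num at this

theorem boost_pos {d : ℕ} (z : Fin d → ℝ) (x : HSpace d) :
    0 < (boostMatrix z).mulVec x.1 0 := by
  rw [boost_mulVec_zero]
  obtain ⟨x, hx, hx0⟩ := x
  simp only
  have hc := boostTime_sq z
  have hp := boostTime_pos z
  have hcs := Finset.sum_mul_sq_le_sq_mul_sq Finset.univ z (fun i => x i.succ)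
  have hs : ∑ i : Fin d, x i.succ ^ 2 = x 0 ^ 2 - 1 := by
    simp only [lorentz, ← sq] at hx
    linarith
  rw [hs] at hcs
  by_contra hcon
  have h1 : boostTime z * x 0 ≤ -∑ i, z i * x i.succ := by linarith
  have h2 := mul_self_le_mul_self (by positivity) h1
  have hz : 0 ≤ ∑ i, z i ^ 2 := by positivity
  nlinarith [mul_pos hx0 hx0]

/-- The boost as an isometry of `ℍ^d`: the translation along the geodesic from `o` to the point
`(√(1 + |z|²), z)`. -/
def boost {d : ℕ} (z : Fin d → ℝ) : SOplus d :=
  ⟨⟨boostMatrix z, boost_det z⟩, boost_lorentz z, boost_pos z⟩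

/-- The hyperbolic volume measure of `ℍ^k`, in the coordinates `y ↦ (√(1 + |y|²), y)`. -/
def hypVolume (k : ℕ) : Measure (EuclideanSpace ℝ (Fin k)) :=
  volume.withDensity fun y => ENNReal.ofReal (1 / √(1 + ‖y‖ ^ 2))

/-- The `k`-dimensional hyperbolic volume measure on the `k`-plane tangent to `v`, as a measure
on `ℍ^d`. -/
def planeVolume {d : ℕ} (k : ℕ) (v : Frame d) : Measure (HSpace d) :=
  (hypVolume k).map fun y => basePt (v * boost (pad d y))

/-- The group `S(O(k) × O(d-k))` of isometries that fix `o` and preserve the `k`-plane tangent to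
the standard frame.  It acts simply transitively, from the right, on the frames at a given point
of a `k`-plane whose first `k` vectors are tangent to the plane. -/
def rotGroup (d k : ℕ) : Subgroup (SOplus d) :=
  MulAction.stabilizer (SOplus d) (origin d) ⊓
    MulAction.stabilizer (SOplus d) (plane (1 : Frame d) k)

theorem val_isEmbedding (d : ℕ) :
    IsEmbedding fun A : SOplus d => (A.1.1 : Matrix (Fin (d + 1)) (Fin (d + 1)) ℝ) :=
  IsEmbedding.subtypeVal.comp IsEmbedding.subtypeVal

instance instSecondCountableSOplus (d : ℕ) : SecondCountableTopology (SOplus d) :=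
  haveI : SecondCountableTopology (Matrix (Fin (d + 1)) (Fin (d + 1)) ℝ) :=
    inferInstanceAs (SecondCountableTopology (Fin (d + 1) → Fin (d + 1) → ℝ))
  (val_isEmbedding d).secondCountableTopology

theorem lorentz_origin {d : ℕ} (x : Fin (d + 1) → ℝ) : lorentz x (origin d).1 = -x 0 := by
  simp [lorentz, origin]

/-- The matrices of the elements of `rotGroup d k`. -/
def rotMatrices (d k : ℕ) : Set (Matrix (Fin (d + 1)) (Fin (d + 1)) ℝ) :=
  {M | M.det = 1 ∧ (∀ x y, lorentz (M.mulVec x) (M.mulVec y) = lorentz x y) ∧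
    M.mulVec (origin d).1 = (origin d).1 ∧
    ∀ x ∈ plane (1 : Frame d) k,
      M.mulVec x.1 ∈ planeSpan (1 : Frame d) k ∧
      M.adjugate.mulVec x.1 ∈ planeSpan (1 : Frame d) k}

theorem rotMatrices_zero {d k : ℕ} {M : Matrix (Fin (d + 1)) (Fin (d + 1)) ℝ}
    (hM : M ∈ rotMatrices d k) (x : Fin (d + 1) → ℝ) : M.mulVec x 0 = x 0 := by
  have h := hM.2.1 x (origin d).1
  rw [hM.2.2.1, lorentz_origin, lorentz_origin] at h
  linarith

theorem rotMatrices_compact (d k : ℕ) : IsCompact (rotMatrices d k) := by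
  have hcl : IsClosed (rotMatrices d k) := by
    have hE : IsClosed (planeSpan (1 : Frame d) k : Set (Fin (d + 1) → ℝ)) :=
      Submodule.closed_of_finiteDimensional _
    have hlor : Continuous fun p : (Fin (d + 1) → ℝ) × (Fin (d + 1) → ℝ) => lorentz p.1 p.2 := by
      unfold lorentz
      fun_prop
    have hmv : ∀ x : Fin (d + 1) → ℝ,
        Continuous fun M : Matrix (Fin (d + 1)) (Fin (d + 1)) ℝ => M.mulVec x := fun x =>
      continuous_id.matrix_mulVec continuous_const
    have hma : ∀ x : Fin (d + 1) → ℝ,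
        Continuous fun M : Matrix (Fin (d + 1)) (Fin (d + 1)) ℝ => M.adjugate.mulVec x := fun x =>
      continuous_id.matrix_adjugate.matrix_mulVec continuous_const
    unfold rotMatrices
    simp only [Set.ofPred_and, Set.ofPred_forall]
    refine (isClosed_eq continuous_id.matrix_det continuous_const).inter (IsClosed.inter ?_
      (IsClosed.inter (isClosed_eq (hmv _) continuous_const) ?_))
    · exact isClosed_iInter fun x => isClosed_iInter fun y =>
        isClosed_eq (hlor.comp ((hmv x).prodMk (hmv y))) continuous_const
    · exact isClosed_iInter fun x => isClosed_iInter fun _ =>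
        (hE.preimage (hmv x.1)).inter (hE.preimage (hma x.1))
  have hK : IsCompact (Set.pi Set.univ fun _ : Fin (d + 1) =>
      Set.pi Set.univ fun _ : Fin (d + 1) => Set.Icc (-1 : ℝ) 1) :=
    isCompact_univ_pi fun _ => isCompact_univ_pi fun _ => isCompact_Icc
  refine hK.of_isClosed_subset hcl fun (M : Matrix (Fin (d + 1)) (Fin (d + 1)) ℝ) hM i _ j _ => ?_
  have hcol : ∀ r, M.mulVec (Pi.single j 1) r = M r j := fun r => by simp
  have h0 : M 0 j = (Pi.single j 1 : Fin (d + 1) → ℝ) 0 := by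
    rw [← hcol, rotMatrices_zero hM]
  have hn := hM.2.1 (Pi.single j 1) (Pi.single j 1)
  have hle : M i j ^ 2 ≤ 1 := by
    have hsum : ∀ x : Fin (d + 1) → ℝ, ∑ r, x r ^ 2 = lorentz x x + 2 * x 0 ^ 2 := fun x => by
      rw [Fin.sum_univ_succ, lorentz]
      simp only [← sq]
      ring
    have h1 := hsum (M.mulVec (Pi.single j 1))
    have h2 := hsum (Pi.single j 1)
    rw [hn, hcol, h0, ← h2] at h1
    have h3 : ∑ r, (Pi.single j 1 : Fin (d + 1) → ℝ) r ^ 2 = 1 := by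
      rw [Finset.sum_eq_single j] <;> simp +contextual
    rw [h3] at h1
    rw [← h1, ← hcol]
    exact Finset.single_le_sum (f := fun r => M.mulVec (Pi.single j 1) r ^ 2)
      (fun r _ => sq_nonneg _) (Finset.mem_univ i)
  exact abs_le.mp ((sq_le_one_iff_abs_le_one _).mp hle)

theorem rotGroup_image (d k : ℕ) :
    (fun A : SOplus d => (A.1.1 : Matrix (Fin (d + 1)) (Fin (d + 1)) ℝ)) '' (rotGroup d k) =
      rotMatrices d k := by
  have hadj : ∀ A : SOplus d, (A⁻¹ : SOplus d).1.1 = A.1.1.adjugate := fun A => by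
    rw [Subgroup.coe_inv, Matrix.SpecialLinearGroup.coe_inv]
  ext M
  constructor
  · rintro ⟨A, ⟨hA, hA'⟩, rfl⟩
    have hA2 : A • plane (1 : Frame d) k = plane (1 : Frame d) k := hA'
    refine ⟨A.1.2, A.2.1, congrArg Subtype.val (show A • origin d = origin d from hA),
      fun x hx => ⟨?_, ?_⟩⟩
    · have : A • x ∈ plane (1 : Frame d) k := by
        rw [← hA2]
        exact Set.smul_mem_smul_set hx
      exact this
    · rw [← hadj]
      have : A⁻¹ • x ∈ plane (1 : Frame d) k := by
        rw [← hA2] at hx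
        exact Set.mem_smul_set_iff_inv_smul_mem.mp hx
      exact this
  · intro hM
    let A : SOplus d := ⟨⟨M, hM.1⟩, hM.2.1, fun x => by
      rw [rotMatrices_zero hM]
      exact x.2.2⟩
    refine ⟨A, ⟨Subtype.ext hM.2.2.1, ?_⟩, rfl⟩
    change A • plane (1 : Frame d) k = plane (1 : Frame d) k
    refine Set.Subset.antisymm ?_ fun x hx => ?_
    · rintro _ ⟨x, hx, rfl⟩
      exact (hM.2.2.2 x hx).1
    · rw [Set.mem_smul_set_iff_inv_smul_mem]
      have := (hM.2.2.2 x hx).2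
      change (A⁻¹ : SOplus d).1.1.mulVec x.1 ∈ planeSpan (1 : Frame d) k
      rw [hadj]
      exact this

instance instCompactRotGroup (d k : ℕ) : CompactSpace (rotGroup d k) := by
  change CompactSpace (rotGroup d k : Set (SOplus d))
  rw [← isCompact_iff_compactSpace, (val_isEmbedding d).isCompact_iff, rotGroup_image]
  exact rotMatrices_compact d k

/-- The invariant probability measure on `S(O(k) × O(d-k))`. -/
def rotMeasure (d k : ℕ) : Measure (rotGroup d k) :=
  Measure.haarMeasure ⊤

/-- The measure on the set of frames in `ℍ^d` tangent to the `k`-plane of `v`: hyperbolic volume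
on the plane times the invariant probability measure on each fibre.  (Both choices of orientation
of the plane have weight `1/2`, and for each of them the vectors of the frame are distributed
by normalized spherical measures.) -/
def planeFrameMeasure {d : ℕ} (k : ℕ) (v : Frame d) : Measure (Frame d) :=
  ((hypVolume k).prod (rotMeasure d k)).map fun p => v * boost (pad d p.1) * (p.2 : SOplus d)

/-! ### Hyperbolic manifolds, their frame bundles and geodesic submanifolds -/

/-- The hyperbolic manifold `M = Δ \ ℍ^d`. -/
abbrev Mfd {d : ℕ} (Δ : Subgroup (SOplus d)) : Type := MulAction.orbitRel.Quotient Δ (HSpace d)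

/-- The oriented orthonormal frame bundle `F(M) = Δ \ F(ℍ^d)` of `M = Δ \ ℍ^d`. -/
abbrev FrameBundle {d : ℕ} (Δ : Subgroup (SOplus d)) : Type :=
  MulAction.orbitRel.Quotient Δ (Frame d)

/-- The covering map `ℍ^d → M`. -/
def toMfd {d : ℕ} (Δ : Subgroup (SOplus d)) (x : HSpace d) : Mfd Δ := Quotient.mk _ x

/-- The covering map `F(ℍ^d) → F(M)`. -/
def toFrameBundle {d : ℕ} (Δ : Subgroup (SOplus d)) (v : Frame d) : FrameBundle Δ :=
  Quotient.mk _ v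

/-- The base point projection `π : F(M) → M`. -/
def proj {d : ℕ} (Δ : Subgroup (SOplus d)) : FrameBundle Δ → Mfd Δ :=
  Quotient.lift (fun v => toMfd Δ (basePt v)) (by
    rintro v w ⟨g, rfl⟩
    exact Quotient.sound ⟨g, (mul_smul (g : SOplus d) w (origin d)).symm⟩)

/-- The stabilizer in `Δ` of the `k`-plane tangent to `v`. -/
def planeStab {d : ℕ} (Δ : Subgroup (SOplus d)) (v : Frame d) (k : ℕ) : Subgroup (SOplus d) :=
  Δ ⊓ MulAction.stabilizer (SOplus d) (plane v k)

/-- The `k`-plane tangent to `v` with the action of its stabilizer in `Δ`. -/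
def planeAction {d : ℕ} (Δ : Subgroup (SOplus d)) (v : Frame d) (k : ℕ) :
    SubMulAction (planeStab Δ v k) (HSpace d) where
  carrier := plane v k
  smul_mem' := by
    rintro ⟨g, hg⟩ x hx
    have h : g • plane v k = plane v k := hg.2
    change g • x ∈ plane v k
    rw [← h]
    exact Set.smul_mem_smul_set hx

/-- The immersed totally geodesic submanifold of `M` covered by the `k`-plane `P` of `v`, as an
abstract manifold: `N = Stab_Δ(P) \ P`. -/
abbrev Leaf {d : ℕ} (Δ : Subgroup (SOplus d)) (v : Frame d) (k : ℕ) : Type :=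
  MulAction.orbitRel.Quotient (planeStab Δ v k) (planeAction Δ v k)

/-- The immersion `N = Stab_Δ(P) \ P → M = Δ \ ℍ^d`. -/
def leafImmersion {d : ℕ} (Δ : Subgroup (SOplus d)) (v : Frame d) (k : ℕ) :
    Leaf Δ v k → Mfd Δ :=
  Quotient.lift (fun x => toMfd Δ x.1) (by
    rintro x y ⟨g, rfl⟩
    exact Quotient.sound ⟨⟨g.1, g.2.1⟩, rfl⟩)

/-- A geodesic `k`-submanifold of `M`: a properly immersed totally geodesic submanifold of
dimension `k`.  It is given by a frame that is tangent to one of its lifts to `ℍ^d`. -/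
structure GeodesicSubmanifold {d : ℕ} (Δ : Subgroup (SOplus d)) (k : ℕ) where
  /-- a frame tangent to a lift of the submanifold -/
  frame : Frame d
  /-- the submanifold is properly immersed -/
  proper : IsProperMap (leafImmersion Δ frame k)

/-- The lifts to `ℍ^d` of a geodesic submanifold of `M` (the translates under `Δ` of one of them),
each given as a linear subspace of `ℝ^{d+1}`. -/
def GeodesicSubmanifold.lifts {d k : ℕ} {Δ : Subgroup (SOplus d)}
    (N : GeodesicSubmanifold Δ k) : Set (Submodule ℝ (Fin (d + 1) → ℝ)) :=
  {V | ∃ g ∈ Δ, V = planeSpan (g * N.frame) k}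

/-! ### The measure `μ_N` on the frame bundle of `M` -/

/-- `D` is a Borel set of frames that contains exactly one frame of each orbit of `Λ`. -/
def IsStrictFundDomain {d : ℕ} (Λ : Subgroup (SOplus d)) (D : Set (Frame d)) : Prop :=
  MeasurableSet D ∧ ∀ v : Frame d, ∃! g : Λ, g • v ∈ D

theorem exists_fundDomain {d : ℕ} (Λ : Subgroup (SOplus d)) [DiscreteTopology Λ] :
    ∃ D, IsStrictFundDomain Λ D := by
  obtain ⟨W, hW, hW1⟩ : ∃ W ∈ 𝓝 (1 : SOplus d), ∀ g ∈ Λ, g ∈ W → g = 1 := by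
    have h : ({1} : Set Λ) ∈ 𝓝 (1 : Λ) := by simp
    obtain ⟨W, hW, hW1⟩ := mem_nhds_subtype _ _ _ |>.mp h
    refine ⟨W, hW, fun g hg hgW => ?_⟩
    exact congrArg Subtype.val (hW1 (show (⟨g, hg⟩ : Λ) ∈ Subtype.val ⁻¹' W from hgW))
  obtain ⟨V, hVo, hV1, hVV⟩ : ∃ V : Set (SOplus d), IsOpen V ∧ 1 ∈ V ∧
      ∀ a ∈ V, ∀ b ∈ V, a * b⁻¹ ∈ W := by
    have hc : Continuous fun p : SOplus d × SOplus d => p.1 * p.2⁻¹ := by fun_prop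
    have hW' : W ∈ 𝓝 ((1 : SOplus d) * 1⁻¹) := by simpa using hW
    have h := hc.continuousAt (x := ((1 : SOplus d), (1 : SOplus d))) hW'
    rw [Filter.mem_map, nhds_prod_eq, Filter.mem_prod_same_iff] at h
    obtain ⟨T, hT, hTW⟩ := h
    obtain ⟨V, hVT, hVo, hV1⟩ := mem_nhds_iff.mp hT
    exact ⟨V, hVo, hV1, fun a ha b hb => hTW (Set.mk_mem_prod (hVT ha) (hVT hb))⟩
  have hUo : ∀ x : SOplus d, IsOpen ((fun v => v * x⁻¹) ⁻¹' V) := fun x =>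
    hVo.preimage (by fun_prop)
  obtain ⟨s, hs, hsU⟩ := TopologicalSpace.countable_cover_nhds
    (f := fun x : SOplus d => (fun v => v * x⁻¹) ⁻¹' V)
    (fun x => (hUo x).mem_nhds (by simpa using hV1))
  have hne : s.Nonempty := by
    by_contra h
    rw [Set.not_nonempty_iff_eq_empty] at h
    simp only [h, Set.mem_empty_iff_false, Set.iUnion_of_empty, Set.iUnion_empty] at hsU
    exact Set.empty_ne_univ hsU
  obtain ⟨u, rfl⟩ := hs.exists_eq_range hne
  let U : ℕ → Set (SOplus d) := fun n => (fun v => v * (u n)⁻¹) ⁻¹' V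
  have hcov : ∀ v, ∃ n, v ∈ U n := fun v => by
    have : v ∈ ⋃ x ∈ Set.range u, (fun v => v * x⁻¹) ⁻¹' V := hsU ▸ Set.mem_univ v
    simpa [U] using this
  let C : ℕ → Set (SOplus d) := fun m => ⋃ g : Λ, (fun v => (g : SOplus d) * v) ⁻¹' U m
  have hCo : ∀ m, IsOpen (C m) := fun m => isOpen_iUnion fun g =>
    (hUo (u m)).preimage (by fun_prop)
  have hCinv : ∀ m v, ∀ g : Λ, (g : SOplus d) * v ∈ C m → v ∈ C m := by
    intro m v g h
    obtain ⟨h', hh⟩ := Set.mem_iUnion.mp h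
    refine Set.mem_iUnion.mpr ⟨h' * g, ?_⟩
    simpa [mul_assoc] using hh
  refine ⟨⋃ n, U n \ ⋃ m, ⋃ _ : m < n, C m, MeasurableSet.iUnion fun n =>
    (hUo (u n)).measurableSet.diff
      (isOpen_iUnion fun m => isOpen_iUnion fun _ => hCo m).measurableSet, fun v => ?_⟩
  classical
  have hex : ∃ n, v ∈ C n := by
    obtain ⟨n, hn⟩ := hcov v
    exact ⟨n, Set.mem_iUnion.mpr ⟨1, by simpa using hn⟩⟩
  have key : ∀ g : Λ, ∀ n, (g : SOplus d) * v ∈ U n \ ⋃ m, ⋃ _ : m < n, C m →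
      n = Nat.find hex := by
    intro g n hn
    have h1 : v ∈ C n := Set.mem_iUnion.mpr ⟨g, hn.1⟩
    refine le_antisymm (not_lt.mp fun hlt => hn.2 ?_) (Nat.find_min' hex h1)
    refine Set.mem_iUnion₂.mpr ⟨Nat.find hex, hlt, ?_⟩
    refine hCinv _ _ g⁻¹ ?_
    simpa using Nat.find_spec hex
  obtain ⟨g, hg⟩ := Set.mem_iUnion.mp (Nat.find_spec hex)
  refine ⟨g, Set.mem_iUnion.mpr ⟨Nat.find hex, hg, fun hmem => ?_⟩, fun g' hg' => ?_⟩
  · obtain ⟨m, hm, hmem⟩ := Set.mem_iUnion₂.mp hmem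
    exact Nat.find_min hex hm (hCinv _ _ g hmem)
  · obtain ⟨n, hn⟩ := Set.mem_iUnion.mp hg'
    have hnn := key g' n hn
    subst hnn
    have h1 := hVV _ hn.1 _ hg
    have h2 : (g' : SOplus d) * v * (u (Nat.find hex))⁻¹ *
        ((g : SOplus d) * v * (u (Nat.find hex))⁻¹)⁻¹ = ((g' * g⁻¹ : Λ) : SOplus d) := by
      push_cast
      group
    have h3 := hW1 _ (g' * g⁻¹).2 (h2 ▸ h1)
    exact mul_inv_eq_one.mp (Subtype.ext h3)

instance instDiscretePlaneStab {d : ℕ} (Δ : Subgroup (SOplus d)) [DiscreteTopology Δ]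
    (v : Frame d) (k : ℕ) : DiscreteTopology (planeStab Δ v k) :=
  DiscreteTopology.of_subset (s := (Δ : Set (SOplus d))) inferInstance inf_le_left

/-- A Borel fundamental domain for the action of a discrete group on frames. -/
def fundDomain {d : ℕ} (Λ : Subgroup (SOplus d)) [DiscreteTopology Λ] : Set (Frame d) :=
  (exists_fundDomain Λ).choose

/-- The measure `μ_N` on `F(M)` of a geodesic submanifold `N = Stab_Δ(P) \ P`.  The set `F_M(N)` of
frames whose first `k` vectors are tangent to `N` is the quotient by `Stab_Δ(P)` of the set of
frames tangent to `P`, and `μ_N` is the measure that the (invariant) measure on the frames tangent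
to `P` induces on this quotient: it is the image of the restriction to a fundamental domain. -/
def frameMeasure {d k : ℕ} (Δ : Subgroup (SOplus d)) [DiscreteTopology Δ]
    (N : GeodesicSubmanifold Δ k) : Measure (FrameBundle Δ) :=
  ((planeFrameMeasure k N.frame).restrict (fundDomain (planeStab Δ N.frame k))).map
    (toFrameBundle Δ)

/-- `μ_Γ` for a finite formal sum `Γ` of geodesic submanifolds with nonnegative weights. -/
def sumFrameMeasure {d k : ℕ} (Δ : Subgroup (SOplus d)) [DiscreteTopology Δ]
    (Γ : GeodesicSubmanifold Δ k →₀ ℝ≥0) : Measure (FrameBundle Δ) :=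
  Γ.sum fun N a => a • frameMeasure Δ N

/-! ### The intersection measure -/

/-- The multiplicity of a point `x` of `M` as a transverse intersection point of `N` and `N'`: the
number of pairs of a sheet of `N` through `x` and a sheet of `N'` through `x` that meet
transversely at `x`. The sheets through `x` correspond to the lifts through a point over `x`. -/
def interMult {d k l : ℕ} {Δ : Subgroup (SOplus d)} (N : GeodesicSubmanifold Δ k)
    (N' : GeodesicSubmanifold Δ l) (x : Mfd Δ) : ℕ∞ :=
  Set.encard {p : Submodule ℝ (Fin (d + 1) → ℝ) × Submodule ℝ (Fin (d + 1) → ℝ) |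
    p.1 ∈ N.lifts ∧ p.2 ∈ N'.lifts ∧ TransverseAt x.out p.1 p.2}

/-- The intersection measure `I(N, N')`: the sum of the Dirac measures at the transverse
intersection points, counted with multiplicity. -/
def interMeasure {d k l : ℕ} {Δ : Subgroup (SOplus d)} (N : GeodesicSubmanifold Δ k)
    (N' : GeodesicSubmanifold Δ l) : Measure (Mfd Δ) :=
  Measure.sum fun x => (interMult N N' x : ℝ≥0∞) • Measure.dirac x

/-- `I(Γ, S)` for finite formal sums of geodesic submanifolds with nonnegative weights. -/
def sumInterMeasure {d k l : ℕ} {Δ : Subgroup (SOplus d)}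
    (Γ : GeodesicSubmanifold Δ k →₀ ℝ≥0) (S : GeodesicSubmanifold Δ l →₀ ℝ≥0) :
    Measure (Mfd Δ) :=
  Γ.sum fun N a => S.sum fun N' b => (a * b) • interMeasure N N'

/-! ### The intersection kernel -/

/-- The closed balls of radius `δ` in the `k`-plane of `u` and in the `l`-plane of `v` intersect
transversely: they have a common point, and at every common point they are transverse. -/
def BallsTransverse {d : ℕ} (k l : ℕ) (δ : ℝ) (u v : Frame d) : Prop :=
  (geoClosedBall k δ u ∩ geoClosedBall l δ v).Nonempty ∧
    ∀ x ∈ geoClosedBall k δ u ∩ geoClosedBall l δ v,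
      TransverseAt x (planeSpan u k) (planeSpan v l)

open Classical in
/-- The intersection kernel `𝕂_δ` on `F(ℍ^d)`. -/
def kernelH {d : ℕ} (k l : ℕ) (δ : ℝ) (u v : Frame d) : ℝ :=
  if BallsTransverse k l δ u v then
    1 / ((planeVolume k u (geoBall k δ u)).toReal * (planeVolume l v (geoBall l δ v)).toReal)
  else 0

/-- The intersection kernel `K_δ(u, v) = ∑_{g ∈ Δ} 𝕂_δ(g ũ, ṽ)` on `F(M)`, where `ũ`, `ṽ` are
any lifts of `u`, `v`. -/
def kernelM {d : ℕ} (Δ : Subgroup (SOplus d)) (k l : ℕ) (δ : ℝ) (u v : FrameBundle Δ) : ℝ :=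
  ∑' g : Δ, kernelH k l δ (g • u.out) v.out

end HypGeom

end

namespace HypGeom

/-! ### The Lorentz form and the action on points -/

section Lorentz

variable {d : ℕ}

/-! By bilinearity it is enough to treat one pair `N`, `N'` of dimensions k and l = d - k. Splitting
f into positive and negative parts moves the work to integrals in `ℝ≥0∞`, where sums and integrals
commute freely.

The inner integral is unfolded. Decomposing Δ into cosets of the stabilizer of the chosen lift of
`N` turns the Poincaré series K_δ, integrated over the frames of `N`, into a sum over all lifts V of
`N` of the integral of 𝕂_δ over the frames tangent to V (`lintegral_poincare`). This uses that the
measure on tangent frames depends only on the plane (`planeFrameMeasure_mul_of_mem_stabilizer`),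
hence on the invariance of hyperbolic volume (`lintegral_hypVolume_comp`) and of Haar measure on the
fibres. Transverse planes of complementary dimensions share at most one point z. If z lies in the
ball of v, the frames of V that see it are those based in the closed δ-ball about z; otherwise there
are none. So the k-dimensional factor of c_δ cancels (`lintegral_kernelH`), and the inner integral
is the number of lifts of `N` that cross the δ-ball of v, divided by the volume of an l-dimensional
δ-ball (`lintegral_kernelM`).

The outer integral is unfolded in the same way. Let Q be the chosen lift of `N'`. Because Δ acts
freely, the lifts of `N` that cross Q correspond to pairs of an intersection point, repeated
according to multiplicity, and an element of the stabilizer of Q in Δ (`crossingLift_bijective`).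
The sum over the stabilizer undoes the fundamental domain, and what remains for every crossing is
the average of f over the δ-ball around it in Q (`lintegral_outer`). Thus for each fixed δ the
iterated integral is exactly the intersection integral, smoothed at scale δ along `N'`.

Properness of the submanifolds and compactness of the support leave finitely many crossings that
matter for all δ ≤ 1 (`exists_finset_ballAverage_eq_zero`), and each average tends to the value at
its centre by continuity (`tendsto_ballAverage`). -/

theorem lorentz_comm (x y : Fin (d + 1) → ℝ) : lorentz x y = lorentz y x := by
  simp only [lorentz, mul_comm]

theorem lorentz_add_right (x y z : Fin (d + 1) → ℝ) :
    lorentz x (y + z) = lorentz x y + lorentz x z := by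
  simp only [lorentz, Pi.add_apply, mul_add, Finset.sum_add_distrib]
  ring

theorem lorentz_smul_right (x y : Fin (d + 1) → ℝ) (c : ℝ) :
    lorentz x (c • y) = c * lorentz x y := by
  simp only [lorentz, Pi.smul_apply, smul_eq_mul, mul_add, Finset.mul_sum]
  congr 1
  · ring
  · exact Finset.sum_congr rfl fun i _ => by ring

theorem lorentz_smul_left (x y : Fin (d + 1) → ℝ) (c : ℝ) :
    lorentz (c • x) y = c * lorentz x y := by
  rw [lorentz_comm, lorentz_smul_right, lorentz_comm]

theorem continuous_lorentz :
    Continuous fun p : (Fin (d + 1) → ℝ) × (Fin (d + 1) → ℝ) => lorentz p.1 p.2 := by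
  unfold lorentz
  fun_prop

theorem smul_val (g : SOplus d) (x : HSpace d) : (g • x).1 = g.1.1.mulVec x.1 := rfl

theorem lorentz_smul_smul (g : SOplus d) (x y : HSpace d) :
    lorentz (g • x).1 (g • y).1 = lorentz x.1 y.1 := g.2.1 _ _

theorem hdist_smul_smul (g : SOplus d) (x y : HSpace d) : hdist (g • x) (g • y) = hdist x y := by
  rw [hdist, hdist, lorentz_smul_smul]

theorem hdist_comm (x y : HSpace d) : hdist x y = hdist y x := by
  rw [hdist, hdist, lorentz_comm]

theorem basePt_mul (g v : SOplus d) : basePt (g * v) = g • basePt v := mul_smul g v _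

theorem mulVec_mul (g h : SOplus d) (x : Fin (d + 1) → ℝ) :
    (g * h).1.1.mulVec x = g.1.1.mulVec (h.1.1.mulVec x) := by
  simp [Matrix.mulVec_mulVec]

theorem one_mulVec' (x : Fin (d + 1) → ℝ) : (1 : SOplus d).1.1.mulVec x = x := by simp

theorem inv_mulVec_mulVec (g : SOplus d) (x : Fin (d + 1) → ℝ) :
    (g⁻¹).1.1.mulVec (g.1.1.mulVec x) = x := by
  rw [← mulVec_mul, inv_mul_cancel, one_mulVec']

theorem mulVec_inv_mulVec (g : SOplus d) (x : Fin (d + 1) → ℝ) :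
    g.1.1.mulVec ((g⁻¹).1.1.mulVec x) = x := by
  rw [← mulVec_mul, mul_inv_cancel, one_mulVec']

theorem basePt_boost (z : Fin d → ℝ) : (basePt (boost z)).1 = Fin.cons (boostTime z) z := by
  funext i
  change (boostMatrix z).mulVec (origin d).1 i = _
  refine Fin.cases ?_ (fun i => ?_) i
  · rw [boost_mulVec_zero]; simp [origin]
  · rw [boost_mulVec_succ]; simp [origin]

theorem sum_sq_succ (x : HSpace d) : ∑ i : Fin d, x.1 i.succ ^ 2 = x.1 0 ^ 2 - 1 := by
  have := x.2.1
  simp only [lorentz, ← sq] at this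
  linarith

theorem boostTime_tail (x : HSpace d) : boostTime (fun i => x.1 (Fin.succ i)) = x.1 0 := by
  rw [boostTime, sum_sq_succ, add_sub_cancel, Real.sqrt_sq x.2.2.le]

theorem basePt_boost_tail (x : HSpace d) : basePt (boost fun i => x.1 (Fin.succ i)) = x := by
  refine Subtype.ext ?_
  rw [basePt_boost, boostTime_tail]
  exact Fin.cons_self_tail x.1

theorem neg_lorentz_basePt_basePt_boost (v : Frame d) (z : Fin d → ℝ) :
    -lorentz (basePt v).1 (basePt (v * boost z)).1 = boostTime z := by
  rw [basePt_mul, basePt, lorentz_smul_smul, lorentz_comm, lorentz_origin, basePt_boost]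
  simp

theorem one_le_boostTime (z : Fin d → ℝ) : 1 ≤ boostTime z := by
  rw [boostTime, Real.one_le_sqrt]
  have : 0 ≤ ∑ i, z i ^ 2 := by positivity
  linarith

theorem exists_basePt_eq_mul_boost (v : Frame d) (x : HSpace d) :
    ∃ z, x = basePt (v * boost z) := by
  refine ⟨fun i => (v⁻¹ • x).1 (Fin.succ i), ?_⟩
  rw [basePt_mul, basePt_boost_tail, smul_inv_smul]

theorem exists_basePt_eq (x : HSpace d) : ∃ v : Frame d, basePt v = x :=
  ⟨_, basePt_boost_tail x⟩

/-- The reversed Cauchy-Schwarz inequality: after moving x to the origin the pairing is the time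
coordinate of a point of the hyperboloid. It places the argument of `Real.arcosh` in the range where
it is monotone. -/
theorem one_le_neg_lorentz (x y : HSpace d) : 1 ≤ -lorentz x.1 y.1 := by
  obtain ⟨v, rfl⟩ := exists_basePt_eq x
  obtain ⟨z, rfl⟩ := exists_basePt_eq_mul_boost v y
  rw [neg_lorentz_basePt_basePt_boost]
  exact one_le_boostTime z

/-- Distance bounds become polynomial inequalities, from which closedness and measurability can be
read off. -/
theorem hdist_le_iff {δ : ℝ} (hδ : 0 ≤ δ) (x y : HSpace d) :
    hdist x y ≤ δ ↔ -lorentz x.1 y.1 ≤ Real.cosh δ := by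
  rw [hdist, ← Real.arcosh_le_arcosh (by linarith [one_le_neg_lorentz x y]) (Real.cosh_pos δ),
    Real.arcosh_cosh hδ]

theorem hdist_lt_iff {δ : ℝ} (hδ : 0 ≤ δ) (x y : HSpace d) :
    hdist x y < δ ↔ -lorentz x.1 y.1 < Real.cosh δ := by
  rw [hdist, ← Real.arcosh_lt_arcosh (by linarith [one_le_neg_lorentz x y]) (Real.cosh_pos δ),
    Real.arcosh_cosh hδ]

end Lorentz

/-! ### Geodesic planes and their linear spans -/

section Planes

variable {d k l : ℕ}

theorem planeSpan_mul (g v : Frame d) (k : ℕ) :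
    planeSpan (g * v) k = (planeSpan v k).map g.1.1.mulVecLin := by
  rw [planeSpan, planeSpan, Submodule.map_span]
  congr 1
  ext w
  constructor
  · rintro ⟨i, hi, rfl⟩
    exact ⟨_, ⟨i, hi, rfl⟩, rfl⟩
  · rintro ⟨_, ⟨i, hi, rfl⟩, rfl⟩
    exact ⟨i, hi, rfl⟩

/-- The columns of the identity are the standard basis, so the model plane is a coordinate subspace;
other planes are reduced to it by `planeSpan_mul`. -/
theorem mem_planeSpan_one {w : Fin (d + 1) → ℝ} :
    w ∈ planeSpan (1 : Frame d) k ↔ ∀ i : Fin (d + 1), k < i → w i = 0 := by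
  have hcol : ∀ i : Fin (d + 1), (fun r => (1 : Frame d).1.1 r i) = Pi.single i (1 : ℝ) := by
    intro i
    funext r
    simp [Matrix.one_apply, Pi.single_apply]
  constructor
  · intro h i hi
    induction h using Submodule.span_induction with
    | mem x hx =>
      obtain ⟨j, hj, rfl⟩ := hx
      have : i ≠ j := by rintro rfl; omega
      simp [this]
    | zero => rfl
    | add x y _ _ hx hy => simp [hx, hy]
    | smul a x _ hx => simp [hx]
  · intro h
    rw [← Finset.univ_sum_single w]
    refine Submodule.sum_mem _ fun i _ => ?_
    by_cases hi : k < i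
    · rw [h i hi, Pi.single_zero]
      exact Submodule.zero_mem _
    · have : Pi.single i (w i) = w i • (Pi.single i (1 : ℝ) : Fin (d + 1) → ℝ) := by
        rw [← Pi.single_smul]; simp
      rw [this]
      exact Submodule.smul_mem _ _ (Submodule.subset_span ⟨i, by omega, (hcol i).symm⟩)

theorem mem_planeSpan_mul {g v : Frame d} {w : Fin (d + 1) → ℝ} :
    w ∈ planeSpan (g * v) k ↔ (g⁻¹).1.1.mulVec w ∈ planeSpan v k := by
  rw [planeSpan_mul]
  constructor
  · rintro ⟨x, hx, rfl⟩
    rw [Matrix.mulVecLin_apply, inv_mulVec_mulVec]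
    exact hx
  · intro h
    exact ⟨_, h, mulVec_inv_mulVec g w⟩

theorem plane_mul (g v : Frame d) (k : ℕ) : plane (g * v) k = g • plane v k := by
  ext x
  rw [Set.mem_smul_set_iff_inv_smul_mem]
  exact mem_planeSpan_mul

theorem smul_mem_plane_mul {g v : Frame d} {x : HSpace d} :
    g • x ∈ plane (g * v) k ↔ x ∈ plane v k := by
  rw [plane_mul, Set.smul_mem_smul_set_iff]

theorem smul_mem_plane {g : Frame d} {x : HSpace d} :
    g • x ∈ plane g k ↔ x ∈ plane (1 : Frame d) k := by
  rw [← smul_mem_plane_mul (g := g) (v := 1), mul_one]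

theorem basePt_mem_plane (v : Frame d) (k : ℕ) : basePt v ∈ plane v k := by
  have h : origin d ∈ plane (1 : Frame d) k := by
    refine mem_planeSpan_one.mpr fun i hi => ?_
    obtain ⟨j, rfl⟩ := Fin.exists_succ_eq.mpr (show i ≠ 0 by rintro rfl; simp at hi)
    simp [origin]
  exact smul_mem_plane.mpr h

/-- The point of the plane of `v` with coordinates `y`. -/
noncomputable def planePoint (v : Frame d) (y : EuclideanSpace ℝ (Fin k)) : HSpace d :=
  basePt (v * boost (pad d y))

theorem planePoint_mul (g v : Frame d) (y : EuclideanSpace ℝ (Fin k)) :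
    planePoint (g * v) y = g • planePoint v y := by
  rw [planePoint, planePoint, mul_assoc, basePt_mul]

theorem sum_pad_sq (hk : k ≤ d) (y : EuclideanSpace ℝ (Fin k)) :
    ∑ i, pad d y i ^ 2 = ‖y‖ ^ 2 := by
  rw [EuclideanSpace.norm_sq_eq]
  obtain ⟨m, rfl⟩ := Nat.exists_eq_add_of_le hk
  rw [Fin.sum_univ_add]
  simp [pad]

theorem boostTime_pad (hk : k ≤ d) (y : EuclideanSpace ℝ (Fin k)) :
    boostTime (pad d y) = √(1 + ‖y‖ ^ 2) := by
  rw [boostTime, sum_pad_sq hk]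

theorem planePoint_one_zero (hk : k ≤ d) (y : EuclideanSpace ℝ (Fin k)) :
    (planePoint (1 : Frame d) y).1 0 = √(1 + ‖y‖ ^ 2) := by
  rw [planePoint, one_mul, basePt_boost, Fin.cons_zero, boostTime_pad hk]

theorem planePoint_one_succ (y : EuclideanSpace ℝ (Fin k)) (i : Fin d) :
    (planePoint (1 : Frame d) y).1 i.succ = pad d y i := by
  rw [planePoint, one_mul, basePt_boost, Fin.cons_succ]

theorem planePoint_mem_plane (v : Frame d) (y : EuclideanSpace ℝ (Fin k)) :
    planePoint v y ∈ plane v k := by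
  rw [← mul_one v, planePoint_mul, smul_mem_plane_mul]
  refine mem_planeSpan_one.mpr fun i hi => ?_
  obtain ⟨j, rfl⟩ := Fin.exists_succ_eq.mpr (show i ≠ 0 by rintro rfl; simp at hi)
  rw [planePoint_one_succ, pad, dif_neg]
  rw [Fin.val_succ] at hi
  omega

/-- After moving v to the identity, the hyperboloid is a graph over its space coordinates, so these
coordinates recover the point. -/
theorem exists_planePoint_eq (hk : k ≤ d) {v : Frame d} {x : HSpace d} (hx : x ∈ plane v k) :
    ∃ y : EuclideanSpace ℝ (Fin k), planePoint v y = x := by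
  obtain ⟨x, rfl⟩ : ∃ x', v • x' = x := ⟨v⁻¹ • x, smul_inv_smul v x⟩
  rw [smul_mem_plane] at hx
  have hx' := mem_planeSpan_one.mp hx
  refine ⟨WithLp.toLp 2 fun i => x.1 (Fin.succ (i.castLE hk)), ?_⟩
  rw [← mul_one v, planePoint_mul, mul_one]
  congr 1
  nth_rw 2 [← basePt_boost_tail x]
  rw [planePoint, one_mul]
  congr 2
  funext i
  rw [pad]
  split_ifs with h
  · rfl
  · exact (hx' i.succ (by rw [Fin.val_succ]; omega)).symm

theorem neg_lorentz_planePoint (hk : k ≤ d) (v : Frame d) (y : EuclideanSpace ℝ (Fin k)) :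
    -lorentz (basePt v).1 (planePoint v y).1 = √(1 + ‖y‖ ^ 2) := by
  rw [planePoint, neg_lorentz_basePt_basePt_boost, boostTime_pad hk]

/-- The hyperbolic cosine of the distance is √(1 + |y|²), so its hyperbolic sine is |y|. Balls of
radius δ in a plane are therefore Euclidean balls of radius sinh δ in the coordinates y. -/
theorem hdist_planePoint (hk : k ≤ d) (v : Frame d) (y : EuclideanSpace ℝ (Fin k)) :
    hdist (basePt v) (planePoint v y) = Real.arsinh ‖y‖ := by
  rw [hdist, neg_lorentz_planePoint hk, ← Real.cosh_arsinh,
    Real.arcosh_cosh (Real.arsinh_nonneg_iff.mpr (norm_nonneg y))]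

theorem hdist_planePoint_le (hk : k ≤ d) (v : Frame d) (y : EuclideanSpace ℝ (Fin k)) {δ : ℝ} :
    hdist (basePt v) (planePoint v y) ≤ δ ↔ ‖y‖ ≤ Real.sinh δ := by
  rw [hdist_planePoint hk, ← Real.arsinh_le_arsinh (y := Real.sinh δ), Real.arsinh_sinh]

theorem hdist_planePoint_lt (hk : k ≤ d) (v : Frame d) (y : EuclideanSpace ℝ (Fin k)) {δ : ℝ} :
    hdist (basePt v) (planePoint v y) < δ ↔ ‖y‖ < Real.sinh δ := by
  rw [hdist_planePoint hk, ← Real.arsinh_lt_arsinh (y := Real.sinh δ), Real.arsinh_sinh]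

theorem planePoint_zero (v : Frame d) :
    planePoint v (0 : EuclideanSpace ℝ (Fin k)) = basePt v := by
  have : pad d (0 : EuclideanSpace ℝ (Fin k)) = 0 := by
    funext i
    simp [pad]
  have hb : boost (0 : Fin d → ℝ) = 1 := Subtype.ext (Subtype.ext (boost_zero d))
  rw [planePoint, this, hb, mul_one]

theorem basePt_boost_single_mem_plane {j : Fin d} (hj : (j.succ : ℕ) ≤ k) :
    basePt (boost (Pi.single j 1)) ∈ plane (1 : Frame d) k := by
  refine mem_planeSpan_one.mpr fun i hi => ?_
  rw [basePt_boost]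
  obtain rfl | ⟨m, rfl⟩ := Fin.eq_zero_or_eq_succ i
  · simp at hi
  · have hne : m ≠ j := by
      rintro rfl
      exact absurd hi (not_lt.mpr hj)
    rw [Fin.cons_succ, Pi.single_eq_of_ne hne]

/-- A plane spans its linear hull. -/
theorem span_plane (v : Frame d) (k : ℕ) :
    Submodule.span ℝ (Subtype.val '' plane v k) = planeSpan v k := by
  refine le_antisymm (Submodule.span_le.mpr ?_) ?_
  · rintro _ ⟨x, hx, rfl⟩
    exact hx
  · have h0 : (basePt v).1 ∈ Submodule.span ℝ (Subtype.val '' plane v k) :=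
      Submodule.subset_span ⟨_, basePt_mem_plane v k, rfl⟩
    refine Submodule.span_le.mpr ?_
    rintro _ ⟨i, hi, rfl⟩
    have hcol : (fun r => v.1.1 r i) = v.1.1.mulVec (Pi.single i 1) := by
      funext r; simp
    have ho : (origin d).1 = Pi.single 0 1 := by
      funext r
      refine Fin.cases ?_ (fun j => ?_) r <;> simp [origin]
    have hb : (basePt v).1 = v.1.1.mulVec (Pi.single 0 1) := by
      rw [← ho]; rfl
    change (fun r => v.1.1 r i) ∈ Submodule.span ℝ (Subtype.val '' plane v k)
    rw [hcol]
    obtain rfl | ⟨j, rfl⟩ := Fin.eq_zero_or_eq_succ i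
    · rwa [← hb]
    -- A column other than the first is the difference of a boosted point of the plane and a
    -- multiple of the base point.
    · have hz : (basePt (v * boost (Pi.single j 1))).1 =
          boostTime (Pi.single j 1) • (basePt v).1 + v.1.1.mulVec (Pi.single j.succ 1) := by
        rw [basePt_mul, smul_val, basePt_boost, hb, ← Matrix.mulVec_smul, ← Matrix.mulVec_add]
        congr 1
        funext r
        obtain rfl | ⟨m, rfl⟩ := Fin.eq_zero_or_eq_succ r
        · simp
        · simp [Pi.single_apply]
      have hmem : basePt (v * boost (Pi.single j 1)) ∈ plane v k := by
        rw [basePt_mul]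
        exact smul_mem_plane.mpr (basePt_boost_single_mem_plane hi)
      have h1 : (basePt (v * boost (Pi.single j 1))).1 ∈
          Submodule.span ℝ (Subtype.val '' plane v k) := Submodule.subset_span ⟨_, hmem, rfl⟩
      rw [hz] at h1
      exact (Submodule.add_mem_iff_right _ (Submodule.smul_mem _ _ h0)).mp h1

/-- Lifts are recorded as linear subspaces, stabilizers through point sets; this passes between the
two. -/
theorem planeSpan_eq_iff {v w : Frame d} : planeSpan v k = planeSpan w k ↔ plane v k = plane w k := by
  constructor
  · intro h
    simp only [plane, h]
  · intro h
    rw [← span_plane, h, span_plane]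

theorem planeSpan_mul_left_cancel {g v w : Frame d} :
    planeSpan (g * v) k = planeSpan (g * w) k ↔ planeSpan v k = planeSpan w k := by
  rw [planeSpan_eq_iff, planeSpan_eq_iff, plane_mul, plane_mul, smul_left_cancel_iff]

theorem finrank_planeSpan (hk : k ≤ d) (v : Frame d) :
    Module.finrank ℝ (planeSpan v k) = k + 1 := by
  have hli : LinearIndependent ℝ fun i : Fin (k + 1) =>
      (fun r => v.1.1 r (i.castLE (Nat.succ_le_succ hk))) := by
    have h1 : LinearIndependent ℝ (v.1.1.transpose : Fin (d + 1) → Fin (d + 1) → ℝ) := by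
      refine Matrix.linearIndependent_rows_of_det_ne_zero ?_
      rw [Matrix.det_transpose, v.1.2]
      exact one_ne_zero
    exact h1.comp _ (Fin.castLE_injective _)
  have := finrank_span_eq_card hli
  rw [Fintype.card_fin] at this
  have hset : {w | ∃ i : Fin (d + 1), (i : ℕ) ≤ k ∧ w = fun r => v.1.1 r i} =
      Set.range fun i : Fin (k + 1) => (fun r => v.1.1 r (i.castLE (Nat.succ_le_succ hk))) := by
    ext w
    constructor
    · rintro ⟨i, hi, rfl⟩
      exact ⟨⟨i, by omega⟩, rfl⟩
    · rintro ⟨i, rfl⟩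
      exact ⟨i.castLE (Nat.succ_le_succ hk), by simp [Nat.lt_succ_iff.mp i.2], rfl⟩
  rw [← this, planeSpan, hset]

/-- Both subspaces contain x, and ℝ^{d+1} is the direct sum of the line through x and the tangent
space at x. So the tangential parts span the tangent space exactly when V and W span everything, a
condition that no longer mentions x. -/
theorem transverseAt_iff {x : HSpace d} {V W : Submodule ℝ (Fin (d + 1) → ℝ)} :
    TransverseAt x V W ↔ x.1 ∈ V ∧ x.1 ∈ W ∧ V ⊔ W = ⊤ := by
  have hmem : ∀ w, w ∈ tangentSpaceAt x ↔ lorentz x.1 w = 0 := fun w => Iff.rfl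
  have hproj : ∀ a, a + lorentz x.1 a • x.1 ∈ tangentSpaceAt x := fun a => by
    rw [hmem, lorentz_add_right, lorentz_smul_right, x.2.1]
    ring
  refine and_congr_right fun hV => and_congr_right fun hW => ⟨fun h => ?_, fun h => ?_⟩
  · refine eq_top_iff.mpr fun a _ => ?_
    have hle : tangentSpaceAt x ≤ V ⊔ W := h ▸ sup_le_sup inf_le_left inf_le_left
    have h1 := Submodule.sub_mem _ (hle (hproj a))
      (Submodule.smul_mem _ (lorentz x.1 a) (Submodule.mem_sup_left (T := W) hV))
    simpa using h1
  · refine le_antisymm (sup_le inf_le_right inf_le_right) fun t ht => ?_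
    obtain ⟨a, ha, b, hb, rfl⟩ := Submodule.mem_sup.mp (h ▸ Submodule.mem_top : t ∈ V ⊔ W)
    refine Submodule.mem_sup.mpr ⟨_, ⟨V.add_mem ha (V.smul_mem (lorentz x.1 a) hV), hproj a⟩,
      _, ⟨W.add_mem hb (W.smul_mem (lorentz x.1 b) hW), hproj b⟩, ?_⟩
    rw [hmem, lorentz_add_right] at ht
    rw [add_add_add_comm, ← add_smul, ht, zero_smul, add_zero]

/-- Transverse planes of complementary dimensions have at most one common point. -/
theorem eq_of_mem_of_sup_eq_top {v w : Frame d} (hk : k ≤ d) (hl : l ≤ d) (hkl : k + l = d)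
    (h : planeSpan v k ⊔ planeSpan w l = ⊤) {x y : HSpace d}
    (hxv : x.1 ∈ planeSpan v k) (hxw : x.1 ∈ planeSpan w l)
    (hyv : y.1 ∈ planeSpan v k) (hyw : y.1 ∈ planeSpan w l) : x = y := by
  -- The intersection has dimension (k + 1) + (l + 1) - (d + 1) = 1, and a line meets the upper
  -- sheet at most once.
  have hr := Submodule.finrank_sup_add_finrank_inf_eq (planeSpan v k) (planeSpan w l)
  rw [h, finrank_top, finrank_planeSpan hk, finrank_planeSpan hl, Module.finrank_fin_fun] at hr
  have h1 : Module.finrank ℝ ↥(planeSpan v k ⊓ planeSpan w l) = 1 := by omega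
  have hx0 : (⟨x.1, hxv, hxw⟩ : ↥(planeSpan v k ⊓ planeSpan w l)) ≠ 0 := by
    intro h0
    have := congrFun (congrArg Subtype.val h0) 0
    exact x.2.2.ne' this
  obtain ⟨c, hc⟩ := exists_smul_eq_of_finrank_eq_one h1 hx0 ⟨y.1, hyv, hyw⟩
  have hc : c • x.1 = y.1 := congrArg Subtype.val hc
  have hc0 : c * x.1 0 = y.1 0 := congrFun hc 0
  have hl := y.2.1
  rw [← hc, lorentz_smul_left, lorentz_smul_right, x.2.1] at hl
  have hcpos : 0 < c := by
    have := y.2.2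
    rw [← hc0] at this
    exact pos_of_mul_pos_left this x.2.2.le
  have : c = 1 := by nlinarith
  refine Subtype.ext ?_
  rw [← hc, this, one_smul]

/-- Transversality does not depend on the common point, so it may be tested without one. -/
theorem ballsTransverse_iff {δ : ℝ} {u v : Frame d} :
    BallsTransverse k l δ u v ↔ (geoClosedBall k δ u ∩ geoClosedBall l δ v).Nonempty ∧
      planeSpan u k ⊔ planeSpan v l = ⊤ := by
  refine and_congr_right fun ⟨x, hx⟩ => ⟨fun h => (transverseAt_iff.mp (h x hx)).2.2, fun h y hy => ?_⟩
  exact transverseAt_iff.mpr ⟨hy.1.1, hy.2.1, h⟩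

theorem mem_geoClosedBall_mul {g u : Frame d} {δ : ℝ} {x : HSpace d} :
    x ∈ geoClosedBall k δ (g * u) ↔ g⁻¹ • x ∈ geoClosedBall k δ u := by
  refine and_congr ?_ ?_
  · rw [plane_mul, Set.mem_smul_set_iff_inv_smul_mem]
  · rw [basePt_mul]
    nth_rw 1 [← smul_inv_smul g x]
    rw [hdist_smul_smul]

theorem sup_mul_eq_top_iff {g u v : Frame d} :
    planeSpan (g * u) k ⊔ planeSpan (g * v) l = ⊤ ↔ planeSpan u k ⊔ planeSpan v l = ⊤ := by
  have hsurj : ∀ g : Frame d, Function.Surjective g.1.1.mulVecLin := fun g x =>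
    ⟨_, mulVec_inv_mulVec g x⟩
  have key : ∀ g u v : Frame d, planeSpan u k ⊔ planeSpan v l = ⊤ →
      planeSpan (g * u) k ⊔ planeSpan (g * v) l = ⊤ := fun g u v h => by
    rw [planeSpan_mul, planeSpan_mul, ← Submodule.map_sup, h, Submodule.map_top,
      LinearMap.range_eq_top.mpr (hsurj g)]
  refine ⟨fun h => ?_, key g u v⟩
  simpa using key g⁻¹ _ _ h

theorem ballsTransverse_mul {δ : ℝ} {g u v : Frame d} :
    BallsTransverse k l δ (g * u) (g * v) ↔ BallsTransverse k l δ u v := by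
  rw [ballsTransverse_iff, ballsTransverse_iff, sup_mul_eq_top_iff]
  refine and_congr_left fun _ => ⟨fun ⟨x, hx⟩ => ⟨g⁻¹ • x, ?_⟩, fun ⟨x, hx⟩ => ⟨g • x, ?_⟩⟩
  · exact ⟨mem_geoClosedBall_mul.mp hx.1, mem_geoClosedBall_mul.mp hx.2⟩
  · constructor <;> rw [mem_geoClosedBall_mul, inv_smul_smul]
    exacts [hx.1, hx.2]

end Planes

/-! ### Topology of the action -/

section Topology

variable {d k l : ℕ}

theorem continuous_boost (d : ℕ) : Continuous (boost : (Fin d → ℝ) → SOplus d) :=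
  (val_isEmbedding d).continuous_iff.mpr (boost_continuous d)

instance instContinuousSMulHSpace (d : ℕ) : ContinuousSMul (SOplus d) (HSpace d) where
  continuous_smul := by
    refine Continuous.subtype_mk ?_ _
    have h : Continuous fun p : SOplus d × HSpace d => p.1.1.1 :=
      (val_isEmbedding d).continuous.comp continuous_fst
    exact h.matrix_mulVec (by fun_prop)

theorem continuous_basePt (d : ℕ) : Continuous (basePt : Frame d → HSpace d) :=
  continuous_id.smul continuous_const

theorem continuous_hdist_lorentz (d : ℕ) :
    Continuous fun p : HSpace d × HSpace d => -lorentz p.1.1 p.2.1 :=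
  (continuous_lorentz.comp (by fun_prop :
    Continuous fun p : HSpace d × HSpace d => (p.1.1, p.2.1))).neg

theorem continuous_pad (d k : ℕ) : Continuous (pad (k := k) d) := by
  refine continuous_pi fun i => ?_
  unfold pad
  by_cases h : (i : ℕ) < k
  · simp only [h, dif_pos]
    fun_prop
  · simp only [h, dif_neg, not_false_iff]
    exact continuous_const

theorem continuous_mul_boost_pad (d k : ℕ) :
    Continuous fun p : Frame d × EuclideanSpace ℝ (Fin k) => p.1 * boost (pad d p.2) :=
  continuous_fst.mul ((continuous_boost d).comp ((continuous_pad d k).comp continuous_snd))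

theorem continuous_planePoint (d k : ℕ) :
    Continuous fun p : Frame d × EuclideanSpace ℝ (Fin k) => planePoint p.1 p.2 :=
  (continuous_basePt d).comp (continuous_mul_boost_pad d k)

theorem continuous_planePoint_right (v : Frame d) (k : ℕ) :
    Continuous (planePoint (k := k) v) :=
  (continuous_planePoint d k).comp (Continuous.prodMk continuous_const continuous_id)

theorem continuous_coord (i : Fin (d + 1)) : Continuous fun x : HSpace d => x.1 i :=
  (continuous_apply i).comp continuous_subtype_val

theorem exists_continuous_frame (d : ℕ) :
    ∃ b : HSpace d → SOplus d, Continuous b ∧ ∀ x, basePt (b x) = x :=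
  ⟨fun x => boost fun i => x.1 (Fin.succ i),
    (continuous_boost d).comp (continuous_pi fun i => continuous_coord i.succ), basePt_boost_tail⟩

/-- The height x₀ exhausts ℍ^d by compact sets. Compact subsets of the quotients are lifted by means
of it. -/
theorem isCompact_height_le (d : ℕ) (r : ℝ) : IsCompact {x : HSpace d | x.1 0 ≤ r} := by
  have hK : IsCompact (Metric.closedBall (0 : EuclideanSpace ℝ (Fin d)) |r|) :=
    isCompact_closedBall 0 _
  refine (hK.image (continuous_planePoint_right (1 : Frame d) d)).of_isClosed_subset
    (isClosed_le (continuous_coord 0) continuous_const) ?_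
  intro x hx
  have hx' : x ∈ plane (1 : Frame d) d := mem_planeSpan_one.mpr fun i hi => by omega
  obtain ⟨y, rfl⟩ := exists_planePoint_eq le_rfl hx'
  refine ⟨y, ?_, rfl⟩
  rw [mem_closedBall_zero_iff]
  have h : (planePoint (1 : Frame d) y).1 0 ≤ r := hx
  rw [planePoint_one_zero le_rfl, Real.sqrt_le_iff] at h
  refine le_of_sq_le_sq ?_ (abs_nonneg r)
  rw [sq_abs]
  linarith

/-- For k = d the plane is all of ℍ^d, so the stabilizer is `rotGroup d d`, which is already known
to be compact. -/
theorem isCompact_stabilizer_origin (d : ℕ) :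
    IsCompact (MulAction.stabilizer (SOplus d) (origin d) : Set (SOplus d)) := by
  have h : MulAction.stabilizer (SOplus d) (origin d) = rotGroup d d := by
    refine le_antisymm (le_inf le_rfl fun g _ => ?_) inf_le_left
    have : plane (1 : Frame d) d = Set.univ :=
      Set.eq_univ_of_forall fun x => mem_planeSpan_one.mpr fun i hi => by omega
    rw [MulAction.mem_stabilizer_iff, this, Set.smul_set_univ]
  rw [h]
  exact isCompact_iff_compactSpace.mpr (instCompactRotGroup d d)

/-- The action of `SO⁺(d,1)` on `ℍ^d` is proper. -/
theorem exists_isCompact_transporter {C C' : Set (HSpace d)} (hC : IsCompact C)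
    (hC' : IsCompact C') :
    ∃ K : Set (SOplus d), IsCompact K ∧ ∀ g : SOplus d, ∀ x ∈ C, g • x ∈ C' → g ∈ K := by
  obtain ⟨b, hb, hbo⟩ := exists_continuous_frame d
  change ∀ x, b x • origin d = x at hbo
  -- With b a continuous choice of frames, g equals b(gx) times an isometry fixing the origin times
  -- b(x)⁻¹.
  refine ⟨b '' C' * (MulAction.stabilizer (SOplus d) (origin d) : Set (SOplus d)) * (b '' C)⁻¹,
    ((hC'.image hb).mul (isCompact_stabilizer_origin d)).mul (hC.image hb).inv, ?_⟩
  intro g x hx hgx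
  refine Set.mem_mul.mpr ⟨b (g • x) * ((b (g • x))⁻¹ * g * b x),
    Set.mul_mem_mul ⟨_, hgx, rfl⟩ ?_, (b x)⁻¹, Set.inv_mem_inv.mpr ⟨x, hx, rfl⟩, by group⟩
  change ((b (g • x))⁻¹ * g * b x) • origin d = origin d
  rw [mul_smul, mul_smul, hbo, inv_smul_eq_iff, hbo]

/-- A discrete group of isometries acts properly discontinuously. -/
theorem finite_transporter (Δ : Subgroup (SOplus d)) [DiscreteTopology Δ] {C C' : Set (HSpace d)}
    (hC : IsCompact C) (hC' : IsCompact C') : {g : Δ | ∃ x ∈ C, g • x ∈ C'}.Finite := by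
  obtain ⟨K, hK, hmem⟩ := exists_isCompact_transporter hC hC'
  have hcl : IsClosed (Δ : Set (SOplus d)) := Subgroup.isClosed_of_discrete
  have h := (hcl.isClosedEmbedding_subtypeVal.isCompact_preimage hK).finite_of_discrete
  refine h.subset ?_
  rintro g ⟨x, hx, hgx⟩
  exact hmem g x hx hgx

instance instCountableOfDiscrete (Δ : Subgroup (SOplus d)) [DiscreteTopology Δ] : Countable Δ :=
  TopologicalSpace.separableSpace_iff_countable.mp inferInstance

/-- A discrete torsion-free group of isometries acts freely. -/
theorem eq_one_of_smul_eq {Δ : Subgroup (SOplus d)} [DiscreteTopology Δ]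
    (htf : ∀ g ∈ Δ, g ≠ 1 → ¬ IsOfFinOrder g) {g : SOplus d} (hg : g ∈ Δ) {x : HSpace d}
    (hx : g • x = x) : g = 1 := by
  by_contra hne
  refine htf g hg hne ?_
  have hfin := finite_transporter Δ (isCompact_singleton (x := x)) (isCompact_singleton (x := x))
  -- All powers of g fix x and so lie in one finite transporter set, which is impossible for an
  -- element of infinite order.
  have hpow : ∀ n : ℕ, (⟨g, hg⟩ : Δ) ^ n ∈ {g : Δ | ∃ y ∈ ({x} : Set (HSpace d)), g • y ∈ ({x} : Set (HSpace d))} := by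
    intro n
    refine ⟨x, rfl, ?_⟩
    induction n with
    | zero => simp
    | succ n ih =>
      have h1 : (⟨g, hg⟩ : Δ) • x = x := hx
      rw [pow_succ, mul_smul, h1]
      exact ih
  have h2 : IsOfFinOrder (⟨g, hg⟩ : Δ) := by
    by_contra hinf
    exact Set.infinite_of_injective_forall_mem (injective_pow_iff_not_isOfFinOrder.mpr hinf) hpow hfin
  exact Δ.subtype.isOfFinOrder h2

/-- Points at bounded distance from a compact set lie in a compact set. -/
theorem exists_isCompact_neighborhood {C : Set (HSpace d)} (hC : IsCompact C) (δ : ℝ) :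
    ∃ C' : Set (HSpace d), IsCompact C' ∧ ∀ x ∈ C, ∀ y, hdist x y ≤ δ → y ∈ C' := by
  obtain ⟨b, hb, hbo⟩ := exists_continuous_frame d
  have hK := isCompact_closedBall (0 : EuclideanSpace ℝ (Fin d)) (Real.sinh δ)
  have hc : Continuous fun p : HSpace d × EuclideanSpace ℝ (Fin d) => planePoint (b p.1) p.2 :=
    (continuous_planePoint d d).comp ((hb.comp continuous_fst).prodMk continuous_snd)
  refine ⟨_, (hC.prod hK).image hc, fun x hx y hy => ?_⟩
  have hmem : y ∈ plane (b x) d := by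
    rw [← smul_inv_smul (b x) y, smul_mem_plane]
    exact mem_planeSpan_one.mpr fun i hi => by omega
  obtain ⟨z, rfl⟩ := exists_planePoint_eq le_rfl hmem
  refine ⟨(x, z), ⟨hx, ?_⟩, rfl⟩
  rw [mem_closedBall_zero_iff]
  exact (hdist_planePoint_le le_rfl (b x) z).mp ((hbo x).symm ▸ hy)

theorem isCompact_geoClosedBall (hk : k ≤ d) (δ : ℝ) (v : Frame d) :
    IsCompact (geoClosedBall k δ v) := by
  have hK := isCompact_closedBall (0 : EuclideanSpace ℝ (Fin k)) (Real.sinh δ)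
  have hc := continuous_planePoint_right v k
  convert hK.image hc using 1
  ext x
  constructor
  · rintro ⟨hx, hx'⟩
    obtain ⟨y, rfl⟩ := exists_planePoint_eq hk hx
    exact ⟨y, mem_closedBall_zero_iff.mpr ((hdist_planePoint_le hk v y).mp hx'), rfl⟩
  · rintro ⟨y, hy, rfl⟩
    exact ⟨planePoint_mem_plane v y, (hdist_planePoint_le hk v y).mpr (mem_closedBall_zero_iff.mp hy)⟩

/-- A compact subset of the image of an open map from `X` is the image of a bounded set. -/
theorem exists_height_le_of_isCompact {X Y : Type*} [TopologicalSpace X] [TopologicalSpace Y]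
    {q : X → Y} (hq : IsOpenMap q) (hs : Function.Surjective q) {h : X → ℝ} (hh : Continuous h)
    {L : Set Y} (hL : IsCompact L) : ∃ r : ℝ, L ⊆ q '' {x | h x ≤ r} := by
  obtain ⟨n, hn⟩ := hL.elim_directed_cover (fun n : ℕ => q '' {x | h x < n})
    (fun n => hq _ (isOpen_lt hh continuous_const)) (fun y _ => by
      obtain ⟨x, rfl⟩ := hs y
      obtain ⟨n, hn⟩ := exists_nat_gt (h x)
      exact Set.mem_iUnion.mpr ⟨n, x, hn, rfl⟩)
    (directed_of_isDirected_le fun m n hmn => Set.image_mono fun x (hx : h x < m) =>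
      show h x < n from hx.trans_le (by exact_mod_cast hmn))
  exact ⟨n, hn.trans (Set.image_mono fun x (hx : h x < n) => hx.le)⟩

theorem isOpenMap_toMfd (Δ : Subgroup (SOplus d)) : IsOpenMap (toMfd Δ) :=
  isOpenMap_quotient_mk'_mul

theorem continuous_toMfd (Δ : Subgroup (SOplus d)) : Continuous (toMfd Δ) :=
  continuous_quotient_mk'

theorem toMfd_surjective (Δ : Subgroup (SOplus d)) : Function.Surjective (toMfd Δ) :=
  Quotient.mk_surjective

theorem toMfd_eq_iff {Δ : Subgroup (SOplus d)} {x y : HSpace d} :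
    toMfd Δ x = toMfd Δ y ↔ ∃ g ∈ Δ, g • y = x := by
  refine Quotient.eq.trans ⟨?_, ?_⟩
  · rintro ⟨g, hg⟩
    exact ⟨g, g.2, hg⟩
  · rintro ⟨g, hg, h⟩
    exact ⟨⟨g, hg⟩, h⟩

theorem exists_isCompact_lift (Δ : Subgroup (SOplus d)) {L : Set (Mfd Δ)} (hL : IsCompact L) :
    ∃ C : Set (HSpace d), IsCompact C ∧ L ⊆ toMfd Δ '' C := by
  obtain ⟨r, hr⟩ := exists_height_le_of_isCompact (isOpenMap_toMfd Δ) (toMfd_surjective Δ)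
    (continuous_coord 0) hL
  exact ⟨_, isCompact_height_le d r, hr⟩

/-- Makes the quotient map from the plane to the leaf open, so that compact sets in the leaf can be
lifted. -/
instance instContinuousConstSMulPlaneAction (Δ : Subgroup (SOplus d)) (v : Frame d) (k : ℕ) :
    ContinuousConstSMul (planeStab Δ v k) (planeAction Δ v k) where
  continuous_const_smul g := by
    refine Continuous.subtype_mk ?_ _
    exact (continuous_const_smul (g : SOplus d)).comp continuous_subtype_val

/-- Only finitely many lifts of a properly immersed geodesic submanifold meet a compact set. -/
theorem GeodesicSubmanifold.finite_lifts {Δ : Subgroup (SOplus d)} [DiscreteTopology Δ]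
    (N : GeodesicSubmanifold Δ k) {C : Set (HSpace d)} (hC : IsCompact C) :
    {V ∈ N.lifts | ∃ x ∈ C, x.1 ∈ V}.Finite := by
  -- Properness enters here: the part of the leaf over the image of C is compact, hence covered by a
  -- part of the plane of bounded height.
  have hL := N.proper.isCompact_preimage (hC.image (continuous_toMfd Δ))
  obtain ⟨r, hr⟩ := exists_height_le_of_isCompact
    (q := (Quotient.mk _ : planeAction Δ N.frame k → Leaf Δ N.frame k))
    isOpenMap_quotient_mk'_mul Quotient.mk_surjective
    ((continuous_coord 0).comp continuous_subtype_val) hL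
  have hfin := finite_transporter Δ (isCompact_height_le d r) hC
  refine (hfin.image fun g : Δ => planeSpan ((g : SOplus d) * N.frame) k).subset ?_
  rintro V ⟨⟨g, hg, rfl⟩, x, hx, hxV⟩
  have hxP : x ∈ plane (g * N.frame) k := hxV
  rw [plane_mul, Set.mem_smul_set_iff_inv_smul_mem] at hxP
  have hmem : (Quotient.mk _ (⟨g⁻¹ • x, hxP⟩ : planeAction Δ N.frame k) : Leaf Δ N.frame k) ∈
      leafImmersion Δ N.frame k ⁻¹' (toMfd Δ '' C) :=
    ⟨x, hx, toMfd_eq_iff.mpr ⟨g, hg, smul_inv_smul g x⟩⟩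
  obtain ⟨⟨y, hy⟩, hyr, hyx⟩ := hr hmem
  obtain ⟨⟨s, hsΔ, hs⟩, hsy⟩ := Quotient.exact hyx
  have hsy : s • (g⁻¹ • x) = y := congrArg Subtype.val hsy
  -- The stabilizer element s moves g⁻¹x into the bounded part without changing the plane. So the
  -- lift is also the translate by g s⁻¹, and such elements form a finite set.
  refine ⟨⟨g * s⁻¹, Δ.mul_mem hg (Δ.inv_mem hsΔ)⟩, ⟨y, hyr, ?_⟩, ?_⟩
  · change (g * s⁻¹) • y ∈ C
    rwa [← hsy, mul_smul, inv_smul_smul, smul_inv_smul]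
  · change planeSpan (g * s⁻¹ * N.frame) k = _
    rw [mul_assoc, planeSpan_mul_left_cancel, planeSpan_eq_iff, plane_mul]
    exact inv_smul_eq_iff.mpr hs.symm

end Topology

/-! ### Invariance of the hyperbolic volume -/

section Volume

variable {k : ℕ}

theorem lintegral_fin_succ {Φ : (Fin (k + 1) → ℝ) → ℝ≥0∞} (hΦ : Measurable Φ) :
    ∫⁻ x, Φ x = ∫⁻ s : EuclideanSpace ℝ (Fin k), ∫⁻ t : ℝ, Φ (Fin.cons t s) := by
  have h1 := (volume_preserving_piFinSuccAbove (fun _ : Fin (k + 1) => ℝ) 0).symm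
  have hcons : ∀ p : ℝ × (Fin k → ℝ),
      (MeasurableEquiv.piFinSuccAbove (fun _ : Fin (k + 1) => ℝ) 0).symm p = Fin.cons p.1 p.2 :=
    fun p => by
      change Fin.insertNth (α := fun _ => ℝ) 0 p.1 p.2 = _
      rw [Fin.insertNth_zero]
      rfl
  have hm : Measurable fun p : ℝ × (Fin k → ℝ) => Φ (Fin.cons p.1 p.2) := by
    simp only [← hcons]
    exact hΦ.comp h1.measurable
  rw [← h1.lintegral_comp hΦ]
  simp only [hcons]
  rw [Measure.volume_eq_prod, lintegral_prod_symm _ hm.aemeasurable,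
    ← (PiLp.volume_preserving_ofLp (Fin k)).lintegral_comp hm.lintegral_prod_left']

/-- The open cone of future timelike vectors of length less than one. -/
def futureCone (k : ℕ) : Set (Fin (k + 1) → ℝ) :=
  {x | 0 < x 0 ∧ 0 < -lorentz x x ∧ -lorentz x x < 1}

/-- The coordinates of the point of hyperbolic space on the ray through a timelike vector. -/
noncomputable def radialProj (x : Fin (k + 1) → ℝ) : EuclideanSpace ℝ (Fin k) :=
  WithLp.toLp 2 fun i => (√(-lorentz x x))⁻¹ * x i.succ

theorem continuous_neg_lorentz_self :
    Continuous fun x : Fin (k + 1) → ℝ => -lorentz x x :=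
  (continuous_lorentz.comp (continuous_id.prodMk continuous_id)).neg

theorem measurableSet_futureCone (k : ℕ) : MeasurableSet (futureCone k) :=
  (measurableSet_lt measurable_const (measurable_pi_apply 0)).inter
    ((measurableSet_lt measurable_const continuous_neg_lorentz_self.measurable).inter
      (measurableSet_lt continuous_neg_lorentz_self.measurable measurable_const))

theorem measurable_radialProj : Measurable (radialProj (k := k)) := by
  refine (WithLp.measurable_toLp 2 _).comp (measurable_pi_lambda _ fun i => ?_)
  exact (continuous_neg_lorentz_self.measurable.sqrt.inv).mul (measurable_pi_apply _)

theorem neg_lorentz_cons (t : ℝ) (s : EuclideanSpace ℝ (Fin k)) :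
    -lorentz (Fin.cons t s : Fin (k + 1) → ℝ) (Fin.cons t s) = t ^ 2 - ‖s‖ ^ 2 := by
  rw [EuclideanSpace.norm_sq_eq]
  simp [lorentz, sq]
  ring

theorem measurable_indicator_radialProj {φ : EuclideanSpace ℝ (Fin k) → ℝ≥0∞} (hφ : Measurable φ) :
    Measurable ((futureCone k).indicator fun x => φ (radialProj x)) :=
  (hφ.comp measurable_radialProj).indicator (measurableSet_futureCone k)

/-- For fixed space part s, substitute t = √(τ² + |s|²), where τ is the Lorentz length and runs over
(0, 1). The derivative gives the weight, and the radial projection becomes s/τ. -/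
theorem lintegral_fibre {φ : EuclideanSpace ℝ (Fin k) → ℝ≥0∞} (s : EuclideanSpace ℝ (Fin k)) :
    ∫⁻ t : ℝ, (futureCone k).indicator (fun x => φ (radialProj x)) (Fin.cons t s) =
      ∫⁻ τ in Set.Ioo (0 : ℝ) 1,
        ENNReal.ofReal (τ / √(τ ^ 2 + ‖s‖ ^ 2)) * φ (τ⁻¹ • s) := by
  have hpos : ∀ τ ∈ Set.Ioo (0 : ℝ) 1, 0 < τ ^ 2 + ‖s‖ ^ 2 := fun τ hτ => by
    have := hτ.1; positivity
  have himg : (fun τ : ℝ => √(τ ^ 2 + ‖s‖ ^ 2)) '' Set.Ioo (0 : ℝ) 1 =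
      {t | (Fin.cons t s : Fin (k + 1) → ℝ) ∈ futureCone k} := by
    ext t
    simp only [futureCone, Set.mem_ofPred_eq, Fin.cons_zero, neg_lorentz_cons]
    constructor
    · rintro ⟨τ, hτ, rfl⟩
      refine ⟨Real.sqrt_pos.mpr (hpos τ hτ), ?_⟩
      rw [Real.sq_sqrt (hpos τ hτ).le, add_sub_cancel_right]
      exact ⟨pow_pos hτ.1 2, by nlinarith [hτ.1, hτ.2]⟩
    · rintro ⟨h0, h1, h2⟩
      refine ⟨√(t ^ 2 - ‖s‖ ^ 2), ⟨Real.sqrt_pos.mpr h1, ?_⟩, ?_⟩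
      · rw [Real.sqrt_lt' one_pos]; linarith
      · simp only
        rw [Real.sq_sqrt h1.le, sub_add_cancel, Real.sqrt_sq h0.le]
  have hmeas : MeasurableSet {t : ℝ | (Fin.cons t s : Fin (k + 1) → ℝ) ∈ futureCone k} := by
    have hc : Continuous fun t : ℝ => (Fin.cons t s : Fin (k + 1) → ℝ) :=
      continuous_pi fun i => by
        obtain rfl | ⟨j, rfl⟩ := Fin.eq_zero_or_eq_succ i
        · exact continuous_id
        · exact continuous_const
    exact hc.measurable (measurableSet_futureCone k)
  have hind : (fun t : ℝ => (futureCone k).indicator (fun x => φ (radialProj x)) (Fin.cons t s)) =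
      Set.indicator {t : ℝ | (Fin.cons t s : Fin (k + 1) → ℝ) ∈ futureCone k}
        fun t => φ (radialProj (Fin.cons t s)) := by
    funext t
    simp only [Set.indicator, Set.mem_ofPred_eq]
  rw [hind, lintegral_indicator hmeas, ← himg,
    lintegral_image_eq_lintegral_abs_deriv_mul measurableSet_Ioo
      (f' := fun τ => τ / √(τ ^ 2 + ‖s‖ ^ 2))]
  · refine setLIntegral_congr_fun measurableSet_Ioo fun τ hτ => ?_
    simp only
    rw [abs_of_nonneg (div_nonneg hτ.1.le (Real.sqrt_nonneg _))]
    congr 2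
    ext i
    simp only [radialProj, neg_lorentz_cons, Fin.cons_succ]
    rw [Real.sq_sqrt (hpos τ hτ).le, add_sub_cancel_right, Real.sqrt_sq hτ.1.le]
    rfl
  · intro τ hτ
    have h1 : HasDerivAt (fun τ : ℝ => τ ^ 2 + ‖s‖ ^ 2) (2 * τ) τ := by
      simpa using (hasDerivAt_pow 2 τ).add_const (‖s‖ ^ 2)
    have h2 := h1.sqrt (hpos τ hτ).ne'
    rw [mul_div_mul_left _ _ two_ne_zero] at h2
    exact h2.hasDerivWithinAt
  · intro a ha b hb hab
    simp only at hab
    rw [Real.sqrt_inj (hpos a ha).le (hpos b hb).le, add_left_inj] at hab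
    exact (pow_left_inj₀ ha.1.le hb.1.le two_ne_zero).mp hab

theorem measurable_hypDensity (k : ℕ) :
    Measurable fun y : EuclideanSpace ℝ (Fin k) => ENNReal.ofReal (1 / √(1 + ‖y‖ ^ 2)) := by
  fun_prop

/-- Substitute s = τ y: the Jacobian is τ^k, and the weight turns into the hyperbolic density 1/√(1
+ |y|²). -/
theorem lintegral_dilation {φ : EuclideanSpace ℝ (Fin k) → ℝ≥0∞} (hφ : Measurable φ) {τ : ℝ}
    (hτ : 0 < τ) :
    ∫⁻ s : EuclideanSpace ℝ (Fin k), ENNReal.ofReal (τ / √(τ ^ 2 + ‖s‖ ^ 2)) * φ (τ⁻¹ • s) =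
      ENNReal.ofReal (τ ^ k) * ∫⁻ y, φ y ∂hypVolume k := by
  have hG : Measurable fun y : EuclideanSpace ℝ (Fin k) =>
      ENNReal.ofReal (1 / √(1 + ‖y‖ ^ 2)) * φ y := (measurable_hypDensity k).mul hφ
  have h1 : ∀ s : EuclideanSpace ℝ (Fin k),
      ENNReal.ofReal (τ / √(τ ^ 2 + ‖s‖ ^ 2)) * φ (τ⁻¹ • s) =
        ENNReal.ofReal (1 / √(1 + ‖τ⁻¹ • s‖ ^ 2)) * φ (τ⁻¹ • s) := fun s => by
    congr 2
    have h2 : τ ^ 2 + ‖s‖ ^ 2 = τ ^ 2 * (1 + ‖τ⁻¹ • s‖ ^ 2) := by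
      rw [norm_smul, Real.norm_of_nonneg (by positivity)]
      field_simp
    rw [h2, Real.sqrt_mul (by positivity), Real.sqrt_sq hτ.le, ← div_div, div_self hτ.ne']
  simp only [h1]
  rw [← lintegral_map (f := fun y => ENNReal.ofReal (1 / √(1 + ‖y‖ ^ 2)) * φ y) hG
      (measurable_const_smul τ⁻¹), Measure.map_addHaar_smul _ (inv_ne_zero hτ.ne'),
    lintegral_smul_measure, hypVolume,
    lintegral_withDensity_eq_lintegral_mul _ (measurable_hypDensity k) hφ]
  congr 1
  rw [finrank_euclideanSpace_fin, inv_pow, inv_inv, abs_of_pos (by positivity)]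

/-- Hyperbolic volume is, up to a constant, the radial projection of Lebesgue measure on the cone.
The constant is ∫₀¹ τ^k dτ; all that matters is that it can be cancelled. -/
theorem exists_lintegral_cone (k : ℕ) : ∃ C : ℝ≥0∞, C ≠ 0 ∧ C ≠ ∞ ∧
    ∀ φ : EuclideanSpace ℝ (Fin k) → ℝ≥0∞, Measurable φ →
      ∫⁻ x, (futureCone k).indicator (fun x => φ (radialProj x)) x =
        C * ∫⁻ y, φ y ∂hypVolume k := by
  refine ⟨∫⁻ τ in Set.Ioo (0 : ℝ) 1, ENNReal.ofReal (τ ^ k), ?_, ?_, fun φ hφ => ?_⟩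
  · rw [← pos_iff_ne_zero, setLIntegral_pos_iff (by fun_prop)]
    have : Function.support (fun τ : ℝ => ENNReal.ofReal (τ ^ k)) ∩ Set.Ioo 0 1 = Set.Ioo 0 1 := by
      refine Set.inter_eq_right.mpr fun τ hτ => ?_
      rw [Function.mem_support, ← pos_iff_ne_zero, ENNReal.ofReal_pos]
      exact pow_pos hτ.1 k
    rw [this]
    simp
  · refine ne_top_of_le_ne_top (b := ∫⁻ τ in Set.Ioo (0 : ℝ) 1, 1) (by simp) ?_
    refine setLIntegral_mono measurable_const fun τ hτ => ?_
    exact ENNReal.ofReal_le_one.mpr (pow_le_one₀ hτ.1.le hτ.2.le)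
  · rw [lintegral_fin_succ (measurable_indicator_radialProj hφ)]
    simp only [lintegral_fibre]
    rw [lintegral_lintegral_swap (Measurable.aemeasurable (by
      simp only [Function.uncurry_def]
      exact Measurable.mul (by fun_prop) (hφ.comp (by fun_prop)))),
      setLIntegral_congr_fun measurableSet_Ioo fun τ hτ => lintegral_dilation hφ hτ.1,
      lintegral_mul_const _ (by fun_prop)]

/-- The hyperbolic volume is invariant under the isometries of `ℍ^k`. -/
theorem lintegral_hypVolume_comp (A : Matrix (Fin (k + 1)) (Fin (k + 1)) ℝ)
    (hA : ∀ x y, lorentz (A.mulVec x) (A.mulVec y) = lorentz x y)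
    (hpos : ∀ x : HSpace k, 0 < A.mulVec x.1 0)
    {T : EuclideanSpace ℝ (Fin k) → EuclideanSpace ℝ (Fin k)} (hT : Measurable T)
    (hTA : ∀ y i, T y i = A.mulVec (Fin.cons (√(1 + ‖y‖ ^ 2)) y) (Fin.succ i))
    {φ : EuclideanSpace ℝ (Fin k) → ℝ≥0∞} (hφ : Measurable φ) :
    ∫⁻ y, φ (T y) ∂hypVolume k = ∫⁻ y, φ y ∂hypVolume k := by
  -- A Lorentz matrix has determinant ±1 and therefore preserves Lebesgue measure; this is the
  -- source of the invariance.
  have hdet : |A.det⁻¹| = 1 := by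
    rw [abs_inv, (pow_eq_one_iff_of_nonneg (abs_nonneg A.det) two_ne_zero).mp
      (by rw [sq_abs, det_sq_of_lorentz A hA]), inv_one]
  have hdet0 : A.det ≠ 0 := fun h => by simp [h] at hdet
  -- Positivity is assumed only on the hyperboloid and extends to future timelike vectors by
  -- scaling.
  have hpos' : ∀ x : Fin (k + 1) → ℝ, 0 < x 0 → 0 < -lorentz x x → 0 < A.mulVec x 0 := by
    intro x h0 h1
    have hr := Real.sqrt_pos.mpr h1
    have hsq := Real.sq_sqrt h1.le
    have h2 := hpos ⟨(√(-lorentz x x))⁻¹ • x, by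
      rw [lorentz_smul_left, lorentz_smul_right]
      field_simp
      linarith, by
      rw [Pi.smul_apply, smul_eq_mul]; positivity⟩
    rw [Matrix.mulVec_smul, Pi.smul_apply, smul_eq_mul] at h2
    exact pos_of_mul_pos_right h2 (inv_nonneg.mpr hr.le)
  have hcone : ∀ x, A.mulVec x ∈ futureCone k ↔ x ∈ futureCone k := by
    intro x
    simp only [futureCone, Set.mem_ofPred_eq, hA]
    refine and_congr_left fun h => ⟨fun h0 => ?_, fun h0 => hpos' x h0 h.1⟩
    -- If x pointed to the past, then -x would point to the future, and so would its image, contrary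
    -- to the assumption on the image of x.
    by_contra hn
    have hx0 : x 0 ≠ 0 := fun hx0 => by
      have h1 := h.1
      simp only [lorentz, hx0, mul_zero, neg_zero, zero_add] at h1
      have : 0 ≤ ∑ i : Fin k, x i.succ * x i.succ :=
        Finset.sum_nonneg fun i _ => mul_self_nonneg _
      linarith
    have := hpos' (-x) (by
      rw [Pi.neg_apply]
      have := lt_of_le_of_ne (not_lt.mp hn) hx0
      linarith) (by rw [lorentz_neg_neg]; exact h.1)
    rw [Matrix.mulVec_neg, Pi.neg_apply] at this
    linarith
  -- A is linear and preserves Lorentz length, so it commutes with normalization onto the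
  -- hyperboloid, where it acts as T.
  have hproj : ∀ x ∈ futureCone k, radialProj (A.mulVec x) = T (radialProj x) := by
    intro x hx
    have h1 := hx.2.1
    have hr := Real.sqrt_pos.mpr h1
    have hsq := Real.sq_sqrt h1.le
    ext i
    have hx' : (Fin.cons (√(1 + ‖radialProj x‖ ^ 2)) (radialProj x) : Fin (k + 1) → ℝ) =
        (√(-lorentz x x))⁻¹ • x := by
      funext j
      obtain rfl | ⟨j, rfl⟩ := Fin.eq_zero_or_eq_succ j
      · rw [Fin.cons_zero, Pi.smul_apply, smul_eq_mul]
        rw [Real.sqrt_eq_iff_mul_self_eq_of_pos (mul_pos (inv_pos.mpr hr) hx.1),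
          EuclideanSpace.norm_sq_eq]
        have h2 : ∀ j, ‖radialProj x j‖ ^ 2 = (√(-lorentz x x))⁻¹ ^ 2 * x j.succ ^ 2 := fun j => by
          rw [Real.norm_eq_abs, sq_abs, ← mul_pow]
          rfl
        simp only [h2, ← Finset.mul_sum]
        rw [inv_pow, hsq]
        have h3 : ∑ j : Fin k, x j.succ ^ 2 = lorentz x x + x 0 ^ 2 := by
          simp only [lorentz, ← sq]; ring
        rw [h3]
        have h4 : (√(-lorentz x x))⁻¹ * x 0 * ((√(-lorentz x x))⁻¹ * x 0) =
            (-lorentz x x)⁻¹ * x 0 ^ 2 := by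
          nth_rw 3 [← hsq]
          ring
        rw [h4]
        have : lorentz x x ≠ 0 := by linarith
        field_simp
        ring
      · rfl
    rw [hTA, hx', Matrix.mulVec_smul]
    simp only [radialProj, hA, Pi.smul_apply, smul_eq_mul]
  obtain ⟨C, hC0, hCt, hC⟩ := exists_lintegral_cone k
  have hΦ := measurable_indicator_radialProj hφ
  have hAm : Measurable (Matrix.toLin' A) :=
    (LinearMap.continuous_of_finiteDimensional _).measurable
  have key : ∫⁻ x, (futureCone k).indicator (fun x => φ (T (radialProj x))) x =
      ∫⁻ x, (futureCone k).indicator (fun x => φ (radialProj x)) x := by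
    have h1 := Real.map_matrix_volume_pi_eq_smul_volume_pi hdet0
    rw [hdet, ENNReal.ofReal_one, one_smul] at h1
    nth_rw 2 [← h1]
    rw [lintegral_map hΦ hAm]
    refine lintegral_congr fun x => ?_
    rw [Matrix.toLin'_apply]
    by_cases hx : x ∈ futureCone k
    · rw [Set.indicator_of_mem hx, Set.indicator_of_mem ((hcone x).mpr hx), hproj x hx]
    · rw [Set.indicator_of_notMem hx, Set.indicator_of_notMem (fun h => hx ((hcone x).mp h))]
  rw [hC (fun y => φ (T y)) (hφ.comp hT), hC _ hφ] at key
  exact (ENNReal.mul_right_inj hC0 hCt).mp key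

end Volume

/-! ### Invariance of the measure on the frames tangent to a plane -/

section FrameMeasure

variable {d k : ℕ}

instance instIsHaarRotMeasure (d k : ℕ) : (rotMeasure d k).IsHaarMeasure := by
  unfold rotMeasure
  infer_instance

instance instIsProbabilityRotMeasure (d k : ℕ) : IsProbabilityMeasure (rotMeasure d k) :=
  ⟨by simpa [rotMeasure] using
    Measure.haarMeasure_self (K₀ := (⊤ : TopologicalSpace.PositiveCompacts (rotGroup d k)))⟩

theorem measurable_planeFrame (v : Frame d) (k : ℕ) :
    Measurable fun p : EuclideanSpace ℝ (Fin k) × rotGroup d k =>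
      v * boost (pad d p.1) * (p.2 : SOplus d) := by
  have h : Continuous fun p : EuclideanSpace ℝ (Fin k) × rotGroup d k =>
      v * boost (pad d p.1) * (p.2 : SOplus d) :=
    ((continuous_mul_boost_pad d k).comp (continuous_const.prodMk continuous_fst)).mul
      (continuous_subtype_val.comp continuous_snd)
  exact h.measurable

theorem lintegral_planeFrameMeasure (v : Frame d) {φ : Frame d → ℝ≥0∞} (hφ : Measurable φ) :
    ∫⁻ u, φ u ∂planeFrameMeasure k v =
      ∫⁻ y, ∫⁻ r : rotGroup d k, φ (v * boost (pad d y) * r) ∂rotMeasure d k ∂hypVolume k := by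
  have h := measurable_planeFrame v k
  have hm : Measurable fun p : EuclideanSpace ℝ (Fin k) × rotGroup d k =>
      φ (v * boost (pad d p.1) * (p.2 : SOplus d)) := hφ.comp h
  rw [planeFrameMeasure, lintegral_map hφ h, lintegral_prod _ hm.aemeasurable]

theorem plane_mul_rot (v : Frame d) (r : rotGroup d k) : plane (v * (r : SOplus d)) k = plane v k := by
  have h : (r : SOplus d) • plane (1 : Frame d) k = plane (1 : Frame d) k := r.2.2
  rw [← plane_mul, mul_one] at h
  rw [plane_mul, h, ← plane_mul, mul_one]

theorem basePt_mul_rot (v : Frame d) (r : rotGroup d k) : basePt (v * (r : SOplus d)) = basePt v := by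
  have h : (r : SOplus d) • origin d = origin d := r.2.1
  rw [basePt_mul]
  exact congrArg (v • ·) h

theorem planeSpan_boost_pad (hk : k ≤ d) (y : EuclideanSpace ℝ (Fin k)) :
    planeSpan (boost (pad d y)) k = planeSpan (1 : Frame d) k := by
  refine Submodule.eq_of_le_of_finrank_eq ?_ (by rw [finrank_planeSpan hk, finrank_planeSpan hk])
  rw [← mul_one (boost (pad d y)), planeSpan_mul, Submodule.map_le_iff_le_comap]
  intro x hx
  rw [mem_planeSpan_one] at hx
  refine mem_planeSpan_one.mpr fun i hi => ?_
  obtain rfl | ⟨j, rfl⟩ := Fin.eq_zero_or_eq_succ i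
  · simp at hi
  · have hj : ¬ (j : ℕ) < k := by rw [Fin.val_succ] at hi; omega
    change (boostMatrix (pad d y)).mulVec x j.succ = 0
    rw [boost_mulVec_succ, hx _ hi, pad, dif_neg hj, zero_mul, add_zero]

theorem planeSpan_mul_boost_pad (hk : k ≤ d) (v : Frame d) (y : EuclideanSpace ℝ (Fin k)) :
    planeSpan (v * boost (pad d y)) k = planeSpan v k := by
  rw [planeSpan_mul, planeSpan_boost_pad hk, ← planeSpan_mul, mul_one]

theorem planeSpan_frame (hk : k ≤ d) (v : Frame d) (y : EuclideanSpace ℝ (Fin k))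
    (r : rotGroup d k) : planeSpan (v * boost (pad d y) * (r : SOplus d)) k = planeSpan v k := by
  rw [← planeSpan_mul_boost_pad hk v y, planeSpan_eq_iff, plane_mul_rot]

theorem basePt_frame (v : Frame d) (y : EuclideanSpace ℝ (Fin k)) (r : rotGroup d k) :
    basePt (v * boost (pad d y) * (r : SOplus d)) = planePoint v y :=
  basePt_mul_rot _ r

/-- Extension of a vector of `ℝ^{k+1}` by zero. -/
noncomputable def extendZero (d : ℕ) (x : Fin (k + 1) → ℝ) : Fin (d + 1) → ℝ :=
  fun i => if h : (i : ℕ) < k + 1 then x ⟨i, h⟩ else 0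

theorem extendZero_castLE (hk : k ≤ d) (x : Fin (k + 1) → ℝ) (i : Fin (k + 1)) :
    extendZero d x (i.castLE (Nat.succ_le_succ hk)) = x i := by
  rw [extendZero, dif_pos (by exact i.2)]
  rfl

theorem extendZero_mem (x : Fin (k + 1) → ℝ) : extendZero d x ∈ planeSpan (1 : Frame d) k :=
  mem_planeSpan_one.mpr fun i hi => by rw [extendZero, dif_neg (by omega)]

theorem extendZero_of_mem (hk : k ≤ d) {w : Fin (d + 1) → ℝ} (hw : w ∈ planeSpan (1 : Frame d) k) :
    extendZero d (fun i : Fin (k + 1) => w (i.castLE (Nat.succ_le_succ hk))) = w := by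
  funext i
  rw [extendZero]
  split_ifs with h
  · rfl
  · exact (mem_planeSpan_one.mp hw i (by omega)).symm

theorem lorentz_extendZero (hk : k ≤ d) (x y : Fin (k + 1) → ℝ) :
    lorentz (extendZero d x) (extendZero d y) = lorentz x y := by
  obtain ⟨m, rfl⟩ := Nat.exists_eq_add_of_le hk
  rw [lorentz, lorentz, Fin.sum_univ_add]
  simp [extendZero]
  rfl

/-- The measure on the frames tangent to a plane depends only on the plane. -/
theorem planeFrameMeasure_mul_of_mem_stabilizer (hk : k ≤ d) (v h : Frame d)
    (hh : plane h k = plane (1 : Frame d) k) :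
    planeFrameMeasure k (v * h) = planeFrameMeasure k v := by
  have hmapE : ∀ w ∈ planeSpan (1 : Frame d) k, h.1.1.mulVec w ∈ planeSpan (1 : Frame d) k := by
    intro w hw
    rw [← planeSpan_eq_iff.mpr hh, ← mul_one h, planeSpan_mul]
    exact ⟨w, hw, by simp⟩
  -- The upper left block of h is its restriction to the linear span of the model plane: an isometry
  -- of ℍ^k.
  let A : Matrix (Fin (k + 1)) (Fin (k + 1)) ℝ := fun i j =>
    h.1.1 (i.castLE (Nat.succ_le_succ hk)) (j.castLE (Nat.succ_le_succ hk))
  have hAx : ∀ x i, A.mulVec x i =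
      h.1.1.mulVec (extendZero d x) (i.castLE (Nat.succ_le_succ hk)) := by
    intro x i
    simp only [Matrix.mulVec, dotProduct, A]
    have hinj : Function.Injective (Fin.castLE (Nat.succ_le_succ hk) : Fin (k + 1) → Fin (d + 1)) :=
      Fin.castLE_injective _
    rw [← Finset.sum_subset (Finset.subset_univ (Finset.univ.map ⟨_, hinj⟩)), Finset.sum_map]
    · refine Finset.sum_congr rfl fun j _ => ?_
      rw [Function.Embedding.coeFn_mk, extendZero_castLE hk]
    · intro j _ hj
      rw [extendZero, dif_neg, mul_zero]
      intro hlt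
      exact hj (Finset.mem_map.mpr ⟨⟨j, hlt⟩, Finset.mem_univ _, rfl⟩)
  have hAext : ∀ x, extendZero d (A.mulVec x) = h.1.1.mulVec (extendZero d x) := fun x => by
    rw [← extendZero_of_mem hk (hmapE _ (extendZero_mem x))]
    congr 1
    funext i
    exact hAx x i
  have hlor : ∀ x y, lorentz (A.mulVec x) (A.mulVec y) = lorentz x y := fun x y => by
    rw [← lorentz_extendZero hk, hAext, hAext, h.2.1, lorentz_extendZero hk]
  have hpos : ∀ x : HSpace k, 0 < A.mulVec x.1 0 := fun x => by
    rw [hAx]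
    exact h.2.2 ⟨extendZero d x.1, by rw [lorentz_extendZero hk]; exact x.2.1, x.2.2⟩
  -- The action of h on the model plane, in the coordinates y.
  let T : EuclideanSpace ℝ (Fin k) → EuclideanSpace ℝ (Fin k) := fun y =>
    WithLp.toLp 2 fun i => (h • planePoint (1 : Frame d) y).1 (Fin.succ (i.castLE hk))
  have hTcont : Continuous fun y : EuclideanSpace ℝ (Fin k) => h • planePoint (1 : Frame d) y :=
    (continuous_planePoint_right 1 k).const_smul h
  have hTm : Measurable T := by
    refine (WithLp.measurable_toLp 2 _).comp (measurable_pi_lambda _ fun i => ?_)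
    exact ((continuous_coord _).comp hTcont).measurable
  have hpt : ∀ y : EuclideanSpace ℝ (Fin k), (planePoint (1 : Frame d) y).1 =
      extendZero d (Fin.cons (√(1 + ‖y‖ ^ 2)) y : Fin (k + 1) → ℝ) := fun y => by
    rw [← extendZero_of_mem hk (planePoint_mem_plane (1 : Frame d) y)]
    congr 1
    funext i
    obtain rfl | ⟨j, rfl⟩ := Fin.eq_zero_or_eq_succ i
    · exact planePoint_one_zero hk y
    · rw [Fin.cons_succ]
      change (planePoint (1 : Frame d) y).1 (Fin.succ (j.castLE hk)) = _
      rw [planePoint_one_succ]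
      simp [pad]
  have hTA : ∀ y i, T y i = A.mulVec (Fin.cons (√(1 + ‖y‖ ^ 2)) y) (Fin.succ i) := fun y i => by
    rw [hAx, ← hpt]
    rfl
  have hTpt : ∀ y, planePoint (1 : Frame d) (T y) = h • planePoint (1 : Frame d) y := fun y => by
    have hmem : h • planePoint (1 : Frame d) y ∈ plane (1 : Frame d) k :=
      hmapE _ (planePoint_mem_plane (1 : Frame d) y)
    obtain ⟨z, hz⟩ := exists_planePoint_eq hk hmem
    rw [← hz]
    congr 1
    ext i
    change (h • planePoint (1 : Frame d) y).1 (Fin.succ (i.castLE hk)) = _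
    rw [← hz, planePoint_one_succ]
    simp [pad]
  -- The frames h · boost(y) and boost(T y) have the same base point and are tangent to the same
  -- plane, so they differ by an element of the fibre group.
  have hrot : ∀ y, (boost (pad d (T y)))⁻¹ * h * boost (pad d y) ∈ rotGroup d k := by
    intro y
    constructor
    · change ((boost (pad d (T y)))⁻¹ * h * boost (pad d y)) • origin d = origin d
      rw [mul_smul, mul_smul, inv_smul_eq_iff]
      have h1 := hTpt y
      rw [planePoint, planePoint, one_mul, one_mul] at h1
      exact h1.symm
    · change ((boost (pad d (T y)))⁻¹ * h * boost (pad d y)) • plane (1 : Frame d) k = _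
      have hb : ∀ y : EuclideanSpace ℝ (Fin k),
          boost (pad d y) • plane (1 : Frame d) k = plane (1 : Frame d) k := fun y => by
        rw [← plane_mul, mul_one, planeSpan_eq_iff.mp (planeSpan_boost_pad hk y)]
      rw [mul_smul, mul_smul, inv_smul_eq_iff, hb, hb, ← plane_mul, mul_one, hh]
  refine Measure.ext_of_lintegral _ fun φ hφ => ?_
  rw [lintegral_planeFrameMeasure _ hφ, lintegral_planeFrameMeasure _ hφ]
  have hG : Measurable fun y : EuclideanSpace ℝ (Fin k) =>
      ∫⁻ r : rotGroup d k, φ (v * boost (pad d y) * r) ∂rotMeasure d k :=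
    (hφ.comp (measurable_planeFrame v k)).lintegral_prod_right'
  -- Invariance of volume absorbs T on the base; left invariance of Haar measure then absorbs the
  -- rotation in every fibre.
  rw [← lintegral_hypVolume_comp A hlor hpos hTm hTA hG]
  refine lintegral_congr fun y => ?_
  refine Eq.trans ?_ (lintegral_mul_left_eq_self (μ := rotMeasure d k)
    (fun r => φ (v * boost (pad d (T y)) * (r : SOplus d))) (⟨_, hrot y⟩ : rotGroup d k))
  refine lintegral_congr fun r => ?_
  congr 1
  rw [Subgroup.coe_mul]
  group

theorem planeFrameMeasure_congr (hk : k ≤ d) {v w : Frame d} (h : planeSpan v k = planeSpan w k) :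
    planeFrameMeasure k v = planeFrameMeasure k w := by
  have h1 : plane (v⁻¹ * w) k = plane (1 : Frame d) k := by
    rw [plane_mul, ← planeSpan_eq_iff.mp h, ← plane_mul, inv_mul_cancel]
  rw [← planeFrameMeasure_mul_of_mem_stabilizer hk v _ h1, mul_inv_cancel_left]

theorem map_mul_planeFrameMeasure (g v : Frame d) (k : ℕ) :
    (planeFrameMeasure k v).map (g * ·) = planeFrameMeasure k (g * v) := by
  rw [planeFrameMeasure, planeFrameMeasure, Measure.map_map (measurable_const_mul g)
    (measurable_planeFrame v k)]
  simp only [Function.comp_def, mul_assoc]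

/-- Integrals over the frames tangent to a plane may be computed with the base point. -/
theorem lintegral_planeFrameMeasure_congr (hk : k ≤ d) (v : Frame d) {φ : Frame d → ℝ≥0∞}
    (hφ : Measurable φ) {ψ : HSpace d → ℝ≥0∞}
    (h : ∀ u, planeSpan u k = planeSpan v k → φ u = ψ (basePt u)) :
    ∫⁻ u, φ u ∂planeFrameMeasure k v = ∫⁻ y, ψ (planePoint v y) ∂hypVolume k := by
  rw [lintegral_planeFrameMeasure v hφ]
  refine lintegral_congr fun y => ?_
  simp only [h _ (planeSpan_frame hk v y _), basePt_frame, lintegral_const, measure_univ, mul_one]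

end FrameMeasure

/-! ### The intersection kernel -/

section Kernel

variable {d k l : ℕ}

/-- The coordinate projection of `ℝ^{d+1}` onto the span of the first `k + 1` vectors. -/
noncomputable def coordProj (d k : ℕ) : Matrix (Fin (d + 1)) (Fin (d + 1)) ℝ :=
  Matrix.diagonal fun i => if (i : ℕ) ≤ k then 1 else 0

theorem mem_planeSpan_iff_exists {v : Frame d} {x : Fin (d + 1) → ℝ} :
    x ∈ planeSpan v k ↔ ∃ c, (v.1.1 * coordProj d k).mulVec c = x := by
  have hP : ∀ c, (coordProj d k).mulVec c ∈ planeSpan (1 : Frame d) k := fun c =>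
    mem_planeSpan_one.mpr fun i hi => by
      rw [coordProj, Matrix.mulVec_diagonal, if_neg (by omega), zero_mul]
  rw [← mul_one v, planeSpan_mul, mul_one]
  constructor
  · rintro ⟨c, hc, rfl⟩
    refine ⟨c, ?_⟩
    rw [← Matrix.mulVec_mulVec, Matrix.mulVecLin_apply]
    congr 1
    funext i
    rw [coordProj, Matrix.mulVec_diagonal]
    split_ifs with h
    · rw [one_mul]
    · rw [mem_planeSpan_one.mp hc i (by omega), mul_zero]
  · rintro ⟨c, rfl⟩
    exact ⟨_, hP c, by rw [← Matrix.mulVec_mulVec, Matrix.mulVecLin_apply]⟩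

/-- The two spans are the ranges of matrices U and V. The matrix UUᵀ + VVᵀ is singular exactly when
Uᵀ and Vᵀ kill a common nonzero vector, that is, when some nonzero vector is orthogonal to both
ranges. This exhibits transversality as an open condition on the frames. -/
theorem sup_eq_top_iff_det_ne_zero {u v : Frame d} :
    planeSpan u k ⊔ planeSpan v l = ⊤ ↔
      ((u.1.1 * coordProj d k) * (u.1.1 * coordProj d k).transpose +
        (v.1.1 * coordProj d l) * (v.1.1 * coordProj d l).transpose).det ≠ 0 := by
  have hu : ∀ x, x ∈ planeSpan u k ↔ _ := fun x => mem_planeSpan_iff_exists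
  have hv : ∀ x, x ∈ planeSpan v l ↔ _ := fun x => mem_planeSpan_iff_exists
  generalize u.1.1 * coordProj d k = U at *
  generalize v.1.1 * coordProj d l = V at *
  constructor
  · intro h hdet
    obtain ⟨w, hw0, hw⟩ := Matrix.exists_mulVec_eq_zero_iff.mpr hdet
    -- Pairing the null vector with itself gives |Uᵀw|² + |Vᵀw|² = 0.
    have hsq : dotProduct (U.transpose.mulVec w) (U.transpose.mulVec w) +
        dotProduct (V.transpose.mulVec w) (V.transpose.mulVec w) = 0 := by
      have h1 := congrArg (dotProduct w) hw
      rw [Matrix.add_mulVec, dotProduct_add, ← Matrix.mulVec_mulVec, ← Matrix.mulVec_mulVec,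
        Matrix.dotProduct_mulVec w U, Matrix.dotProduct_mulVec w V, dotProduct_zero] at h1
      simpa only [Matrix.mulVec_transpose] using h1
    have hnn : ∀ x : Fin (d + 1) → ℝ, 0 ≤ dotProduct x x := fun x =>
      Finset.sum_nonneg fun i _ => mul_self_nonneg _
    have hU0 : U.transpose.mulVec w = 0 := dotProduct_self_eq_zero.mp (by
      linarith [hnn (U.transpose.mulVec w), hnn (V.transpose.mulVec w)])
    have hV0 : V.transpose.mulVec w = 0 := dotProduct_self_eq_zero.mp (by
      linarith [hnn (U.transpose.mulVec w), hnn (V.transpose.mulVec w)])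
    obtain ⟨a, ha, b, hb, hab⟩ := Submodule.mem_sup.mp (h ▸ Submodule.mem_top :
      w ∈ planeSpan u k ⊔ planeSpan v l)
    obtain ⟨a, rfl⟩ := (hu _).mp ha
    obtain ⟨b, rfl⟩ := (hv _).mp hb
    refine hw0 (dotProduct_self_eq_zero.mp ?_)
    nth_rw 2 [← hab]
    rw [dotProduct_add, Matrix.dotProduct_mulVec, Matrix.dotProduct_mulVec,
      ← Matrix.mulVec_transpose, ← Matrix.mulVec_transpose, hU0, hV0, zero_dotProduct,
      zero_dotProduct, add_zero]
  · intro hdet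
    refine eq_top_iff.mpr fun x _ => ?_
    obtain ⟨w, rfl⟩ := Matrix.mulVec_surjective_iff_isUnit.mpr
      ((Matrix.isUnit_iff_isUnit_det _).mpr hdet.isUnit) x
    rw [Matrix.add_mulVec, ← Matrix.mulVec_mulVec, ← Matrix.mulVec_mulVec]
    exact Submodule.add_mem_sup ((hu _).mpr ⟨_, rfl⟩) ((hv _).mpr ⟨_, rfl⟩)

theorem isOpen_sup_eq_top (d k l : ℕ) :
    IsOpen {p : Frame d × Frame d | planeSpan p.1 k ⊔ planeSpan p.2 l = ⊤} := by
  simp only [sup_eq_top_iff_det_ne_zero]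
  have h : ∀ m, Continuous fun v : Frame d => v.1.1 * coordProj d m := fun m =>
    (val_isEmbedding d).continuous.matrix_mul continuous_const
  have h1 : Continuous fun p : Frame d × Frame d => p.1.1.1 * coordProj d k :=
    (h k).comp continuous_fst
  have h2 : Continuous fun p : Frame d × Frame d => p.2.1.1 * coordProj d l :=
    (h l).comp continuous_snd
  exact isOpen_ne_fun ((h1.matrix_mul h1.matrix_transpose).add
    (h2.matrix_mul h2.matrix_transpose)).matrix_det continuous_const

theorem mem_geoClosedBall_iff (hk : k ≤ d) {δ : ℝ} {v : Frame d} {x : HSpace d} :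
    x ∈ geoClosedBall k δ v ↔
      ∃ y ∈ Metric.closedBall (0 : EuclideanSpace ℝ (Fin k)) (Real.sinh δ), planePoint v y = x := by
  constructor
  · rintro ⟨hx, hx'⟩
    obtain ⟨y, rfl⟩ := exists_planePoint_eq hk hx
    exact ⟨y, mem_closedBall_zero_iff.mpr ((hdist_planePoint_le hk v y).mp hx'), rfl⟩
  · rintro ⟨y, hy, rfl⟩
    exact ⟨planePoint_mem_plane v y, (hdist_planePoint_le hk v y).mpr (mem_closedBall_zero_iff.mp hy)⟩

/-- The pairs of frames are the projection of a closed incidence set along the compact product of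
two parameter balls. Together with the openness of transversality this makes the kernel measurable.
-/
theorem isClosed_geoClosedBall_inter_nonempty (hk : k ≤ d) (hl : l ≤ d) (δ : ℝ) :
    IsClosed {p : Frame d × Frame d |
      (geoClosedBall k δ p.1 ∩ geoClosedBall l δ p.2).Nonempty} := by
  let B : (m : ℕ) → Set (EuclideanSpace ℝ (Fin m)) := fun m => Metric.closedBall 0 (Real.sinh δ)
  have hB : ∀ m, CompactSpace (B m) := fun m =>
    isCompact_iff_compactSpace.mp (isCompact_closedBall _ _)
  have hg1 : Continuous fun q : (Frame d × Frame d) × (B k × B l) => (q.1.1, q.2.1.1) := by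
    fun_prop
  have hg2 : Continuous fun q : (Frame d × Frame d) × (B k × B l) => (q.1.2, q.2.2.1) := by
    fun_prop
  have h1 := (continuous_planePoint d k).comp hg1
  have h2 := (continuous_planePoint d l).comp hg2
  have hcl : IsClosed {q : (Frame d × Frame d) × (B k × B l) |
      planePoint q.1.1 q.2.1.1 = planePoint q.1.2 q.2.2.1} :=
    isClosed_eq h1 h2
  convert isClosedMap_fst_of_compactSpace _ hcl using 1
  ext p
  constructor
  · rintro ⟨x, hx, hx'⟩
    obtain ⟨y, hy, hyx⟩ := (mem_geoClosedBall_iff hk).mp hx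
    obtain ⟨z, hz, hzx⟩ := (mem_geoClosedBall_iff hl).mp hx'
    exact ⟨(p, (⟨y, hy⟩, ⟨z, hz⟩)), hyx.trans hzx.symm, rfl⟩
  · rintro ⟨⟨p, y, z⟩, h, rfl⟩
    exact ⟨planePoint p.1 y.1, (mem_geoClosedBall_iff hk).mpr ⟨y, y.2, rfl⟩,
      (mem_geoClosedBall_iff hl).mpr ⟨z, z.2, h.symm⟩⟩

theorem measurableSet_ballsTransverse (hk : k ≤ d) (hl : l ≤ d) (δ : ℝ) :
    MeasurableSet {p : Frame d × Frame d | BallsTransverse k l δ p.1 p.2} := by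
  simp only [ballsTransverse_iff]
  exact (isClosed_geoClosedBall_inter_nonempty hk hl δ).measurableSet.inter
    (isOpen_sup_eq_top d k l).measurableSet

/-- The volume of a ball of radius `δ` in `ℍ^k`. -/
noncomputable def ballVolume (k : ℕ) (δ : ℝ) : ℝ≥0∞ :=
  hypVolume k (Metric.ball 0 (Real.sinh δ))

theorem hypVolume_absolutelyContinuous (k : ℕ) : hypVolume k ≪ volume :=
  withDensity_absolutelyContinuous _ _

theorem hypVolume_le (k : ℕ) : hypVolume k ≤ volume := by
  refine (withDensity_mono (g := 1) (ae_of_all _ fun y => ?_)).trans_eq withDensity_one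
  refine ENNReal.ofReal_le_one.mpr ?_
  rw [div_le_one (Real.sqrt_pos.mpr (by positivity)), Real.one_le_sqrt]
  linarith [sq_nonneg ‖y‖]

/-- The kernel tests closed balls but is normalized by open ones. The bounding sphere is a null set,
so the two volumes cancel exactly. -/
theorem hypVolume_closedBall (hk : 1 ≤ k) (δ : ℝ) :
    hypVolume k (Metric.closedBall 0 (Real.sinh δ)) = ballVolume k δ := by
  have : Nontrivial (EuclideanSpace ℝ (Fin k)) := by
    have : Nonempty (Fin k) := ⟨⟨0, hk⟩⟩
    infer_instance
  have h0 : hypVolume k (Metric.sphere 0 (Real.sinh δ)) = 0 :=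
    hypVolume_absolutelyContinuous k (Measure.addHaar_sphere _ _ _)
  rw [← Metric.ball_union_sphere, ballVolume]
  refine le_antisymm ((measure_union_le _ _).trans_eq (by rw [h0, add_zero])) ?_
  exact measure_mono Set.subset_union_left

theorem ballVolume_ne_top (k : ℕ) (δ : ℝ) : ballVolume k δ ≠ ∞ :=
  ne_top_of_le_ne_top measure_ball_lt_top.ne (hypVolume_le k _)

theorem ballVolume_ne_zero (k : ℕ) {δ : ℝ} (hδ : 0 < δ) : ballVolume k δ ≠ 0 := by
  have hpos : ∀ y : EuclideanSpace ℝ (Fin k), ENNReal.ofReal (1 / √(1 + ‖y‖ ^ 2)) ≠ 0 := fun y => by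
    rw [← pos_iff_ne_zero, ENNReal.ofReal_pos]
    exact div_pos one_pos (Real.sqrt_pos.mpr (by positivity))
  rw [ballVolume, hypVolume, withDensity_apply _ Metric.isOpen_ball.measurableSet, ← pos_iff_ne_zero,
    setLIntegral_pos_iff (measurable_hypDensity k)]
  have : (Function.support fun y : EuclideanSpace ℝ (Fin k) =>
      ENNReal.ofReal (1 / √(1 + ‖y‖ ^ 2))) = Set.univ := Set.eq_univ_of_forall hpos
  rw [this, Set.univ_inter]
  exact Metric.measure_ball_pos _ _ (Real.sinh_pos_iff.mpr hδ)

theorem planeVolume_geoBall (hk : k ≤ d) {δ : ℝ} (hδ : 0 < δ) (v : Frame d) :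
    planeVolume k v (geoBall k δ v) = ballVolume k δ := by
  have hm : MeasurableSet (geoBall k δ v) := by
    have h1 : IsClosed (plane v k) :=
      (Submodule.closed_of_finiteDimensional (planeSpan v k)).preimage continuous_subtype_val
    have h2 : IsOpen {x : HSpace d | hdist (basePt v) x < δ} := by
      simp only [hdist_lt_iff hδ.le]
      exact isOpen_lt ((continuous_hdist_lorentz d).comp (continuous_const.prodMk continuous_id))
        continuous_const
    exact h1.measurableSet.inter h2.measurableSet
  change (hypVolume k).map (planePoint v) (geoBall k δ v) = _
  rw [Measure.map_apply (continuous_planePoint_right v k).measurable hm, ballVolume]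
  congr 1
  ext y
  rw [mem_ball_zero_iff, ← hdist_planePoint_lt hk v y]
  exact ⟨fun h => h.2, fun h => ⟨planePoint_mem_plane v y, h⟩⟩

open Classical in
-- The normalizing constant is the same for all frames, as every δ-ball is parametrized by the same
-- Euclidean ball.
theorem ofReal_kernelH (hk : k ≤ d) (hl : l ≤ d) {δ : ℝ} (hδ : 0 < δ) (u v : Frame d) :
    ENNReal.ofReal (kernelH k l δ u v) =
      if BallsTransverse k l δ u v then (ballVolume k δ * ballVolume l δ)⁻¹ else 0 := by
  rw [kernelH]
  split_ifs with h
  · have hk0 := ENNReal.toReal_pos (ballVolume_ne_zero k hδ) (ballVolume_ne_top k δ)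
    have hl0 := ENNReal.toReal_pos (ballVolume_ne_zero l hδ) (ballVolume_ne_top l δ)
    rw [planeVolume_geoBall hk hδ, planeVolume_geoBall hl hδ, one_div,
      ENNReal.ofReal_inv_of_pos (mul_pos hk0 hl0), ENNReal.ofReal_mul hk0.le,
      ENNReal.ofReal_toReal (ballVolume_ne_top k δ), ENNReal.ofReal_toReal (ballVolume_ne_top l δ)]
  · exact ENNReal.ofReal_zero

theorem kernelH_nonneg (k l : ℕ) (δ : ℝ) (u v : Frame d) : 0 ≤ kernelH k l δ u v := by
  unfold kernelH
  split_ifs <;> positivity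

theorem measurable_ofReal_kernelH (hk : k ≤ d) (hl : l ≤ d) {δ : ℝ} (hδ : 0 < δ) :
    Measurable fun p : Frame d × Frame d => ENNReal.ofReal (kernelH k l δ p.1 p.2) := by
  classical
  have h : (fun p : Frame d × Frame d => ENNReal.ofReal (kernelH k l δ p.1 p.2)) = fun p =>
      if BallsTransverse k l δ p.1 p.2 then (ballVolume k δ * ballVolume l δ)⁻¹ else 0 :=
    funext fun p => ofReal_kernelH hk hl hδ p.1 p.2
  rw [h]
  exact Measurable.ite (measurableSet_ballsTransverse hk hl δ) measurable_const measurable_const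

theorem measurable_ofReal_kernelH_left (hk : k ≤ d) (hl : l ≤ d) {δ : ℝ} (hδ : 0 < δ)
    (v : Frame d) : Measurable fun u : Frame d => ENNReal.ofReal (kernelH k l δ u v) := by
  have h : Measurable fun u : Frame d => (u, v) := measurable_id.prodMk measurable_const
  have h' := (measurable_ofReal_kernelH (k := k) (l := l) hk hl hδ).comp h
  exact h'

theorem kernelH_mul (hk : k ≤ d) (hl : l ≤ d) {δ : ℝ} (hδ : 0 < δ) (g u v : Frame d) :
    kernelH k l δ (g * u) (g * v) = kernelH k l δ u v := by
  rw [kernelH, kernelH, planeVolume_geoBall hk hδ, planeVolume_geoBall hl hδ,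
    planeVolume_geoBall hk hδ, planeVolume_geoBall hl hδ]
  by_cases h : BallsTransverse k l δ u v
  · rw [if_pos h, if_pos (ballsTransverse_mul.mpr h)]
  · rw [if_neg h, if_neg fun h' => h (ballsTransverse_mul.mp h')]

/-- A translate of u whose ball touches that of v has its base point in a fixed compact set, so
proper discontinuity applies. The series defining K_δ is thus a finite sum, and its `tsum` is not a
default value. -/
theorem finite_ballsTransverse (Δ : Subgroup (SOplus d)) [DiscreteTopology Δ] (hl : l ≤ d) (δ : ℝ)
    (u v : Frame d) : {g : Δ | BallsTransverse k l δ (g • u) v}.Finite := by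
  obtain ⟨C, hC, hCn⟩ := exists_isCompact_neighborhood (isCompact_geoClosedBall hl δ v) δ
  refine (finite_transporter Δ (isCompact_singleton (x := basePt u)) hC).subset ?_
  rintro g ⟨⟨x, hx, hx'⟩, -⟩
  refine ⟨_, rfl, hCn x hx' _ ?_⟩
  rw [hdist_comm]
  have h := hx.2
  change hdist (basePt ((g : SOplus d) * u)) x ≤ δ at h
  rwa [basePt_mul] at h

/-- The representatives chosen by `out` are translates a u and b v; the reindexing g ↦ b g a⁻¹ and
the invariance of the kernel under b remove them. -/
theorem kernelM_mk (Δ : Subgroup (SOplus d)) (hk : k ≤ d) (hl : l ≤ d) {δ : ℝ} (hδ : 0 < δ)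
    (u v : Frame d) : kernelM Δ k l δ (toFrameBundle Δ u) (toFrameBundle Δ v) =
      ∑' g : Δ, kernelH k l δ (g • u) v := by
  obtain ⟨a, ha⟩ := Quotient.mk_out (s := MulAction.orbitRel Δ (Frame d)) u
  obtain ⟨b, hb⟩ := Quotient.mk_out (s := MulAction.orbitRel Δ (Frame d)) v
  rw [kernelM, ← ((Equiv.mulLeft b).trans (Equiv.mulRight a⁻¹)).tsum_eq]
  refine tsum_congr fun g => ?_
  change kernelH k l δ (((b * g * a⁻¹ : Δ)) • (toFrameBundle Δ u).out) (toFrameBundle Δ v).out = _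
  have ha' : (toFrameBundle Δ u).out = a • u := ha.symm
  have hb' : (toFrameBundle Δ v).out = b • v := hb.symm
  rw [ha', hb', mul_smul, mul_smul, inv_smul_smul]
  exact kernelH_mul hk hl hδ (b : SOplus d) (g • u) v

theorem ofReal_kernelM_mk (Δ : Subgroup (SOplus d)) [DiscreteTopology Δ] (hk : k ≤ d) (hl : l ≤ d)
    {δ : ℝ} (hδ : 0 < δ) (u v : Frame d) :
    ENNReal.ofReal (kernelM Δ k l δ (toFrameBundle Δ u) (toFrameBundle Δ v)) =
      ∑' g : Δ, ENNReal.ofReal (kernelH k l δ (g • u) v) := by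
  rw [kernelM_mk Δ hk hl hδ]
  refine ENNReal.ofReal_tsum_of_nonneg (fun g => kernelH_nonneg k l δ _ _) ?_
  refine summable_of_hasFiniteSupport ((finite_ballsTransverse (k := k) Δ hl δ u v).subset fun g hg => ?_)
  by_contra h
  exact hg (if_neg h)

theorem kernelM_nonneg (Δ : Subgroup (SOplus d)) (k l : ℕ) (δ : ℝ) (u v : FrameBundle Δ) :
    0 ≤ kernelM Δ k l δ u v :=
  tsum_nonneg fun _ => kernelH_nonneg k l δ _ _

theorem measurable_toFrameBundle (Δ : Subgroup (SOplus d)) : Measurable (toFrameBundle Δ) :=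
  measurable_quot_mk

theorem measurable_toMfd (Δ : Subgroup (SOplus d)) : Measurable (toMfd Δ) :=
  measurable_quot_mk

theorem smul_frame {Δ : Subgroup (SOplus d)} (g : Δ) (u : Frame d) : g • u = (g : SOplus d) * u :=
  rfl

theorem measurable_ofReal_sum_kernelH (Δ : Subgroup (SOplus d)) [DiscreteTopology Δ] (hk : k ≤ d)
    (hl : l ≤ d) {δ : ℝ} (hδ : 0 < δ) :
    Measurable fun p : Frame d × Frame d =>
      ∑' g : Δ, ENNReal.ofReal (kernelH k l δ (g • p.1) p.2) := by
  refine Measurable.tsum fun g => ?_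
  have h : Measurable fun p : Frame d × Frame d => ((g : SOplus d) * p.1, p.2) :=
    (measurable_fst.const_mul _).prodMk measurable_snd
  have h' := (measurable_ofReal_kernelH (k := k) (l := l) hk hl hδ).comp h
  simp only [smul_frame]
  exact h'

theorem measurable_kernelM_left (Δ : Subgroup (SOplus d)) [DiscreteTopology Δ] (hk : k ≤ d)
    (hl : l ≤ d) {δ : ℝ} (hδ : 0 < δ) (v : FrameBundle Δ) :
    Measurable fun u => kernelM Δ k l δ u v := by
  obtain ⟨v, rfl⟩ := Quotient.mk_surjective v
  refine measurable_from_quotient.mpr ?_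
  have h : ∀ u, kernelM Δ k l δ (toFrameBundle Δ u) (toFrameBundle Δ v) =
      (∑' g : Δ, ENNReal.ofReal (kernelH k l δ (g • u) v)).toReal := fun u => by
    rw [← ofReal_kernelM_mk Δ hk hl hδ, ENNReal.toReal_ofReal (kernelM_nonneg _ _ _ _ _ _)]
  change Measurable fun u => kernelM Δ k l δ (toFrameBundle Δ u) (toFrameBundle Δ v)
  simp only [h]
  exact ((measurable_ofReal_sum_kernelH Δ hk hl hδ).comp
    (measurable_id.prodMk measurable_const)).ennreal_toReal

end Kernel

/-! ### Unfolding the inner integral -/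

section Unfolding

variable {d k l : ℕ}

/-- Unfolding: the translates of a strict fundamental domain tile the space of frames, and μ is
invariant under them. -/
theorem lintegral_fundDomain (Λ : Subgroup (SOplus d)) [DiscreteTopology Λ] {μ : Measure (Frame d)}
    (hμ : ∀ h ∈ Λ, μ.map (h * ·) = μ) {φ : Frame d → ℝ≥0∞} (hφ : Measurable φ) :
    ∫⁻ u in fundDomain Λ, ∑' h : Λ, φ ((h : SOplus d) * u) ∂μ = ∫⁻ u, φ u ∂μ := by
  have hD : IsStrictFundDomain Λ (fundDomain Λ) := (exists_fundDomain Λ).choose_spec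
  have hinv : SMulInvariantMeasure Λ (Frame d) μ := ⟨fun h s hs => by
    conv_rhs => rw [← hμ h h.2, Measure.map_apply (measurable_const_mul _) hs]
    rfl⟩
  have hF : IsFundamentalDomain Λ (fundDomain Λ) μ := .mk' hD.1.nullMeasurableSet hD.2
  have hm : ∀ h : Λ, Measurable fun u => φ ((h : SOplus d) * u) := fun h =>
    hφ.comp (measurable_const_mul (h : SOplus d))
  rw [lintegral_tsum fun h => (hm h).aemeasurable, hF.lintegral_eq_tsum'' φ]
  rfl

theorem map_mul_planeFrameMeasure_of_mem_planeStab (hk : k ≤ d) {Δ : Subgroup (SOplus d)}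
    {v : Frame d} {h : SOplus d} (hh : h ∈ planeStab Δ v k) :
    (planeFrameMeasure k v).map (h * ·) = planeFrameMeasure k v := by
  rw [map_mul_planeFrameMeasure]
  refine planeFrameMeasure_congr hk (planeSpan_eq_iff.mpr ?_)
  rw [plane_mul]
  exact hh.2

theorem mem_planeStab_iff {Δ : Subgroup (SOplus d)} {v : Frame d} {h : SOplus d} :
    h ∈ planeStab Δ v k ↔ h ∈ Δ ∧ planeSpan (h * v) k = planeSpan v k := by
  rw [planeSpan_eq_iff, plane_mul]
  rfl

/-- An element of the group that takes the chosen lift of `N` to a given lift. -/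
noncomputable def GeodesicSubmanifold.translate {Δ : Subgroup (SOplus d)}
    (N : GeodesicSubmanifold Δ k) (V : N.lifts) : SOplus d := V.2.choose

theorem GeodesicSubmanifold.translate_mem {Δ : Subgroup (SOplus d)}
    (N : GeodesicSubmanifold Δ k) (V : N.lifts) : N.translate V ∈ Δ := V.2.choose_spec.1

theorem GeodesicSubmanifold.planeSpan_translate {Δ : Subgroup (SOplus d)}
    (N : GeodesicSubmanifold Δ k) (V : N.lifts) :
    planeSpan (N.translate V * N.frame) k = V.1 := V.2.choose_spec.2.symm

theorem GeodesicSubmanifold.map_mem_lifts {Δ : Subgroup (SOplus d)}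
    (N : GeodesicSubmanifold Δ k) {g : SOplus d} (hg : g ∈ Δ)
    {V : Submodule ℝ (Fin (d + 1) → ℝ)} (hV : V ∈ N.lifts) : V.map g.1.1.mulVecLin ∈ N.lifts := by
  obtain ⟨a, ha, rfl⟩ := hV
  exact ⟨g * a, Δ.mul_mem hg ha, by rw [mul_assoc, planeSpan_mul g]⟩

/-- Orbit and stabilizer: the cosets of the stabilizer of the chosen plane in Δ are indexed by the
lifts. -/
theorem translate_mul_bijective {Δ : Subgroup (SOplus d)} (N : GeodesicSubmanifold Δ k) :
    Function.Bijective fun p : N.lifts × planeStab Δ N.frame k =>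
      (⟨N.translate p.1 * p.2, Δ.mul_mem (N.translate_mem p.1) p.2.2.1⟩ : Δ) := by
  have hspan : ∀ (V : N.lifts) (h : planeStab Δ N.frame k),
      planeSpan (N.translate V * (h : SOplus d) * N.frame) k = V.1 := fun V h => by
    rw [mul_assoc, planeSpan_mul, (mem_planeStab_iff.mp h.2).2, ← planeSpan_mul,
      N.planeSpan_translate]
  constructor
  · rintro ⟨V, h⟩ ⟨V', h'⟩ heq
    have heq : N.translate V * (h : SOplus d) = N.translate V' * h' := congrArg Subtype.val heq
    have hV : V = V' := Subtype.ext (by rw [← hspan V h, heq, hspan])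
    subst hV
    rw [Subtype.ext (mul_left_cancel heq)]
  · rintro ⟨g, hg⟩
    let V : N.lifts := ⟨_, g, hg, rfl⟩
    refine ⟨⟨V, ⟨(N.translate V)⁻¹ * g, mem_planeStab_iff.mpr
      ⟨Δ.mul_mem (Δ.inv_mem (N.translate_mem V)) hg, ?_⟩⟩⟩,
      Subtype.ext (mul_inv_cancel_left _ _)⟩
    rw [← planeSpan_mul_left_cancel (g := N.translate V), mul_assoc, mul_inv_cancel_left,
      N.planeSpan_translate]

theorem countable_lifts {Δ : Subgroup (SOplus d)} [DiscreteTopology Δ] (N : GeodesicSubmanifold Δ k) : N.lifts.Countable := by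
  have h : N.lifts = Set.range fun g : Δ => planeSpan ((g : SOplus d) * N.frame) k := by
    ext V
    exact ⟨fun ⟨g, hg, h⟩ => ⟨⟨g, hg⟩, h.symm⟩, fun ⟨g, h⟩ => ⟨g, g.2, h.symm⟩⟩
  rw [h]
  exact Set.countable_range _

/-- The integral of a Poincaré series over the frames tangent to `N` is the sum of the integrals
over the frames tangent to the lifts of `N`. -/
theorem lintegral_poincare (hk : k ≤ d) {Δ : Subgroup (SOplus d)} [DiscreteTopology Δ]
    (N : GeodesicSubmanifold Δ k) {φ : Frame d → ℝ≥0∞} (hφ : Measurable φ) :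
    ∫⁻ u in fundDomain (planeStab Δ N.frame k), ∑' g : Δ, φ (g • u) ∂planeFrameMeasure k N.frame =
      ∑' V : N.lifts, ∫⁻ u, φ u ∂planeFrameMeasure k (N.translate V * N.frame) := by
  have hcount : Countable N.lifts := (countable_lifts N).to_subtype
  have hφg : ∀ g : SOplus d, Measurable fun u => φ (g * u) := fun g =>
    hφ.comp (measurable_const_mul g)
  -- Δ is split into cosets. The sum over the stabilizer will undo the fundamental domain, and the
  -- sum over coset representatives yields the lifts.
  have h1 : ∀ u, ∑' g : Δ, φ (g • u) = ∑' V : N.lifts, ∑' h : planeStab Δ N.frame k,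
      φ (N.translate V * ((h : SOplus d) * u)) := fun u => by
    rw [← (Equiv.ofBijective _ (translate_mul_bijective N)).tsum_eq, ENNReal.tsum_prod']
    refine tsum_congr fun V => tsum_congr fun h => ?_
    rw [← mul_assoc]
    rfl
  simp only [h1]
  have hm : ∀ V : N.lifts, Measurable fun u =>
      ∑' h : planeStab Δ N.frame k, φ (N.translate V * ((h : SOplus d) * u)) := fun V =>
    Measurable.tsum fun h => (hφg (N.translate V)).comp (measurable_const_mul (h : SOplus d))
  rw [lintegral_tsum fun V => (hm V).aemeasurable]
  refine tsum_congr fun V => ?_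
  rw [lintegral_fundDomain _ (fun h hh => map_mul_planeFrameMeasure_of_mem_planeStab hk hh)
    (hφg (N.translate V)), ← map_mul_planeFrameMeasure, lintegral_map hφ (measurable_const_mul _)]

/-- The ball of radius `δ` in the `l`-plane of `v` meets the plane with linear span `V`
transversely. -/
def Meets (l : ℕ) (δ : ℝ) (v : Frame d) (V : Submodule ℝ (Fin (d + 1) → ℝ)) : Prop :=
  V ⊔ planeSpan v l = ⊤ ∧ ∃ x ∈ geoClosedBall l δ v, x.1 ∈ V

open Classical in
-- A plane transverse to that of v meets it in at most one point z. If z lies in the ball of v, a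
-- tangent frame contributes exactly when its base point is within δ of z. The base points fill a
-- closed δ-ball, whose volume cancels one factor of c_δ, and each fibre has mass one.
theorem lintegral_kernelH (hk : 1 ≤ k) (hkd : k ≤ d) (hl : l ≤ d) (hkl : k + l = d) {δ : ℝ}
    (hδ : 0 < δ) (w v : Frame d) :
    ∫⁻ u, ENNReal.ofReal (kernelH k l δ u v) ∂planeFrameMeasure k w =
      if Meets l δ v (planeSpan w k) then (ballVolume l δ)⁻¹ else 0 := by
  have hm := measurable_ofReal_kernelH_left hkd hl hδ v
  split_ifs with h
  · obtain ⟨htop, z, hzv, hzw⟩ := h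
    obtain ⟨y, hy⟩ := exists_planePoint_eq hkd (show z ∈ plane w k from hzw)
    have hspan := planeSpan_mul_boost_pad hkd w y
    -- The frame describing the plane is replaced by one based at z, so that the relevant ball is
    -- centred at the origin of the coordinates.
    rw [← planeFrameMeasure_congr hkd hspan]
    rw [← hspan] at htop hzw
    generalize hw' : w * boost (pad d y) = w' at *
    have hz : basePt w' = z := by rw [← hy, ← hw']; rfl
    rw [lintegral_planeFrameMeasure_congr hkd w' hm
      (ψ := fun x => if hdist x z ≤ δ then (ballVolume k δ * ballVolume l δ)⁻¹ else 0)]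
    · have h1 : ∀ y : EuclideanSpace ℝ (Fin k),
          (if hdist (planePoint w' y) z ≤ δ then (ballVolume k δ * ballVolume l δ)⁻¹ else 0) =
          (Metric.closedBall 0 (Real.sinh δ)).indicator
            (fun _ => (ballVolume k δ * ballVolume l δ)⁻¹) y := fun y => by
        rw [Set.indicator]
        refine if_congr ?_ rfl rfl
        rw [hdist_comm, ← hz, hdist_planePoint_le hkd, mem_closedBall_zero_iff]
      simp only [h1]
      rw [lintegral_indicator Metric.isClosed_closedBall.measurableSet, setLIntegral_const,
        hypVolume_closedBall hk, ENNReal.mul_inv (.inl (ballVolume_ne_zero k hδ))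
        (.inl (ballVolume_ne_top k δ)), mul_comm, ← mul_assoc,
        ENNReal.mul_inv_cancel (ballVolume_ne_zero k hδ) (ballVolume_ne_top k δ), one_mul]
    · intro u hu
      rw [ofReal_kernelH hkd hl hδ]
      refine if_congr ?_ rfl rfl
      rw [ballsTransverse_iff, hu]
      constructor
      · rintro ⟨⟨x, hxu, hxv⟩, -⟩
        have hxu1 : x.1 ∈ planeSpan u k := hxu.1
        have hxz := eq_of_mem_of_sup_eq_top hkd hl hkl htop (hu ▸ hxu1) hxv.1 hzw hzv.1
        exact hxz ▸ hxu.2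
      · intro hd
        refine ⟨⟨z, ⟨?_, hd⟩, hzv⟩, htop⟩
        change z.1 ∈ planeSpan u k
        rwa [hu]
  · rw [lintegral_planeFrameMeasure_congr hkd w hm (ψ := fun _ => 0) fun u hu => ?_, lintegral_zero]
    rw [ofReal_kernelH hkd hl hδ, if_neg]
    rw [ballsTransverse_iff, hu]
    rintro ⟨⟨x, hxu, hxv⟩, htop⟩
    have hxu1 : x.1 ∈ planeSpan u k := hxu.1
    exact h ⟨htop, x, hxv, hu ▸ hxu1⟩

/-- The inner integral counts the lifts of `N` that meet a ball. -/
theorem lintegral_kernelM (hk : 1 ≤ k) (hkd : k ≤ d) (hl : l ≤ d) (hkl : k + l = d)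
    {Δ : Subgroup (SOplus d)} [DiscreteTopology Δ] (N : GeodesicSubmanifold Δ k) {δ : ℝ}
    (hδ : 0 < δ) (v : Frame d) :
    ∫⁻ u, ENNReal.ofReal (kernelM Δ k l δ u (toFrameBundle Δ v)) ∂frameMeasure Δ N =
      {V ∈ N.lifts | Meets l δ v V}.encard * (ballVolume l δ)⁻¹ := by
  classical
  have hm := measurable_ofReal_kernelH_left hkd hl hδ v
  rw [frameMeasure, lintegral_map (measurable_kernelM_left Δ hkd hl hδ _).ennreal_ofReal
    (measurable_toFrameBundle Δ)]
  simp only [ofReal_kernelM_mk Δ hkd hl hδ]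
  rw [lintegral_poincare hkd N hm]
  simp only [lintegral_kernelH hk hkd hl hkl hδ, N.planeSpan_translate]
  rw [← ENNReal.tsum_set_const, tsum_subtype N.lifts fun V => if Meets l δ v V then (ballVolume l δ)⁻¹ else 0,
    tsum_subtype {V ∈ N.lifts | Meets l δ v V} fun _ => (ballVolume l δ)⁻¹]
  refine tsum_congr fun V => ?_
  by_cases h1 : V ∈ N.lifts <;> by_cases h2 : Meets l δ v V <;> simp [Set.indicator, h1, h2]

/-- Only finitely many lifts of a proper submanifold meet the compact ball of v. -/
theorem lintegral_kernelM_lt_top (hk : 1 ≤ k) (hkd : k ≤ d) (hl : l ≤ d) (hkl : k + l = d)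
    {Δ : Subgroup (SOplus d)} [DiscreteTopology Δ] (N : GeodesicSubmanifold Δ k) {δ : ℝ}
    (hδ : 0 < δ) (v : FrameBundle Δ) :
    ∫⁻ u, ENNReal.ofReal (kernelM Δ k l δ u v) ∂frameMeasure Δ N < ∞ := by
  obtain ⟨v, rfl⟩ := Quotient.mk_surjective v
  have h := lintegral_kernelM hk hkd hl hkl N hδ v
  rw [toFrameBundle] at h
  rw [h]
  have hfin : {V ∈ N.lifts | Meets l δ v V}.Finite :=
    (N.finite_lifts (isCompact_geoClosedBall hl δ v)).subset fun V hV => ⟨hV.1, hV.2.2⟩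
  refine ENNReal.mul_lt_top ?_ (ENNReal.inv_lt_top.mpr (pos_iff_ne_zero.mpr (ballVolume_ne_zero l hδ)))
  rw [hfin.encard_eq_coe]
  exact ENNReal.coe_lt_top

theorem measurable_lintegral_kernelM (hkd : k ≤ d) (hl : l ≤ d)
    {Δ : Subgroup (SOplus d)} [DiscreteTopology Δ] (N : GeodesicSubmanifold Δ k) {δ : ℝ}
    (hδ : 0 < δ) :
    Measurable fun v => ∫⁻ u, ENNReal.ofReal (kernelM Δ k l δ u v) ∂frameMeasure Δ N := by
  -- Needed for the measurability of a parametrized integral in its parameter.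
  have hfin : SFinite (planeFrameMeasure k N.frame) := by
    unfold planeFrameMeasure hypVolume
    infer_instance
  refine measurable_from_quotient.mpr ?_
  have h : ∀ v, ∫⁻ u, ENNReal.ofReal (kernelM Δ k l δ u (toFrameBundle Δ v)) ∂frameMeasure Δ N =
      ∫⁻ u in fundDomain (planeStab Δ N.frame k), ∑' g : Δ, ENNReal.ofReal (kernelH k l δ (g • u) v)
        ∂planeFrameMeasure k N.frame := fun v => by
    rw [frameMeasure, lintegral_map (measurable_kernelM_left Δ hkd hl hδ _).ennreal_ofReal
      (measurable_toFrameBundle Δ)]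
    simp only [ofReal_kernelM_mk Δ hkd hl hδ]
  change Measurable fun v =>
    ∫⁻ u, ENNReal.ofReal (kernelM Δ k l δ u (toFrameBundle Δ v)) ∂frameMeasure Δ N
  simp only [h]
  exact (measurable_ofReal_sum_kernelH Δ hkd hl hδ).lintegral_prod_left'

end Unfolding

/-! ### Transverse intersection points -/

section Crossings

variable {d k l : ℕ} {Δ : Subgroup (SOplus d)}

theorem map_mulVecLin_mul (g h : SOplus d) (V : Submodule ℝ (Fin (d + 1) → ℝ)) :
    V.map (g * h).1.1.mulVecLin = (V.map h.1.1.mulVecLin).map g.1.1.mulVecLin := by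
  rw [← Submodule.map_comp]
  congr 1
  refine LinearMap.ext fun x => ?_
  rw [Matrix.mulVecLin_apply, mulVec_mul]
  rfl

theorem smul_mem_map_iff {g : SOplus d} {V : Submodule ℝ (Fin (d + 1) → ℝ)} {x : HSpace d} :
    (g • x).1 ∈ V.map g.1.1.mulVecLin ↔ x.1 ∈ V := by
  constructor
  · rintro ⟨y, hy, h⟩
    have h1 := congrArg ((g⁻¹).1.1.mulVec ·) h
    simp only [Matrix.mulVecLin_apply, smul_val, inv_mulVec_mulVec] at h1
    exact h1 ▸ hy
  · exact fun h => ⟨_, h, rfl⟩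

theorem map_mulVecLin_injective (g : SOplus d) :
    Function.Injective (Submodule.map g.1.1.mulVecLin) := by
  refine Submodule.map_injective_of_injective fun x y h => ?_
  have h1 := congrArg ((g⁻¹).1.1.mulVec ·) h
  simpa only [Matrix.mulVecLin_apply, inv_mulVec_mulVec] using h1

theorem map_sup_map_eq_top (g : SOplus d) {V W : Submodule ℝ (Fin (d + 1) → ℝ)} (h : V ⊔ W = ⊤) :
    V.map g.1.1.mulVecLin ⊔ W.map g.1.1.mulVecLin = ⊤ := by
  rw [← Submodule.map_sup, h, Submodule.map_top]
  exact LinearMap.range_eq_top.mpr fun x => ⟨_, mulVec_inv_mulVec g x⟩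

theorem map_mulVecLin_one (V : Submodule ℝ (Fin (d + 1) → ℝ)) :
    V.map (1 : SOplus d).1.1.mulVecLin = V := by
  have h : (1 : SOplus d).1.1.mulVecLin = LinearMap.id := LinearMap.ext fun x => one_mulVec' x
  rw [h, Submodule.map_id]

/-- The pairs of a lift of `N` and a lift of `N'` that cross over the point `x`. -/
def crossingPairs (N : GeodesicSubmanifold Δ k) (N' : GeodesicSubmanifold Δ l) (x : Mfd Δ) :
    Set (Submodule ℝ (Fin (d + 1) → ℝ) × Submodule ℝ (Fin (d + 1) → ℝ)) :=
  {p | p.1 ∈ N.lifts ∧ p.2 ∈ N'.lifts ∧ TransverseAt x.out p.1 p.2}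

/-- The transverse intersection points of `N` and `N'`, repeated according to multiplicity. -/
abbrev Crossing (N : GeodesicSubmanifold Δ k) (N' : GeodesicSubmanifold Δ l) : Type :=
  Σ x : Mfd Δ, crossingPairs N N' x

variable {N : GeodesicSubmanifold Δ k} {N' : GeodesicSubmanifold Δ l}

theorem toMfd_out (x : Mfd Δ) : toMfd Δ x.out = x := Quotient.out_eq x

theorem toMfd_smul {g : SOplus d} (hg : g ∈ Δ) (x : HSpace d) : toMfd Δ (g • x) = toMfd Δ x :=
  toMfd_eq_iff.mpr ⟨g, hg, rfl⟩

theorem eq_of_mem_lifts (hk : k ≤ d) (hl : l ≤ d) (hkl : k + l = d)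
    {V W : Submodule ℝ (Fin (d + 1) → ℝ)} (hV : V ∈ N.lifts) (hW : W ∈ N'.lifts) (h : V ⊔ W = ⊤)
    {x y : HSpace d} (hxV : x.1 ∈ V) (hxW : x.1 ∈ W) (hyV : y.1 ∈ V) (hyW : y.1 ∈ W) : x = y := by
  obtain ⟨g, -, rfl⟩ := hV
  obtain ⟨g', -, rfl⟩ := hW
  exact eq_of_mem_of_sup_eq_top hk hl hkl h hxV hxW hyV hyW

/-- A crossing is determined by any translate of the corresponding pair of lifts. -/
theorem Crossing.eq_of_map_eq [DiscreteTopology Δ] (htf : ∀ g ∈ Δ, g ≠ 1 → ¬ IsOfFinOrder g)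
    (hk : k ≤ d) (hl : l ≤ d) (hkl : k + l = d) {p q : Crossing N N'} {g g' : SOplus d}
    (hg : g ∈ Δ) (hg' : g' ∈ Δ)
    (h1 : p.2.1.1.map g.1.1.mulVecLin = q.2.1.1.map g'.1.1.mulVecLin)
    (h2 : p.2.1.2.map g.1.1.mulVecLin = q.2.1.2.map g'.1.1.mulVecLin) : p = q ∧ g = g' := by
  obtain ⟨x, ⟨V, W⟩, hV, hW, hx⟩ := p
  obtain ⟨x', ⟨V', W'⟩, hV', hW', hx'⟩ := q
  simp only at h1 h2 hV hW hx hV' hW' hx'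
  rw [transverseAt_iff] at hx hx'
  -- Both translated points lie on the same transverse pair of lifts, which has only one common
  -- point.
  have hpt : g • x.out = g' • x'.out :=
    eq_of_mem_lifts hk hl hkl (N.map_mem_lifts hg hV) (N'.map_mem_lifts hg hW)
      (map_sup_map_eq_top g hx.2.2) (smul_mem_map_iff.mpr hx.1) (smul_mem_map_iff.mpr hx.2.1)
      (h1 ▸ smul_mem_map_iff.mpr hx'.1) (h2 ▸ smul_mem_map_iff.mpr hx'.2.1)
  have hxx : x = x' := by
    rw [← toMfd_out x, ← toMfd_out x', ← toMfd_smul hg, hpt, toMfd_smul hg']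
  subst hxx
  -- Both elements take the same point to the same image, and Δ acts freely.
  have hgg : g = g' := by
    rw [← inv_smul_eq_iff, ← mul_smul] at hpt
    have := eq_one_of_smul_eq htf (Δ.mul_mem (Δ.inv_mem hg') hg) (x := x.out)
      (by rw [mul_smul, inv_smul_eq_iff, ← inv_smul_eq_iff, ← mul_smul]; exact hpt)
    rw [inv_mul_eq_one] at this
    exact this.symm
  subst hgg
  obtain rfl := map_mulVecLin_injective g h1
  obtain rfl := map_mulVecLin_injective g h2
  exact ⟨rfl, rfl⟩

/-- Only finitely many crossings lie over a compact set. -/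
theorem Crossing.finite_of_isCompact [DiscreteTopology Δ]
    (htf : ∀ g ∈ Δ, g ≠ 1 → ¬ IsOfFinOrder g) (hk : k ≤ d) (hl : l ≤ d) (hkl : k + l = d)
    {C : Set (HSpace d)} (hC : IsCompact C) :
    {p : Crossing N N' | p.1 ∈ toMfd Δ '' C}.Finite := by
  have hex : ∀ p : Crossing N N', p.1 ∈ toMfd Δ '' C → ∃ g ∈ Δ, g • p.1.out ∈ C := by
    rintro p ⟨c, hc, hcp⟩
    rw [← toMfd_out p.1] at hcp
    obtain ⟨g, hg, rfl⟩ := toMfd_eq_iff.mp hcp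
    exact ⟨g, hg, hc⟩
  choose! g hg hgC using hex
  -- A crossing over C is moved so that its point lies in C. It is then determined by the translated
  -- pair of lifts, and finitely many lifts of each submanifold meet C.
  refine Set.Finite.of_injOn (f := fun p => (p.2.1.1.map (g p).1.1.mulVecLin,
    p.2.1.2.map (g p).1.1.mulVecLin)) (t := {V ∈ N.lifts | ∃ x ∈ C, x.1 ∈ V} ×ˢ
      {V ∈ N'.lifts | ∃ x ∈ C, x.1 ∈ V}) ?_ ?_ ((N.finite_lifts hC).prod (N'.finite_lifts hC))
  · intro p hp
    have hT := transverseAt_iff.mp p.2.2.2.2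
    exact ⟨⟨N.map_mem_lifts (hg p hp) p.2.2.1, _, hgC p hp, smul_mem_map_iff.mpr hT.1⟩,
      ⟨N'.map_mem_lifts (hg p hp) p.2.2.2.1, _, hgC p hp, smul_mem_map_iff.mpr hT.2.1⟩⟩
  · intro p hp q hq h
    rw [Prod.mk.injEq] at h
    exact (Crossing.eq_of_map_eq htf hk hl hkl (hg p hp) (hg q hq) h.1 h.2).1

/-- An element of the group that takes the second lift of a crossing to the chosen lift of `N'`. -/
noncomputable def Crossing.shift (p : Crossing N N') : SOplus d :=
  (N'.translate ⟨p.2.1.2, p.2.2.2.1⟩)⁻¹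

theorem Crossing.shift_mem (p : Crossing N N') : p.shift ∈ Δ := Δ.inv_mem (N'.translate_mem _)

theorem Crossing.map_shift (p : Crossing N N') :
    p.2.1.2.map p.shift.1.1.mulVecLin = planeSpan N'.frame l := by
  have h := N'.planeSpan_translate ⟨p.2.1.2, p.2.2.2.1⟩
  simp only at h
  rw [← h, ← planeSpan_mul, Crossing.shift, inv_mul_cancel_left]

/-- The point of a crossing on the chosen lift of `N'`. -/
noncomputable def Crossing.point (p : Crossing N N') : HSpace d := p.shift • p.1.out

theorem Crossing.toMfd_point (p : Crossing N N') : toMfd Δ p.point = p.1 := by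
  rw [Crossing.point, toMfd_smul p.shift_mem, toMfd_out]

theorem Crossing.point_mem_plane (p : Crossing N N') : p.point ∈ plane N'.frame l := by
  change p.point.1 ∈ planeSpan N'.frame l
  rw [← p.map_shift]
  exact smul_mem_map_iff.mpr (transverseAt_iff.mp p.2.2.2.2).2.1

theorem Crossing.exists_frame (hl : l ≤ d) (p : Crossing N N') :
    ∃ w : Frame d, planeSpan w l = planeSpan N'.frame l ∧ basePt w = p.point := by
  obtain ⟨y, hy⟩ := exists_planePoint_eq hl p.point_mem_plane
  exact ⟨_, planeSpan_mul_boost_pad hl N'.frame y, hy⟩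

/-- The lifts of `N` that cross the chosen lift of `N'`. -/
def crossingLifts (N : GeodesicSubmanifold Δ k) (N' : GeodesicSubmanifold Δ l) :
    Set (Submodule ℝ (Fin (d + 1) → ℝ)) :=
  {V ∈ N.lifts | V ⊔ planeSpan N'.frame l = ⊤ ∧
    ∃ x : HSpace d, x.1 ∈ V ∧ x.1 ∈ planeSpan N'.frame l}

theorem self_mem_lifts (N : GeodesicSubmanifold Δ k) : planeSpan N.frame k ∈ N.lifts :=
  ⟨1, Δ.one_mem, by rw [one_mul]⟩

theorem map_eq_self_of_mem_planeStab {v : Frame d} {h : SOplus d} (hh : h ∈ planeStab Δ v l) :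
    (planeSpan v l).map h.1.1.mulVecLin = planeSpan v l := by
  rw [← planeSpan_mul, (mem_planeStab_iff.mp hh).2]

/-- The lift of `N` that belongs to a crossing and an element of the stabilizer of the chosen lift
of `N'`. -/
noncomputable def crossingLift (p : Crossing N N' × planeStab Δ N'.frame l) :
    Submodule ℝ (Fin (d + 1) → ℝ) :=
  p.1.2.1.1.map ((p.2 : SOplus d)⁻¹ * p.1.shift).1.1.mulVecLin

theorem map_crossingLift_snd (p : Crossing N N' × planeStab Δ N'.frame l) :
    p.1.2.1.2.map ((p.2 : SOplus d)⁻¹ * p.1.shift).1.1.mulVecLin = planeSpan N'.frame l := by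
  rw [map_mulVecLin_mul, p.1.map_shift, map_eq_self_of_mem_planeStab (inv_mem p.2.2)]

theorem crossingLift_mem_lifts (p : Crossing N N' × planeStab Δ N'.frame l) :
    crossingLift p ∈ N.lifts :=
  N.map_mem_lifts (Δ.mul_mem (Δ.inv_mem p.2.2.1) p.1.shift_mem) p.1.2.2.1

theorem crossingLift_sup (p : Crossing N N' × planeStab Δ N'.frame l) :
    crossingLift p ⊔ planeSpan N'.frame l = ⊤ := by
  rw [← map_crossingLift_snd p]
  exact map_sup_map_eq_top _ (transverseAt_iff.mp p.1.2.2.2.2).2.2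

theorem point_mem_crossingLift (p : Crossing N N' × planeStab Δ N'.frame l) :
    ((p.2 : SOplus d)⁻¹ • p.1.point).1 ∈ crossingLift p := by
  rw [Crossing.point, ← mul_smul]
  exact smul_mem_map_iff.mpr (transverseAt_iff.mp p.1.2.2.2.2).1

theorem point_mem_planeSpan (p : Crossing N N' × planeStab Δ N'.frame l) :
    ((p.2 : SOplus d)⁻¹ • p.1.point).1 ∈ planeSpan N'.frame l := by
  rw [← map_crossingLift_snd p, Crossing.point, ← mul_smul]
  exact smul_mem_map_iff.mpr (transverseAt_iff.mp p.1.2.2.2.2).2.1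

/-- A lift V crossing the chosen lift Q of `N'` gives a pair (V, Q), hence a crossing after
translation to the representative point. Conversely, the pair of a crossing can be translated so
that its second member is Q, and the freedom in doing so is the stabilizer of Q. Injectivity rests
on the freeness of the action, through `Crossing.eq_of_map_eq`. -/
theorem crossingLift_bijective [DiscreteTopology Δ] (htf : ∀ g ∈ Δ, g ≠ 1 → ¬ IsOfFinOrder g)
    (hk : k ≤ d) (hl : l ≤ d) (hkl : k + l = d) :
    Function.Bijective fun p : Crossing N N' × planeStab Δ N'.frame l =>
      (⟨crossingLift p, crossingLift_mem_lifts p, crossingLift_sup p, _,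
        point_mem_crossingLift p, point_mem_planeSpan p⟩ : crossingLifts N N') := by
  constructor
  · intro p q h
    have h1 : crossingLift p = crossingLift q := congrArg Subtype.val h
    obtain ⟨hp, hg⟩ := Crossing.eq_of_map_eq htf hk hl hkl
      (Δ.mul_mem (Δ.inv_mem p.2.2.1) p.1.shift_mem) (Δ.mul_mem (Δ.inv_mem q.2.2.1) q.1.shift_mem)
      h1 ((map_crossingLift_snd p).trans (map_crossingLift_snd q).symm)
    refine Prod.ext hp (Subtype.ext ?_)
    rw [hp] at hg
    exact inv_injective (mul_right_cancel hg)
  · rintro ⟨V, hV, htop, y, hyV, hyW⟩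
    obtain ⟨g, hg, hgy⟩ := toMfd_eq_iff.mp (toMfd_out (toMfd Δ y))
    let p : Crossing N N' := ⟨toMfd Δ y, (V.map g.1.1.mulVecLin,
      (planeSpan N'.frame l).map g.1.1.mulVecLin), N.map_mem_lifts hg hV,
      N'.map_mem_lifts hg (self_mem_lifts N'), by
        rw [← hgy]
        exact transverseAt_iff.mpr ⟨smul_mem_map_iff.mpr hyV, smul_mem_map_iff.mpr hyW,
          map_sup_map_eq_top g htop⟩⟩
    -- Both g⁻¹ and `p.shift` bring the second lift back to Q, so their discrepancy preserves Q.
    have hmem : p.shift * g ∈ planeStab Δ N'.frame l := by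
      refine mem_planeStab_iff.mpr ⟨Δ.mul_mem p.shift_mem hg, ?_⟩
      rw [planeSpan_mul, map_mulVecLin_mul]
      exact p.map_shift
    refine ⟨(p, ⟨_, hmem⟩), Subtype.ext ?_⟩
    change (V.map g.1.1.mulVecLin).map ((p.shift * g)⁻¹ * p.shift).1.1.mulVecLin = V
    rw [← map_mulVecLin_mul, mul_assoc, inv_mul_cancel, map_mulVecLin_one]

theorem Crossing.countable [DiscreteTopology Δ] (htf : ∀ g ∈ Δ, g ≠ 1 → ¬ IsOfFinOrder g)
    (hk : k ≤ d) (hl : l ≤ d) (hkl : k + l = d) : Countable (Crossing N N') := by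
  have h : Countable (crossingLifts N N') := ((countable_lifts N).mono fun V hV => hV.1).to_subtype
  have hinj := (crossingLift_bijective (N := N) (N' := N') htf hk hl hkl).1
  exact (hinj.comp (Prod.mk_left_injective (1 : planeStab Δ N'.frame l))).countable

end Crossings

/-! ### Unfolding the outer integral -/

section Outer

variable {d k l : ℕ} {Δ : Subgroup (SOplus d)}

/-- The count of crossings is available only for frames tangent to the chosen lift, and the measure
is carried by these. They form a closed set: by dimension, equality of spans only asks that certain
columns of v lie in a fixed subspace. -/
theorem ae_planeSpan_eq (hl : l ≤ d) (w : Frame d) :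
    ∀ᵐ v ∂planeFrameMeasure l w, planeSpan v l = planeSpan w l := by
  have hset : {v : Frame d | planeSpan v l = planeSpan w l} =
      ⋂ i : Fin (d + 1), ⋂ _ : (i : ℕ) ≤ l, {v | (fun r => v.1.1 r i) ∈ planeSpan w l} := by
    ext v
    simp only [Set.mem_iInter, Set.mem_ofPred_eq]
    constructor
    · intro h i hi
      rw [← h]
      exact Submodule.subset_span ⟨i, hi, rfl⟩
    · intro h
      refine Submodule.eq_of_le_of_finrank_eq (Submodule.span_le.mpr ?_)
        (by rw [finrank_planeSpan hl, finrank_planeSpan hl])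
      rintro _ ⟨i, hi, rfl⟩
      exact h i hi
  have hm : MeasurableSet {v : Frame d | planeSpan v l = planeSpan w l} := by
    rw [hset]
    refine (isClosed_iInter fun i => isClosed_iInter fun _ =>
      (Submodule.closed_of_finiteDimensional (planeSpan w l)).preimage ?_).measurableSet
    exact continuous_pi fun r => (val_isEmbedding d).continuous.matrix_elem r i
  rw [planeFrameMeasure, ae_map_iff (measurable_planeFrame w l).aemeasurable hm]
  exact ae_of_all _ fun p => planeSpan_frame hl w p.1 p.2

theorem measurable_proj {d : ℕ} (Δ : Subgroup (SOplus d)) : Measurable (proj Δ) := by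
  refine measurable_from_quotient.mpr ?_
  have h := (measurable_toMfd Δ).comp (continuous_basePt d).measurable
  exact h

/-- The average of `F` over the ball of radius `δ` around the base point of `w` in the plane
of `w`. -/
noncomputable def ballAverage (Δ : Subgroup (SOplus d)) (l : ℕ) (F : Mfd Δ → ℝ≥0∞) (δ : ℝ)
    (w : Frame d) : ℝ≥0∞ :=
  (∫⁻ y : EuclideanSpace ℝ (Fin l) in Metric.closedBall 0 (Real.sinh δ),
    F (toMfd Δ (planePoint w y)) ∂hypVolume l) * (ballVolume l δ)⁻¹

/-- A frame at a crossing that is tangent to the chosen lift of `N'`. -/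
noncomputable def Crossing.frame {N : GeodesicSubmanifold Δ k} {N' : GeodesicSubmanifold Δ l}
    (hl : l ≤ d) (p : Crossing N N') : Frame d := (p.exists_frame hl).choose

theorem Crossing.planeSpan_frame {N : GeodesicSubmanifold Δ k} {N' : GeodesicSubmanifold Δ l}
    (hl : l ≤ d) (p : Crossing N N') : planeSpan (p.frame hl) l = planeSpan N'.frame l :=
  (p.exists_frame hl).choose_spec.1

theorem Crossing.basePt_frame {N : GeodesicSubmanifold Δ k} {N' : GeodesicSubmanifold Δ l}
    (hl : l ≤ d) (p : Crossing N N') : basePt (p.frame hl) = p.point :=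
  (p.exists_frame hl).choose_spec.2

/-- The two planes meet only at the translate of the crossing point by the inverse of the stabilizer
element. The inverse in `crossingLift` lets that element act on v instead, which is the form
required for unfolding. -/
theorem meets_crossingLift_iff {N : GeodesicSubmanifold Δ k} {N' : GeodesicSubmanifold Δ l}
    (hk : k ≤ d) (hl : l ≤ d) (hkl : k + l = d) {δ : ℝ} {v : Frame d}
    (hv : planeSpan v l = planeSpan N'.frame l) (p : Crossing N N' × planeStab Δ N'.frame l) :
    Meets l δ v (crossingLift p) ↔ hdist (basePt ((p.2 : SOplus d) * v)) p.1.point ≤ δ := by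
  have hd : hdist (basePt ((p.2 : SOplus d) * v)) p.1.point =
      hdist (basePt v) ((p.2 : SOplus d)⁻¹ • p.1.point) := by
    rw [← hdist_smul_smul (p.2 : SOplus d) (basePt v), smul_inv_smul, basePt_mul]
  rw [hd]
  constructor
  · rintro ⟨-, x, hxv, hxp⟩
    have hx1 : x.1 ∈ planeSpan v l := hxv.1
    have h := eq_of_mem_lifts hk hl hkl (crossingLift_mem_lifts p) (self_mem_lifts N')
      (crossingLift_sup p) hxp (hv ▸ hx1) (point_mem_crossingLift p) (point_mem_planeSpan p)
    rw [← h]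
    exact hxv.2
  · intro h
    refine ⟨hv ▸ crossingLift_sup p, _, ⟨?_, h⟩, point_mem_crossingLift p⟩
    change _ ∈ planeSpan v l
    rw [hv]
    exact point_mem_planeSpan p

open Classical in
-- A lift that meets the ball of v transversely also crosses the chosen lift of `N'`, in which the
-- ball lies; so `crossingLift_bijective` reindexes the count.
theorem encard_meets_eq_tsum [DiscreteTopology Δ] (htf : ∀ g ∈ Δ, g ≠ 1 → ¬ IsOfFinOrder g)
    (N : GeodesicSubmanifold Δ k) (N' : GeodesicSubmanifold Δ l)
    (hk : k ≤ d) (hl : l ≤ d) (hkl : k + l = d) (δ : ℝ) {v : Frame d}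
    (hv : planeSpan v l = planeSpan N'.frame l) :
    (({V ∈ N.lifts | Meets l δ v V}.encard : ℕ∞) : ℝ≥0∞) =
      ∑' p : Crossing N N', ∑' h : planeStab Δ N'.frame l,
        if hdist (basePt ((h : SOplus d) * v)) p.point ≤ δ then 1 else 0 := by
  have h1 : ∀ (p : Crossing N N') (h : planeStab Δ N'.frame l),
      (if hdist (basePt ((h : SOplus d) * v)) p.point ≤ δ then (1 : ℝ≥0∞) else 0) =
        if Meets l δ v (crossingLift (p, h)) then 1 else 0 := fun p h =>
    if_congr (meets_crossingLift_iff hk hl hkl hv (p, h)).symm rfl rfl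
  simp only [h1]
  have h2 := (Equiv.ofBijective _ (crossingLift_bijective (N := N) (N' := N') htf hk hl hkl)).tsum_eq
    fun V => if Meets l δ v V.1 then (1 : ℝ≥0∞) else 0
  rw [ENNReal.tsum_prod'] at h2
  refine Eq.trans ?_ h2.symm
  rw [← mul_one (({V ∈ N.lifts | Meets l δ v V}.encard : ℕ∞) : ℝ≥0∞), ← ENNReal.tsum_set_const,
    tsum_subtype (crossingLifts N N') fun V => if Meets l δ v V then (1 : ℝ≥0∞) else 0,
    tsum_subtype {V ∈ N.lifts | Meets l δ v V} fun _ => (1 : ℝ≥0∞)]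
  refine tsum_congr fun V => ?_
  have h3 : V ∈ {V ∈ N.lifts | Meets l δ v V} ↔ V ∈ crossingLifts N N' ∧ Meets l δ v V := by
    refine ⟨fun h => ⟨⟨h.1, hv ▸ h.2.1, ?_⟩, h.2⟩, fun h => ⟨h.1.1, h.2⟩⟩
    obtain ⟨x, hx, hxV⟩ := h.2.2
    have hx1 : x.1 ∈ planeSpan v l := hx.1
    exact ⟨x, hxV, hv ▸ hx1⟩
  by_cases h : V ∈ {V ∈ N.lifts | Meets l δ v V}
  · rw [Set.indicator_of_mem h, Set.indicator_of_mem (h3.mp h).1, if_pos (h3.mp h).2]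
  · rw [Set.indicator_of_notMem h]
    by_cases h' : V ∈ crossingLifts N N'
    · rw [Set.indicator_of_mem h', if_neg fun hm => h (h3.mpr ⟨h', hm⟩)]
    · rw [Set.indicator_of_notMem h']

theorem measurableSet_hdist_le {δ : ℝ} (hδ : 0 ≤ δ) (x : HSpace d) :
    MeasurableSet {v : Frame d | hdist (basePt v) x ≤ δ} := by
  simp only [hdist_le_iff hδ]
  have h := (continuous_hdist_lorentz d).comp ((continuous_basePt d).prodMk
    (continuous_const (y := x)))
  exact (isClosed_le h continuous_const).measurableSet

/-- The outer integral is a sum of averages over balls around the crossings. -/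
theorem lintegral_outer [DiscreteTopology Δ] (htf : ∀ g ∈ Δ, g ≠ 1 → ¬ IsOfFinOrder g)
    (N : GeodesicSubmanifold Δ k) (N' : GeodesicSubmanifold Δ l) (hk1 : 1 ≤ k)
    (hk : k ≤ d) (hl : l ≤ d) (hkl : k + l = d) {δ : ℝ} (hδ : 0 < δ) {F : Mfd Δ → ℝ≥0∞}
    (hF : Measurable F) :
    ∫⁻ v, F (proj Δ v) * ∫⁻ u, ENNReal.ofReal (kernelM Δ k l δ u v) ∂frameMeasure Δ N
        ∂frameMeasure Δ N' =
      ∑' p : Crossing N N', ballAverage Δ l F δ (p.frame hl) := by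
  classical
  have hcount := Crossing.countable (N := N) (N' := N') htf hk hl hkl
  have hproj := measurable_proj Δ
  let φ : Crossing N N' → Frame d → ℝ≥0∞ := fun p v =>
    if hdist (basePt v) p.point ≤ δ then F (toMfd Δ (basePt v)) * (ballVolume l δ)⁻¹ else 0
  have hφ : ∀ p, Measurable (φ p) := fun p => by
    have h := hF.comp ((measurable_toMfd Δ).comp (continuous_basePt d).measurable)
    exact Measurable.ite (measurableSet_hdist_le hδ.le p.point) (h.mul_const _) measurable_const
  have hG : Measurable fun v => F (proj Δ v) *
      ∫⁻ u, ENNReal.ofReal (kernelM Δ k l δ u v) ∂frameMeasure Δ N :=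
    (hF.comp hproj).mul (measurable_lintegral_kernelM hk hl N hδ)
  have h1 : ∀ v : Frame d, planeSpan v l = planeSpan N'.frame l →
      F (proj Δ (toFrameBundle Δ v)) *
        ∫⁻ u, ENNReal.ofReal (kernelM Δ k l δ u (toFrameBundle Δ v)) ∂frameMeasure Δ N =
      ∑' p : Crossing N N', ∑' h : planeStab Δ N'.frame l, φ p ((h : SOplus d) * v) := by
    intro v hv
    rw [lintegral_kernelM hk1 hk hl hkl N hδ, encard_meets_eq_tsum htf N N' hk hl hkl δ hv,
      ← ENNReal.tsum_mul_right, ← ENNReal.tsum_mul_left]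
    refine tsum_congr fun p => ?_
    rw [← ENNReal.tsum_mul_right, ← ENNReal.tsum_mul_left]
    refine tsum_congr fun h => ?_
    -- The value of F at the base point does not change under the stabilizer, so F may be moved
    -- inside the sum.
    have hpt : toMfd Δ (basePt ((h : SOplus d) * v)) = proj Δ (toFrameBundle Δ v) := by
      rw [basePt_mul, toMfd_smul h.2.1]
      rfl
    simp only [φ, hpt]
    split_ifs
    · rw [one_mul]
    · rw [zero_mul, mul_zero]
  have hm : ∀ p, Measurable fun v => ∑' h : planeStab Δ N'.frame l, φ p ((h : SOplus d) * v) :=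
    fun p => Measurable.tsum fun h => (hφ p).comp (measurable_const_mul (h : SOplus d))
  rw [frameMeasure, lintegral_map hG (measurable_toFrameBundle Δ),
    lintegral_congr_ae ((ae_restrict_of_ae (ae_planeSpan_eq hl N'.frame)).mono h1),
    lintegral_tsum fun p => (hm p).aemeasurable]
  refine tsum_congr fun p => ?_
  have hFp : Measurable fun y : EuclideanSpace ℝ (Fin l) =>
      F (toMfd Δ (planePoint (p.frame hl) y)) := by
    have h := hF.comp ((measurable_toMfd Δ).comp
      (continuous_planePoint_right (p.frame hl) l).measurable)
    exact h
  -- The second unfolding; then the plane is described by a frame based at the crossing, which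
  -- centres the ball at the origin.
  rw [lintegral_fundDomain _ (fun h hh => map_mul_planeFrameMeasure_of_mem_planeStab hl hh) (hφ p),
    ← planeFrameMeasure_congr hl (p.planeSpan_frame hl),
    lintegral_planeFrameMeasure_congr hl _ (hφ p) (ψ := fun x =>
      if hdist x p.point ≤ δ then F (toMfd Δ x) * (ballVolume l δ)⁻¹ else 0) fun u _ => rfl,
    ballAverage, ← lintegral_mul_const _ hFp,
    ← lintegral_indicator Metric.isClosed_closedBall.measurableSet]
  refine lintegral_congr fun y => ?_
  rw [Set.indicator]
  refine if_congr ?_ rfl rfl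
  rw [hdist_comm, ← p.basePt_frame hl, hdist_planePoint_le hl, mem_closedBall_zero_iff]

theorem ballAverage_le (hl1 : 1 ≤ l) {F : Mfd Δ → ℝ≥0∞} {δ : ℝ} {w : Frame d} {b : ℝ≥0∞}
    (hb : ∀ y ∈ Metric.closedBall (0 : EuclideanSpace ℝ (Fin l)) (Real.sinh δ),
      F (toMfd Δ (planePoint w y)) ≤ b) : ballAverage Δ l F δ w ≤ b := by
  have h := setLIntegral_mono (μ := hypVolume l) (measurable_const (a := b)) hb
  rw [setLIntegral_const, hypVolume_closedBall hl1] at h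
  rw [ballAverage, ← div_eq_mul_inv]
  exact ENNReal.div_le_of_le_mul h

theorem le_ballAverage (hl1 : 1 ≤ l) {F : Mfd Δ → ℝ≥0∞} {δ : ℝ} (hδ : 0 < δ) {w : Frame d} {b : ℝ≥0∞}
    (hb : ∀ y ∈ Metric.closedBall (0 : EuclideanSpace ℝ (Fin l)) (Real.sinh δ),
      b ≤ F (toMfd Δ (planePoint w y))) : b ≤ ballAverage Δ l F δ w := by
  have h := setLIntegral_mono' (μ := hypVolume l) Metric.isClosed_closedBall.measurableSet hb
  rw [setLIntegral_const, hypVolume_closedBall hl1] at h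
  rw [ballAverage, ← div_eq_mul_inv, ENNReal.le_div_iff_mul_le (.inl (ballVolume_ne_zero l hδ))
    (.inl (ballVolume_ne_top l δ))]
  exact h

/-- Near the centre F stays within ε of its value there, and so do its averages over small balls. -/
theorem tendsto_ballAverage (hl1 : 1 ≤ l) {F : Mfd Δ → ℝ≥0∞} (hF : Continuous F) (w : Frame d)
    (hw : F (toMfd Δ (basePt w)) ≠ ∞) :
    Tendsto (fun δ => ballAverage Δ l F δ w) (𝓝[>] 0) (𝓝 (F (toMfd Δ (basePt w)))) := by
  rw [ENNReal.tendsto_nhds hw]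
  intro ε hε
  have hc : Continuous fun y : EuclideanSpace ℝ (Fin l) => F (toMfd Δ (planePoint w y)) := by
    have h := hF.comp ((continuous_toMfd Δ).comp (continuous_planePoint_right w l))
    exact h
  have h0 : F (toMfd Δ (planePoint w (0 : EuclideanSpace ℝ (Fin l)))) = F (toMfd Δ (basePt w)) := by
    rw [planePoint_zero]
  have hnhds : ∀ᶠ y in 𝓝 (0 : EuclideanSpace ℝ (Fin l)), F (toMfd Δ (planePoint w y)) ∈
      Set.Icc (F (toMfd Δ (basePt w)) - ε) (F (toMfd Δ (basePt w)) + ε) := by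
    have h := hc.tendsto 0
    rw [h0, ENNReal.tendsto_nhds hw] at h
    exact h ε hε
  obtain ⟨r, hr, hball⟩ := Metric.nhds_basis_closedBall.eventually_iff.mp hnhds
  have hsinh : ∀ᶠ δ in 𝓝[>] (0 : ℝ), Real.sinh δ ≤ r := by
    have h : Tendsto Real.sinh (𝓝[>] 0) (𝓝 0) := by
      have h1 := Real.continuous_sinh.tendsto 0
      rw [Real.sinh_zero] at h1
      exact h1.mono_left nhdsWithin_le_nhds
    exact h.eventually (Iic_mem_nhds hr)
  filter_upwards [hsinh, self_mem_nhdsWithin] with δ hδr hδ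
  exact ⟨le_ballAverage hl1 hδ fun y hy => (hball (Metric.closedBall_subset_closedBall hδr hy)).1,
    ballAverage_le hl1 fun y hy => (hball (Metric.closedBall_subset_closedBall hδr hy)).2⟩

/-- For a function with compact support only finitely many crossings contribute. -/
theorem exists_finset_ballAverage_eq_zero [DiscreteTopology Δ]
    (htf : ∀ g ∈ Δ, g ≠ 1 → ¬ IsOfFinOrder g) (N : GeodesicSubmanifold Δ k)
    (N' : GeodesicSubmanifold Δ l) (hl1 : 1 ≤ l) (hk : k ≤ d) (hl : l ≤ d) (hkl : k + l = d)
    {F : Mfd Δ → ℝ≥0∞} {L : Set (Mfd Δ)} (hL : IsCompact L) (hFL : ∀ x ∉ L, F x = 0) (r : ℝ) :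
    ∃ s : Finset (Crossing N N'), ∀ p ∉ s, F p.1 = 0 ∧
      ∀ δ, 0 < δ → δ ≤ r → ballAverage Δ l F δ (p.frame hl) = 0 := by
  obtain ⟨C, hC, hLC⟩ := exists_isCompact_lift Δ hL
  -- An average of radius at most r can see the support from a crossing at distance at most r, so
  -- the lift of the support is enlarged by r.
  obtain ⟨C', hC', hCC'⟩ := exists_isCompact_neighborhood hC r
  have hfin := Crossing.finite_of_isCompact (N := N) (N' := N') htf hk hl hkl (hC.union hC')
  refine ⟨hfin.toFinset, fun p hp => ?_⟩
  have hp' : p.1 ∉ toMfd Δ '' (C ∪ C') := fun h => hp (hfin.mem_toFinset.mpr h)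
  refine ⟨hFL _ fun h => hp' (Set.image_mono Set.subset_union_left (hLC h)), fun δ hδ hδr => ?_⟩
  refine le_antisymm (ballAverage_le hl1 fun y hy => ?_) zero_le
  refine (hFL _ fun h => hp' ?_).le
  obtain ⟨c, hc, hcy⟩ := hLC h
  obtain ⟨g, hg, rfl⟩ := toMfd_eq_iff.mp hcy
  refine ⟨g • p.point, .inr (hCC' _ hc _ ?_), ?_⟩
  · rw [mem_closedBall_zero_iff, ← hdist_planePoint_le hl (p.frame hl), p.basePt_frame hl,
      ← hdist_smul_smul g, hdist_comm] at hy
    exact hy.trans hδr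
  · rw [toMfd_smul hg, p.toMfd_point]

theorem lintegral_interMeasure (N : GeodesicSubmanifold Δ k) (N' : GeodesicSubmanifold Δ l)
    {F : Mfd Δ → ℝ≥0∞} (hF : Measurable F) :
    ∫⁻ x, F x ∂interMeasure N N' = ∑' p : Crossing N N', F p.1 := by
  rw [interMeasure, lintegral_sum_measure, ENNReal.tsum_sigma']
  refine tsum_congr fun x => ?_
  rw [lintegral_smul_measure, lintegral_dirac' _ hF, smul_eq_mul]
  -- `interMult` is by definition the cardinality of `crossingPairs`.
  exact (ENNReal.tsum_set_const (crossingPairs N N' x) (F x)).symm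

end Outer

/-! ### The limit of the iterated integrals -/

theorem measurable_of_continuous_mfd {d : ℕ} {Δ : Subgroup (SOplus d)} {β : Type*} [TopologicalSpace β] [MeasurableSpace β]
    [BorelSpace β] {f : Mfd Δ → β} (hf : Continuous f) : Measurable f := by
  refine measurable_from_quotient.mpr ?_
  have h := (hf.comp (continuous_toMfd Δ)).measurable
  exact h

section Limit

variable {d k l : ℕ} {Δ : Subgroup (SOplus d)} [DiscreteTopology Δ]

theorem integrable_kernelM (hk1 : 1 ≤ k) (hk : k ≤ d) (hl : l ≤ d) (hkl : k + l = d)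
    (N : GeodesicSubmanifold Δ k) {δ : ℝ} (hδ : 0 < δ) (v : FrameBundle Δ) :
    Integrable (fun u => kernelM Δ k l δ u v) (frameMeasure Δ N) := by
  refine ⟨(measurable_kernelM_left Δ hk hl hδ v).aestronglyMeasurable, ?_⟩
  rw [hasFiniteIntegral_iff_ofReal (ae_of_all _ fun u => kernelM_nonneg Δ k l δ u v)]
  exact lintegral_kernelM_lt_top hk1 hk hl hkl N hδ v

theorem integral_kernelM (hk : k ≤ d) (hl : l ≤ d) (N : GeodesicSubmanifold Δ k) {δ : ℝ}
    (hδ : 0 < δ) (v : FrameBundle Δ) :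
    ∫ u, kernelM Δ k l δ u v ∂frameMeasure Δ N =
      (∫⁻ u, ENNReal.ofReal (kernelM Δ k l δ u v) ∂frameMeasure Δ N).toReal :=
  integral_eq_lintegral_of_nonneg_ae (ae_of_all _ fun u => kernelM_nonneg Δ k l δ u v)
    (measurable_kernelM_left Δ hk hl hδ v).aestronglyMeasurable

theorem ofReal_integral_kernelM (hk1 : 1 ≤ k) (hk : k ≤ d) (hl : l ≤ d) (hkl : k + l = d)
    (N : GeodesicSubmanifold Δ k) {δ : ℝ} (hδ : 0 < δ) (v : FrameBundle Δ) :
    ENNReal.ofReal (∫ u, kernelM Δ k l δ u v ∂frameMeasure Δ N) =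
      ∫⁻ u, ENNReal.ofReal (kernelM Δ k l δ u v) ∂frameMeasure Δ N := by
  rw [integral_kernelM hk hl N hδ,
    ENNReal.ofReal_toReal (lintegral_kernelM_lt_top hk1 hk hl hkl N hδ v).ne]

/-- One finite set of crossings serves the intersection integral and all radii up to r at once, so
the limit can be taken term by term. -/
theorem exists_finset_ofReal (htf : ∀ g ∈ Δ, g ≠ 1 → ¬ IsOfFinOrder g) (N : GeodesicSubmanifold Δ k)
    (N' : GeodesicSubmanifold Δ l) (hk1 : 1 ≤ k) (hl1 : 1 ≤ l) (hk : k ≤ d) (hl : l ≤ d)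
    (hkl : k + l = d) {f : Mfd Δ → ℝ} (hf : Continuous f) (hfc : HasCompactSupport f)
    (r : ℝ) : ∃ s : Finset (Crossing N N'),
    ∫⁻ x, ENNReal.ofReal (f x) ∂interMeasure N N' = ∑ p ∈ s, ENNReal.ofReal (f p.1) ∧
    ∀ δ, 0 < δ → δ ≤ r → ∫⁻ v, ENNReal.ofReal (f (proj Δ v)) *
      ∫⁻ u, ENNReal.ofReal (kernelM Δ k l δ u v) ∂frameMeasure Δ N ∂frameMeasure Δ N' =
      ∑ p ∈ s, ballAverage Δ l (fun x => ENNReal.ofReal (f x)) δ (p.frame hl) := by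
  have hF : Measurable fun x => ENNReal.ofReal (f x) :=
    (measurable_of_continuous_mfd hf).ennreal_ofReal
  obtain ⟨s, hs⟩ := exists_finset_ballAverage_eq_zero htf N N' hl1 hk hl hkl
    (F := fun x => ENNReal.ofReal (f x)) hfc (fun x hx => by
      rw [image_eq_zero_of_notMem_tsupport hx, ENNReal.ofReal_zero]) r
  refine ⟨s, ?_, fun δ hδ hδr => ?_⟩
  · rw [lintegral_interMeasure N N' hF, tsum_eq_sum fun p hp => (hs p hp).1]
  · rw [lintegral_outer htf N N' hk1 hk hl hkl hδ hF,
      tsum_eq_sum fun p hp => (hs p hp).2 δ hδ hδr]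

theorem lintegral_interMeasure_ne_top (htf : ∀ g ∈ Δ, g ≠ 1 → ¬ IsOfFinOrder g) (N : GeodesicSubmanifold Δ k)
    (N' : GeodesicSubmanifold Δ l) (hk1 : 1 ≤ k) (hl1 : 1 ≤ l) (hk : k ≤ d) (hl : l ≤ d)
    (hkl : k + l = d) {f : Mfd Δ → ℝ} (hf : Continuous f) (hfc : HasCompactSupport f) :
    ∫⁻ x, ENNReal.ofReal (f x) ∂interMeasure N N' ≠ ∞ := by
  obtain ⟨s, hs, -⟩ := exists_finset_ofReal htf N N' hk1 hl1 hk hl hkl hf hfc 1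
  rw [hs]
  exact ENNReal.sum_ne_top.mpr fun p _ => ENNReal.ofReal_ne_top

theorem lintegral_outer_ne_top (htf : ∀ g ∈ Δ, g ≠ 1 → ¬ IsOfFinOrder g) (N : GeodesicSubmanifold Δ k)
    (N' : GeodesicSubmanifold Δ l) (hk1 : 1 ≤ k) (hl1 : 1 ≤ l) (hk : k ≤ d) (hl : l ≤ d)
    (hkl : k + l = d) {f : Mfd Δ → ℝ} (hf : Continuous f) (hfc : HasCompactSupport f)
    {δ : ℝ} (hδ : 0 < δ) :
    ∫⁻ v, ENNReal.ofReal (f (proj Δ v)) *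
      ∫⁻ u, ENNReal.ofReal (kernelM Δ k l δ u v) ∂frameMeasure Δ N ∂frameMeasure Δ N' ≠ ∞ := by
  obtain ⟨s, -, hs⟩ := exists_finset_ofReal htf N N' hk1 hl1 hk hl hkl hf hfc δ
  obtain ⟨b, hb⟩ := hfc.exists_bound_of_continuous hf
  rw [hs δ hδ le_rfl]
  -- Averages of a function bounded by b are bounded by b, and there are finitely many of them.
  refine ENNReal.sum_ne_top.mpr fun p _ => ne_top_of_le_ne_top (b := ENNReal.ofReal b)
    ENNReal.ofReal_ne_top (ballAverage_le hl1 fun y _ => ?_)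
  exact ENNReal.ofReal_le_ofReal ((Real.le_norm_self _).trans (hb _))

theorem tendsto_lintegral_outer (htf : ∀ g ∈ Δ, g ≠ 1 → ¬ IsOfFinOrder g) (N : GeodesicSubmanifold Δ k)
    (N' : GeodesicSubmanifold Δ l) (hk1 : 1 ≤ k) (hl1 : 1 ≤ l) (hk : k ≤ d) (hl : l ≤ d)
    (hkl : k + l = d) {f : Mfd Δ → ℝ} (hf : Continuous f) (hfc : HasCompactSupport f) :
    Tendsto (fun δ => ∫⁻ v, ENNReal.ofReal (f (proj Δ v)) *
      ∫⁻ u, ENNReal.ofReal (kernelM Δ k l δ u v) ∂frameMeasure Δ N ∂frameMeasure Δ N')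
      (𝓝[>] 0) (𝓝 (∫⁻ x, ENNReal.ofReal (f x) ∂interMeasure N N')) := by
  obtain ⟨s, hs, hsδ⟩ := exists_finset_ofReal htf N N' hk1 hl1 hk hl hkl hf hfc 1
  have hF : Continuous fun x => ENNReal.ofReal (f x) := ENNReal.continuous_ofReal.comp hf
  have h : Tendsto (fun δ => ∑ p ∈ s,
      ballAverage Δ l (fun x => ENNReal.ofReal (f x)) δ (p.frame hl)) (𝓝[>] 0)
      (𝓝 (∑ p ∈ s, ENNReal.ofReal (f p.1))) := by
    refine tendsto_finsetSum s fun p _ => ?_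
    have h1 := tendsto_ballAverage hl1 hF (p.frame hl) ENNReal.ofReal_ne_top
    rwa [p.basePt_frame hl, p.toMfd_point] at h1
  rw [hs]
  refine h.congr' ?_
  filter_upwards [self_mem_nhdsWithin, nhdsWithin_le_nhds (Iic_mem_nhds one_pos)] with δ hδ hδ1
  exact (hsδ δ hδ hδ1).symm

theorem ofReal_mul_integral_kernelM (hk1 : 1 ≤ k) (hk : k ≤ d) (hl : l ≤ d) (hkl : k + l = d)
    (N : GeodesicSubmanifold Δ k) (f : Mfd Δ → ℝ) {δ : ℝ} (hδ : 0 < δ) (v : FrameBundle Δ) :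
    ENNReal.ofReal (f (proj Δ v) * ∫ u, kernelM Δ k l δ u v ∂frameMeasure Δ N) =
      ENNReal.ofReal (f (proj Δ v)) *
        ∫⁻ u, ENNReal.ofReal (kernelM Δ k l δ u v) ∂frameMeasure Δ N := by
  rw [ENNReal.ofReal_mul' (integral_nonneg fun u => kernelM_nonneg Δ k l δ u v),
    ofReal_integral_kernelM hk1 hk hl hkl N hδ]

theorem integrable_interMeasure (htf : ∀ g ∈ Δ, g ≠ 1 → ¬ IsOfFinOrder g) (N : GeodesicSubmanifold Δ k)
    (N' : GeodesicSubmanifold Δ l) (hk1 : 1 ≤ k) (hl1 : 1 ≤ l) (hk : k ≤ d) (hl : l ≤ d)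
    (hkl : k + l = d) {f : Mfd Δ → ℝ} (hf : Continuous f) (hfc : HasCompactSupport f) :
    Integrable f (interMeasure N N') := by
  refine ⟨(measurable_of_continuous_mfd hf).aestronglyMeasurable, ?_⟩
  rw [hasFiniteIntegral_iff_norm]
  exact (lintegral_interMeasure_ne_top htf N N' hk1 hl1 hk hl hkl hf.norm hfc.norm).lt_top

theorem integrable_outer (htf : ∀ g ∈ Δ, g ≠ 1 → ¬ IsOfFinOrder g) (N : GeodesicSubmanifold Δ k)
    (N' : GeodesicSubmanifold Δ l) (hk1 : 1 ≤ k) (hl1 : 1 ≤ l) (hk : k ≤ d) (hl : l ≤ d)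
    (hkl : k + l = d) {f : Mfd Δ → ℝ} (hf : Continuous f) (hfc : HasCompactSupport f)
    {δ : ℝ} (hδ : 0 < δ) :
    Integrable (fun v => f (proj Δ v) * ∫ u, kernelM Δ k l δ u v ∂frameMeasure Δ N)
      (frameMeasure Δ N') := by
  have hm : Measurable fun v => f (proj Δ v) * ∫ u, kernelM Δ k l δ u v ∂frameMeasure Δ N := by
    simp only [integral_kernelM hk hl N hδ]
    exact ((measurable_of_continuous_mfd hf).comp (measurable_proj Δ)).mul
      (measurable_lintegral_kernelM hk hl N hδ).ennreal_toReal
  refine ⟨hm.aestronglyMeasurable, ?_⟩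
  rw [hasFiniteIntegral_iff_norm]
  have h : ∀ v, ENNReal.ofReal ‖f (proj Δ v) * ∫ u, kernelM Δ k l δ u v ∂frameMeasure Δ N‖ =
      ENNReal.ofReal ‖f (proj Δ v)‖ *
        ∫⁻ u, ENNReal.ofReal (kernelM Δ k l δ u v) ∂frameMeasure Δ N := fun v => by
    rw [norm_mul, Real.norm_of_nonneg (integral_nonneg fun u => kernelM_nonneg Δ k l δ u v)]
    exact ofReal_mul_integral_kernelM hk1 hk hl hkl N (fun x => ‖f x‖) hδ v
  simp only [h]
  exact (lintegral_outer_ne_top htf N N' hk1 hl1 hk hl hkl hf.norm hfc.norm hδ).lt_top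

theorem tendsto_integral_outer (htf : ∀ g ∈ Δ, g ≠ 1 → ¬ IsOfFinOrder g) (N : GeodesicSubmanifold Δ k)
    (N' : GeodesicSubmanifold Δ l) (hk1 : 1 ≤ k) (hl1 : 1 ≤ l) (hk : k ≤ d) (hl : l ≤ d)
    (hkl : k + l = d) {f : Mfd Δ → ℝ} (hf : Continuous f) (hfc : HasCompactSupport f) :
    Tendsto (fun δ => ∫ v, f (proj Δ v) * ∫ u, kernelM Δ k l δ u v ∂frameMeasure Δ N
      ∂frameMeasure Δ N') (𝓝[>] 0) (𝓝 (∫ x, f x ∂interMeasure N N')) := by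
  have hfc' : HasCompactSupport fun x => -f x := hfc.neg
  -- `ENNReal.ofReal` truncates at zero, so applying the limit to f and to -f treats the positive
  -- and the negative part.
  have h1 := (ENNReal.tendsto_toReal (lintegral_interMeasure_ne_top htf N N' hk1 hl1 hk hl hkl hf
    hfc)).comp (tendsto_lintegral_outer htf N N' hk1 hl1 hk hl hkl hf hfc)
  have h2 := (ENNReal.tendsto_toReal (lintegral_interMeasure_ne_top htf N N' hk1 hl1 hk hl hkl
    hf.neg hfc')).comp (tendsto_lintegral_outer htf N N' hk1 hl1 hk hl hkl hf.neg hfc')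
  rw [integral_eq_lintegral_pos_part_sub_lintegral_neg_part
    (integrable_interMeasure htf N N' hk1 hl1 hk hl hkl hf hfc)]
  refine (h1.sub h2).congr' ?_
  filter_upwards [self_mem_nhdsWithin] with δ hδ
  rw [integral_eq_lintegral_pos_part_sub_lintegral_neg_part
    (integrable_outer htf N N' hk1 hl1 hk hl hkl hf hfc hδ)]
  simp only [← neg_mul, ofReal_mul_integral_kernelM hk1 hk hl hkl N f hδ,
    ofReal_mul_integral_kernelM hk1 hk hl hkl N (fun x => -f x) hδ, Function.comp_apply]
  rfl

end Limit

/-! ### Finite formal sums of submanifolds with weights -/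

section Sums

theorem integrable_finsupp_sum {ι α E : Type*} [MeasurableSpace α] [NormedAddCommGroup E]
    (Γ : ι →₀ ℝ≥0) {μ : ι → Measure α} {g : α → E} (hg : ∀ i, Integrable g (μ i)) :
    Integrable g (Γ.sum fun i a => a • μ i) :=
  integrable_finsetSum_measure.mpr fun i _ => (hg i).smul_measure_nnreal

theorem integral_finsupp_sum {ι α : Type*} [MeasurableSpace α] (Γ : ι →₀ ℝ≥0) {μ : ι → Measure α}
    {g : α → ℝ} (hg : ∀ i, Integrable g (μ i)) :
    ∫ x, g x ∂(Γ.sum fun i a => a • μ i) = ∑ i ∈ Γ.support, (Γ i : ℝ) * ∫ x, g x ∂μ i := by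
  rw [Finsupp.sum, integral_finsetSum_measure fun i _ => (hg i).smul_measure_nnreal]
  refine Finset.sum_congr rfl fun i _ => ?_
  rw [integral_smul_nnreal_measure]
  rfl

/-- The product of weights is separated so that the formula for a single weighted sum can be applied
twice. -/
theorem sumInterMeasure_eq {d k l : ℕ} {Δ : Subgroup (SOplus d)}
    (Γ : GeodesicSubmanifold Δ k →₀ ℝ≥0) (S : GeodesicSubmanifold Δ l →₀ ℝ≥0) :
    sumInterMeasure Γ S = Γ.sum fun N a => a • S.sum fun N' b => b • interMeasure N N' := by
  simp only [sumInterMeasure, Finsupp.sum, Finset.smul_sum, mul_smul]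

end Sums

end HypGeom

theorem mainTheorem8 (d k : ℕ) (hk : 1 ≤ k) (hkd : k + 1 ≤ d)
    (Δ : Subgroup (HypGeom.SOplus d)) [DiscreteTopology Δ]
    (htf : ∀ g ∈ Δ, g ≠ 1 → ¬ IsOfFinOrder g)
    (Γ : HypGeom.GeodesicSubmanifold Δ k →₀ ℝ≥0)
    (S : HypGeom.GeodesicSubmanifold Δ (d - k) →₀ ℝ≥0)
    (f : HypGeom.Mfd Δ → ℝ) (hf : Continuous f) (hfc : HasCompactSupport f) :
    Integrable f (HypGeom.sumInterMeasure Γ S) ∧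
    (∀ δ : ℝ, 0 < δ →
      (∀ v : HypGeom.FrameBundle Δ,
        Integrable (fun u => f (HypGeom.proj Δ v) * HypGeom.kernelM Δ k (d - k) δ u v)
          (HypGeom.sumFrameMeasure Δ Γ)) ∧
      Integrable (fun v => ∫ u, f (HypGeom.proj Δ v) * HypGeom.kernelM Δ k (d - k) δ u v
          ∂(HypGeom.sumFrameMeasure Δ Γ)) (HypGeom.sumFrameMeasure Δ S)) ∧
    Tendsto (fun δ : ℝ => ∫ v, ∫ u,
        f (HypGeom.proj Δ v) * HypGeom.kernelM Δ k (d - k) δ u v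
          ∂(HypGeom.sumFrameMeasure Δ Γ) ∂(HypGeom.sumFrameMeasure Δ S))
      (𝓝[>] 0) (𝓝 (∫ x, f x ∂(HypGeom.sumInterMeasure Γ S))) := by
  have hl1 : 1 ≤ d - k := by omega
  have hk' : k ≤ d := by omega
  have hl : d - k ≤ d := Nat.sub_le d k
  have hkl : k + (d - k) = d := Nat.add_sub_cancel' hk'
  have hI := fun N N' => HypGeom.integrable_interMeasure htf N N' hk hl1 hk' hl hkl hf hfc
  have hK : ∀ δ : ℝ, 0 < δ → ∀ v N, Integrable
      (fun u => f (HypGeom.proj Δ v) * HypGeom.kernelM Δ k (d - k) δ u v)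
      (HypGeom.frameMeasure Δ N) := fun δ hδ v N =>
    (HypGeom.integrable_kernelM hk hk' hl hkl N hδ v).const_mul _
  have hinner : ∀ δ : ℝ, 0 < δ → ∀ v,
      ∫ u, f (HypGeom.proj Δ v) * HypGeom.kernelM Δ k (d - k) δ u v
        ∂(HypGeom.sumFrameMeasure Δ Γ) = ∑ N ∈ Γ.support, (Γ N : ℝ) *
          (f (HypGeom.proj Δ v) *
            ∫ u, HypGeom.kernelM Δ k (d - k) δ u v ∂HypGeom.frameMeasure Δ N) := by
    intro δ hδ v
    rw [HypGeom.sumFrameMeasure, HypGeom.integral_finsupp_sum Γ (hK δ hδ v)]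
    simp only [integral_const_mul]
  have hO := fun (δ : ℝ) (hδ : 0 < δ) N N' =>
    HypGeom.integrable_outer htf N N' hk hl1 hk' hl hkl hf hfc hδ
  have hO' := fun (δ : ℝ) (hδ : 0 < δ) N' => integrable_finsetSum Γ.support
    fun N _ => (hO δ hδ N N').const_mul (Γ N : ℝ)
  refine ⟨?_, fun δ hδ => ⟨fun v => HypGeom.integrable_finsupp_sum Γ (hK δ hδ v), ?_⟩, ?_⟩
  · rw [HypGeom.sumInterMeasure_eq]
    exact HypGeom.integrable_finsupp_sum Γ fun N => HypGeom.integrable_finsupp_sum S (hI N)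
  · simp only [hinner δ hδ]
    exact HypGeom.integrable_finsupp_sum S (hO' δ hδ)
  · rw [HypGeom.sumInterMeasure_eq, HypGeom.integral_finsupp_sum Γ fun N =>
      HypGeom.integrable_finsupp_sum S (hI N)]
    simp only [HypGeom.integral_finsupp_sum S (hI _)]
    have hlim := tendsto_finsetSum Γ.support fun N _ => (tendsto_finsetSum S.support
      fun N' _ => (HypGeom.tendsto_integral_outer htf N N' hk hl1 hk' hl hkl hf hfc).const_mul
        (S N' : ℝ)).const_mul (Γ N : ℝ)
    refine hlim.congr' ?_
    filter_upwards [self_mem_nhdsWithin] with δ hδ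
    simp only [hinner δ hδ]
    rw [HypGeom.sumFrameMeasure, HypGeom.integral_finsupp_sum S (hO' δ hδ)]
    simp only [integral_finsetSum _ fun N _ => (hO δ hδ N _).const_mul (Γ N : ℝ),
      integral_const_mul, Finset.mul_sum]
    -- The iterated integral has the sum over S outermost, the intersection measure the sum over Γ.
    rw [Finset.sum_comm]
    refine Finset.sum_congr rfl fun N' _ => Finset.sum_congr rfl fun N _ => ?_
    ring
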